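/- Let $n\ge 1$, $m=2n-1$, $I_{m+1,1}=\mathrm{diag}(1,\dots,1,-1)$, and let $G=\mathrm{Spin}(2n,1)$ (the double cover of $\mathrm{SO}_e(2n,1)$), acting by the adjoint action on $\mathfrak g=\mathfrak{so}(2n,1)=\{X\in M_{m+2}(\mathbb R): XI_{m+1,1}+I_{m+1,1}X^t=0\}$. For row vectors $\alpha,\beta\in\mathbb R^m$, $Y\in\mathfrak{so}(m)$ and $c\in\mathbb R$ put $$X_\alpha=\begin{pmatrix}0&-\alpha^t&\alpha^t\\ \alpha&0&0\\ \alpha&0&0\end{pmatrix},\quad H_0=\begin{pmatrix}0_m&0&0\\0&0&1\\0&1&0\end{pmatrix},\quad X_{Y,\beta,c}=\begin{pmatrix}Y&\beta^t&\beta^t\\-\beta&0&c\\ \beta&c&0\end{pmatrix}.$$ Let $\mathfrak n=\{X_\alpha\}$, $\mathfrak a=\mathbb RH_0$, $\mathfrak m=\{\mathrm{diag}(Y,0,0):Y\in\mathfrak{so}(m)\}$, $\mathfrak l=\mathfrak m+\mathfrak a$, $\mathfrak p=\mathfrak l+\mathfrak n$, and let $P=MAN\subset G$ be the corresponding parabolic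 subgroup, i.e. the preimage of $\mathrm{SO}(m)\exp(\mathfrak a)\exp(\mathfrak n)\subset \mathrm{SO}_e(2n,1)$. Define $\mathrm{pr}\colon\mathfrak g\to\mathfrak p^*$ by $\mathrm{pr}(X)(Z)=\tfrac12\mathrm{tr}(XZ)$. A coadjoint $P$-orbit $\mathcal O\subset\mathfrak p^*$ has depth zero if it is contained in $\mathfrak l^*$ (the functionals on $\mathfrak p$ vanishing on $\mathfrak n$), and depth one otherwise. Every depth one orbit contains an element $\mathrm{pr}(X_{Y,\beta,0})$ with $Y\in\mathfrak{so}(m)$, $\beta\ne0$ and $Y\beta^t=0$. The sign of the Pfaffian of $\mathcal O$ is the sign of the Pfaffian of the $2n\times 2n$ matrix $$Z_{Y,\beta}=\begin{pmatrix}Y&\beta^t/|\beta|\\-\beta/|\beta|&0\end{pmatrix},$$ and the singular values of $\mathcal O$ are the numbers $x_1\ge\dots\ge x_{n-1}\ge0$ such that $\{x_1,x_1,\dots,x_{n-1},x_{n-1},0\}$ is the multiset of singular values of $Y$; these depend only on $\mathcal O$. Let $a_1>a_2>\dots>a_{n-1}>|a_n|>0$, let $t_{\vec a}\in\mathfrak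 g$ be the block diagonal matrix with blocks $\begin{pmatrix}0&a_i\\-a_i&0\end{pmatrix}$, $1\le i\le n$, followed by a zero entry, let $f\in\mathfrak g^*$ be given by $f(X)=\tfrac12\mathrm{tr}(t_{\vec a}X)$, let $\mathcal O_f=G\cdot f$, and let $q\colon\mathcal O_f\to\mathfrak p^*$ be the restriction map (the moment map). Then $q(\mathcal O_f)$ is the union of all depth one coadjoint $P$-orbits in $\mathfrak p^*$ whose Pfaffian sign is the sign of $a_n$ and whose singular values $(x_1,\dots,x_{n-1})$ satisfy $$a_1\ge x_1\ge a_2\ge x_2\ge\dots\ge a_{n-1}\ge x_{n-1}\ge|a_n|.$$ Moreover, $q$ maps each $P$-orbit in $\mathcal O_f$ onto a $P$-orbit in $\mathfrak p^*$, and maps different $P$-orbits in $\mathcal O_f$ to different $P$-orbits in $\mathfrak p^*$. -/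

import Mathlib

open scoped Matrix

namespace SpinOrbit

/-- Index set of `ℝ^{m+2}`: the coordinates `1, …, m`, followed by the two coordinates
`m+1` (space-like) and `m+2` (time-like). -/
abbrev Idx (m : ℕ) : Type := Fin m ⊕ Fin 2

/-- The signs `(1, …, 1, 1, -1)` of the form of signature `(m+1, 1)`. -/
def sgn (m : ℕ) : Idx m → ℝ := Sum.elim (fun _ => 1) ![1, -1]

/-- The matrix `I_{m+1,1}`. -/
def lorentz (m : ℕ) : Matrix (Idx m) (Idx m) ℝ := Matrix.diagonal (sgn m)

/-- The quadratic form `x₁² + ⋯ + x_{m+1}² - x_{m+2}²`. -/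
noncomputable def quadForm (m : ℕ) : QuadraticForm ℝ (Idx m → ℝ) :=
  QuadraticMap.weightedSumSquares ℝ (sgn m)

/-- `G = Spin(m+1,1)`, inside the Clifford algebra. The unitarity condition in `spinGroup` forces
spinor norm one, so this is the two-fold cover of the identity component `SO_e(m+1,1)`. -/
abbrev Spin (m : ℕ) : Type := spinGroup (quadForm m)

/-! ### The vector representation of `G` -/

theorem iota_injective (m : ℕ) : Function.Injective (CliffordAlgebra.ι (quadForm m)) := by
  intro x y h
  have h2 := congrArg (CliffordAlgebra.equivExterior (quadForm m)) h
  have key : ∀ v, CliffordAlgebra.equivExterior (quadForm m) (CliffordAlgebra.ι (quadForm m) v)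
      = ExteriorAlgebra.ι ℝ v := fun v =>
    CliffordAlgebra.changeForm_ι CliffordAlgebra.changeForm.associated_neg_proof v
  rw [key, key] at h2
  exact (ExteriorAlgebra.ι_inj ℝ x y).1 h2

theorem conj_mem_range {m : ℕ} (g : Spin m) (v : Idx m → ℝ) :
    (g : CliffordAlgebra (quadForm m)) * CliffordAlgebra.ι (quadForm m) v
      * ((g⁻¹ : Spin m) : CliffordAlgebra (quadForm m))
      ∈ LinearMap.range (CliffordAlgebra.ι (quadForm m)) := by
  have h := spinGroup.conjAct_smul_ι_mem_range_ι (Q := quadForm m)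
    (x := spinGroup.toUnits g) g.2 v
  rw [ConjAct.units_smul_def, ConjAct.ofConjAct_toConjAct] at h
  exact h

/-- The endomorphism `v ↦ g v g⁻¹` of `ℝ^{m+2}` (the vectors sit in the Clifford algebra). -/
noncomputable def vecEnd {m : ℕ} (g : Spin m) : (Idx m → ℝ) →ₗ[ℝ] (Idx m → ℝ) :=
  (LinearEquiv.ofInjective (CliffordAlgebra.ι (quadForm m)) (iota_injective m)).symm.toLinearMap ∘ₗ
    LinearMap.codRestrict (LinearMap.range (CliffordAlgebra.ι (quadForm m)))
      ((LinearMap.mulRight ℝ ((g⁻¹ : Spin m) : CliffordAlgebra (quadForm m))) ∘ₗ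
        (LinearMap.mulLeft ℝ (g : CliffordAlgebra (quadForm m))) ∘ₗ
          CliffordAlgebra.ι (quadForm m))
      (fun v => conj_mem_range g v)

theorem iota_vecEnd {m : ℕ} (g : Spin m) (v : Idx m → ℝ) :
    CliffordAlgebra.ι (quadForm m) (vecEnd g v)
      = (g : CliffordAlgebra (quadForm m)) * CliffordAlgebra.ι (quadForm m) v
        * ((g⁻¹ : Spin m) : CliffordAlgebra (quadForm m)) := by
  have h := LinearEquiv.apply_symm_apply
    (LinearEquiv.ofInjective (CliffordAlgebra.ι (quadForm m)) (iota_injective m))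
    ⟨_, conj_mem_range g v⟩
  exact congrArg Subtype.val h

/-- The vector representation of `G = Spin(m+1,1)` on `ℝ^{m+2}`. -/
noncomputable def vecRep (m : ℕ) : Representation ℝ (Spin m) (Idx m → ℝ) where
  toFun := vecEnd
  map_one' := by
    apply LinearMap.ext
    intro v
    apply iota_injective m
    simp [iota_vecEnd]
  map_mul' g h := by
    apply LinearMap.ext
    intro v
    apply iota_injective m
    simp [iota_vecEnd, mul_assoc]

/-- The covering homomorphism `G → G₁ = SO_e(m+1,1)`, `g ↦ g₁`, as a map into matrices. -/
noncomputable def toMat (m : ℕ) : Spin m →* Matrix (Idx m) (Idx m) ℝ :=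
  (LinearMap.toMatrixAlgEquiv' : _ ≃ₐ[ℝ] Matrix (Idx m) (Idx m) ℝ).toAlgHom.toMonoidHom.comp
    (vecRep m)

theorem toMat_mulVec {m : ℕ} (g : Spin m) (v : Idx m → ℝ) : toMat m g *ᵥ v = vecEnd g v := by
  have : toMat m g = LinearMap.toMatrix' (vecEnd g) := rfl
  rw [this, LinearMap.toMatrix'_mulVec]

theorem quadForm_vecEnd {m : ℕ} (g : Spin m) (v : Idx m → ℝ) :
    quadForm m (vecEnd g v) = quadForm m v := by
  have h := CliffordAlgebra.ι_sq_scalar (quadForm m) (vecEnd g v)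
  have hg : ((g⁻¹ : Spin m) : CliffordAlgebra (quadForm m)) * g = 1 := 
    congrArg Subtype.val (inv_mul_cancel g)
  have hg' : (g : CliffordAlgebra (quadForm m)) * ((g⁻¹ : Spin m) : CliffordAlgebra (quadForm m)) = 1 := 
    congrArg Subtype.val (mul_inv_cancel g)
  have e : CliffordAlgebra.ι (quadForm m) (vecEnd g v) * CliffordAlgebra.ι (quadForm m) (vecEnd g v)
      = algebraMap ℝ _ (quadForm m v) := by
    rw [iota_vecEnd]
    calc _ = (g : CliffordAlgebra (quadForm m)) * CliffordAlgebra.ι (quadForm m) v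
          * (((g⁻¹ : Spin m) : CliffordAlgebra (quadForm m)) * (g : CliffordAlgebra (quadForm m))) * CliffordAlgebra.ι (quadForm m) v
          * ((g⁻¹ : Spin m) : CliffordAlgebra (quadForm m)) := by simp only [mul_assoc]
      _ = (g : CliffordAlgebra (quadForm m)) * (CliffordAlgebra.ι (quadForm m) v
          * CliffordAlgebra.ι (quadForm m) v) * ((g⁻¹ : Spin m) : CliffordAlgebra (quadForm m)) := by
            rw [hg, mul_one]; simp only [mul_assoc]
      _ = _ := by
            rw [CliffordAlgebra.ι_sq_scalar, ← Algebra.commutes, mul_assoc, hg', mul_one]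
  rw [e] at h
  exact ((algebraMap ℝ (CliffordAlgebra (quadForm m))).injective h).symm

theorem polar_quadForm {m : ℕ} (v w : Idx m → ℝ) :
    QuadraticMap.polar (quadForm m) v w = 2 * (v ⬝ᵥ (lorentz m *ᵥ w)) := by
  simp only [QuadraticMap.polar, quadForm, QuadraticMap.weightedSumSquares_apply, dotProduct,
    lorentz, Matrix.mulVec_diagonal, Finset.mul_sum, ← Finset.sum_sub_distrib, Pi.add_apply,
    smul_eq_mul]
  exact Finset.sum_congr rfl fun i _ => by ring

/-- Elements of `G` act on `ℝ^{m+2}` by matrices in `O(m+1,1)`. -/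
theorem toMat_transpose_mul {m : ℕ} (g : Spin m) :
    (toMat m g)ᵀ * lorentz m * toMat m g = lorentz m := by
  have h : ∀ v w : Idx m → ℝ,
      v ⬝ᵥ (((toMat m g)ᵀ * lorentz m * toMat m g) *ᵥ w) = v ⬝ᵥ (lorentz m *ᵥ w) := by
    intro v w
    have h1 := polar_quadForm (vecEnd g v) (vecEnd g w)
    have h2 := polar_quadForm v w
    have h3 : QuadraticMap.polar (quadForm m) (vecEnd g v) (vecEnd g w)
        = QuadraticMap.polar (quadForm m) v w := by
      simp only [QuadraticMap.polar, ← map_add, quadForm_vecEnd]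
    have h4 : vecEnd g v ⬝ᵥ (lorentz m *ᵥ vecEnd g w) = v ⬝ᵥ (lorentz m *ᵥ w) := by linarith
    rw [← h4, ← toMat_mulVec, ← toMat_mulVec, ← Matrix.mulVec_mulVec, ← Matrix.mulVec_mulVec,
      Matrix.mulVec_transpose, dotProduct_comm, ← Matrix.dotProduct_mulVec, dotProduct_comm]
  ext i j
  have := h (Pi.single i 1) (Pi.single j 1)
  simpa using this

theorem toMat_inv_mul {m : ℕ} (g : Spin m) : toMat m g⁻¹ * toMat m g = 1 := by
  rw [← map_mul, inv_mul_cancel, map_one]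

theorem toMat_mul_inv {m : ℕ} (g : Spin m) : toMat m g * toMat m g⁻¹ = 1 := by
  rw [← map_mul, mul_inv_cancel, map_one]

/-! ### The Lie algebra `𝔤 = 𝔰𝔬(m+1,1)` and the adjoint representation of `G` -/

/-- `𝔤 = 𝔰𝔬(m+1,1) = {X : X I_{m+1,1} + I_{m+1,1} Xᵗ = 0}`, as a vector space of matrices. -/
def lieG (m : ℕ) : Submodule ℝ (Matrix (Idx m) (Idx m) ℝ) where
  carrier := {X | X * lorentz m + lorentz m * Xᵀ = 0}
  zero_mem' := by simp
  add_mem' := by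
    intro X Y hX hY
    simp only [Set.mem_ofPred_eq] at hX hY ⊢
    have : (X + Y) * lorentz m + lorentz m * (X + Y)ᵀ
        = (X * lorentz m + lorentz m * Xᵀ) + (Y * lorentz m + lorentz m * Yᵀ) := by
      rw [Matrix.transpose_add]; noncomm_ring
    rw [this, hX, hY, add_zero]
  smul_mem' := by
    intro c X hX
    simp only [Set.mem_ofPred_eq] at hX ⊢
    rw [Matrix.transpose_smul, Matrix.smul_mul, Matrix.mul_smul, ← smul_add, hX, smul_zero]

theorem mem_lieG {m : ℕ} (X : Matrix (Idx m) (Idx m) ℝ) :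
    X ∈ lieG m ↔ X * lorentz m + lorentz m * Xᵀ = 0 := Iff.rfl

theorem lorentz_mul_self (m : ℕ) : lorentz m * lorentz m = 1 := by
  rw [lorentz, Matrix.diagonal_mul_diagonal, ← Matrix.diagonal_one]
  congr 1
  funext i
  rcases i with i | i
  · simp [sgn]
  · fin_cases i <;> simp [sgn]

theorem mem_lieG' {m : ℕ} (X : Matrix (Idx m) (Idx m) ℝ) :
    X ∈ lieG m ↔ Xᵀ * lorentz m + lorentz m * X = 0 := by
  have e := lorentz_mul_self m
  have key : ∀ A B : Matrix (Idx m) (Idx m) ℝ, A * lorentz m + lorentz m * B = 0 →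
      B * lorentz m + lorentz m * A = 0 := by
    intro A B h
    calc B * lorentz m + lorentz m * A
        = (lorentz m * lorentz m) * B * lorentz m
            + lorentz m * A * (lorentz m * lorentz m) := by rw [e, one_mul, mul_one]
      _ = lorentz m * (A * lorentz m + lorentz m * B) * lorentz m := by noncomm_ring
      _ = 0 := by rw [h, mul_zero, zero_mul]
  exact ⟨key _ _, key _ _⟩

theorem conj_mem_lieG {m : ℕ} (g : Spin m) {X : Matrix (Idx m) (Idx m) ℝ} (hX : X ∈ lieG m) :
    toMat m g * X * toMat m g⁻¹ ∈ lieG m := by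
  rw [mem_lieG'] at hX ⊢
  set A := toMat m g
  set B := toMat m g⁻¹
  set J := lorentz m
  have hB : Bᵀ * J * B = J := toMat_transpose_mul g⁻¹
  have hA : Aᵀ * J * A = J := toMat_transpose_mul g
  have hAB : A * B = 1 := toMat_mul_inv g
  have hBA : Bᵀ * Aᵀ = 1 := by rw [← Matrix.transpose_mul, hAB, Matrix.transpose_one]
  have h1 : Aᵀ * J = J * B := by
    calc Aᵀ * J = Aᵀ * J * (A * B) := by rw [hAB, mul_one]
      _ = (Aᵀ * J * A) * B := by simp only [mul_assoc]
      _ = J * B := by rw [hA]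
  have h2 : J * A = Bᵀ * J := by
    calc J * A = (Bᵀ * Aᵀ) * J * A := by rw [hBA, one_mul]
      _ = Bᵀ * (Aᵀ * J * A) := by simp only [mul_assoc]
      _ = Bᵀ * J := by rw [hA]
  calc (A * X * B)ᵀ * J + J * (A * X * B)
      = Bᵀ * Xᵀ * (Aᵀ * J) + (J * A) * X * B := by
        simp only [Matrix.transpose_mul, mul_assoc]
    _ = Bᵀ * (Xᵀ * J + J * X) * B := by rw [h1, h2]; noncomm_ring
    _ = 0 := by rw [hX, mul_zero, zero_mul]

/-- The adjoint representation `Ad(g) X = g₁ X g₁⁻¹` of `G` on `𝔤`. -/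
noncomputable def adG (m : ℕ) : Representation ℝ (Spin m) (lieG m) where
  toFun g :=
    { toFun := fun X => ⟨toMat m g * X.1 * toMat m g⁻¹, conj_mem_lieG g X.2⟩
      map_add' := fun X Y => by ext1; simp [mul_add, add_mul]
      map_smul' := fun c X => by ext1; simp }
  map_one' := by
    apply LinearMap.ext
    intro X
    ext1
    simp
  map_mul' g h := by
    apply LinearMap.ext
    intro X
    ext1
    simp [mul_assoc]

/-! ### The parabolic subalgebra `𝔭 = 𝔪 + 𝔞 + 𝔫` and the parabolic subgroup `P = MAN` -/

/-- `𝔰𝔬(m)`: skew-symmetric `m × m` matrices. -/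
def so (m : ℕ) : Submodule ℝ (Matrix (Fin m) (Fin m) ℝ) where
  carrier := {Y | Yᵀ = -Y}
  zero_mem' := by simp
  add_mem' := by
    intro X Y hX hY
    simp only [Set.mem_ofPred_eq] at hX hY ⊢
    rw [Matrix.transpose_add, hX, hY, neg_add]
  smul_mem' := by
    intro c X hX
    simp only [Set.mem_ofPred_eq] at hX ⊢
    rw [Matrix.transpose_smul, hX, smul_neg]

/-- `𝔪 = {diag(Y, 0, 0) : Y ∈ 𝔰𝔬(m)}`. -/
def lieM (m : ℕ) : Submodule ℝ (Matrix (Idx m) (Idx m) ℝ) where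
  carrier := {X | ∃ Y ∈ so m, X = Matrix.fromBlocks Y 0 0 0}
  zero_mem' := ⟨0, (so m).zero_mem, by simp⟩
  add_mem' := by
    rintro _ _ ⟨Y, hY, rfl⟩ ⟨Z, hZ, rfl⟩
    exact ⟨Y + Z, (so m).add_mem hY hZ, by simp [Matrix.fromBlocks_add]⟩
  smul_mem' := by
    rintro c _ ⟨Y, hY, rfl⟩
    exact ⟨c • Y, (so m).smul_mem c hY, by simp [Matrix.fromBlocks_smul]⟩

/-- The generator `H₀` of `𝔞`. -/
def H0 (m : ℕ) : Matrix (Idx m) (Idx m) ℝ := Matrix.fromBlocks 0 0 0 !![0, 1; 1, 0]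

/-- `𝔞 = ℝ H₀`. -/
def lieA (m : ℕ) : Submodule ℝ (Matrix (Idx m) (Idx m) ℝ) := Submodule.span ℝ {H0 m}

/-- The nilpotent matrix `X_α` with rows `(0, -αᵗ, αᵗ)`, `(α, 0, 0)`, `(α, 0, 0)`. -/
def nilX {m : ℕ} (α : Fin m → ℝ) : Matrix (Idx m) (Idx m) ℝ :=
  Matrix.fromBlocks 0 (Matrix.of fun i => ![-α i, α i]) (Matrix.of ![α, α]) 0

theorem nilX_zero (m : ℕ) : nilX (0 : Fin m → ℝ) = 0 := by
  ext i j
  rcases i with i | i <;> rcases j with j | j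
  · simp [nilX]
  · fin_cases j <;> simp [nilX]
  · fin_cases i <;> simp [nilX]
  · simp [nilX]

/-- `𝔫 = {X_α : α ∈ ℝ^m}`. -/
def lieN (m : ℕ) : Submodule ℝ (Matrix (Idx m) (Idx m) ℝ) where
  carrier := {X | ∃ α : Fin m → ℝ, X = nilX α}
  zero_mem' := ⟨0, (nilX_zero m).symm⟩
  add_mem' := by
    rintro _ _ ⟨α, rfl⟩ ⟨β, rfl⟩
    refine ⟨α + β, ?_⟩
    ext i j
    rcases i with i | i <;> rcases j with j | j
    · simp [nilX]
    · fin_cases j <;> simp [nilX]; ring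
    · fin_cases i <;> simp [nilX]
    · simp [nilX]
  smul_mem' := by
    rintro c _ ⟨α, rfl⟩
    refine ⟨c • α, ?_⟩
    ext i j
    rcases i with i | i <;> rcases j with j | j
    · simp [nilX]
    · fin_cases j <;> simp [nilX]
    · fin_cases i <;> simp [nilX]
    · simp [nilX]

/-- The parabolic subalgebra `𝔭 = 𝔪 + 𝔞 + 𝔫`. -/
def lieP (m : ℕ) : Submodule ℝ (Matrix (Idx m) (Idx m) ℝ) := lieM m ⊔ lieA m ⊔ lieN m

theorem mem_lieP {m : ℕ} {X : Matrix (Idx m) (Idx m) ℝ} : X ∈ lieP m ↔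
    ∃ Y ∈ so m, ∃ (t : ℝ) (α : Fin m → ℝ),
      X = Matrix.fromBlocks Y 0 0 0 + t • H0 m + nilX α := by
  rw [lieP, Submodule.mem_sup]
  constructor
  · rintro ⟨_, h, _, ⟨α, rfl⟩, rfl⟩
    obtain ⟨_, ⟨Y, hY, rfl⟩, _, h2, rfl⟩ := Submodule.mem_sup.1 h
    obtain ⟨t, rfl⟩ := Submodule.mem_span_singleton.1 h2
    exact ⟨Y, hY, t, α, rfl⟩
  · rintro ⟨Y, hY, t, α, rfl⟩
    exact ⟨_, Submodule.add_mem_sup ⟨Y, hY, rfl⟩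
      (Submodule.smul_mem _ t (Submodule.mem_span_singleton_self _)), _, ⟨α, rfl⟩, rfl⟩

/-- Entrywise form of the equation defining `𝔤`. -/
theorem mem_lieG_iff_entry {m : ℕ} (X : Matrix (Idx m) (Idx m) ℝ) :
    X ∈ lieG m ↔ ∀ i j, X i j * sgn m j + sgn m i * X j i = 0 := by
  rw [mem_lieG, ← Matrix.ext_iff]
  simp [lorentz, Matrix.mul_diagonal, Matrix.diagonal_mul]

theorem so_entry {m : ℕ} {Y : Matrix (Fin m) (Fin m) ℝ} (hY : Y ∈ so m) (i j : Fin m) :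
    Y j i = -Y i j := congrFun (congrFun (show Yᵀ = -Y from hY) i) j

theorem lieP_le_lieG (m : ℕ) : lieP m ≤ lieG m := by
  intro X hX
  obtain ⟨Y, hY, t, α, rfl⟩ := mem_lieP.1 hX
  rw [mem_lieG_iff_entry]
  intro i j
  rcases i with i | i <;> rcases j with j | j
  · simp [sgn, H0, nilX, so_entry hY i j]
  · fin_cases j <;> simp [sgn, H0, nilX]
  · fin_cases i <;> simp [sgn, H0, nilX]
  · fin_cases i <;> fin_cases j <;> simp [sgn, H0, nilX]

/-- The null vector `(0, …, 0, 1, 1)`. -/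
def nullVec (m : ℕ) : Idx m → ℝ := Sum.elim 0 1

theorem mem_lieP_iff_eigen {m : ℕ} {X : Matrix (Idx m) (Idx m) ℝ} :
    X ∈ lieP m ↔ X ∈ lieG m ∧ ∃ c : ℝ, X *ᵥ nullVec m = c • nullVec m := by
  constructor
  · intro hX
    refine ⟨lieP_le_lieG m hX, ?_⟩
    obtain ⟨Y, hY, t, α, rfl⟩ := mem_lieP.1 hX
    refine ⟨t, ?_⟩
    ext i
    rcases i with i | i
    · simp [Matrix.mulVec, dotProduct, nullVec, H0, nilX]
    · fin_cases i <;> simp [Matrix.mulVec, dotProduct, nullVec, H0, nilX]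
  · rintro ⟨hX, c, hc⟩
    rw [mem_lieG_iff_entry] at hX
    have hB : ∀ i : Fin m, X (Sum.inl i) (Sum.inr 0) = -X (Sum.inl i) (Sum.inr 1) := by
      intro i
      have := congrFun hc (Sum.inl i)
      simp [Matrix.mulVec, dotProduct, nullVec] at this
      linarith
    refine mem_lieP.2 ⟨Matrix.of fun i j => X (Sum.inl i) (Sum.inl j), ?_, X (Sum.inr 0) (Sum.inr 1),
      fun i => X (Sum.inl i) (Sum.inr 1), ?_⟩
    · change Matrix.transpose _ = _
      ext i j
      have := hX (Sum.inl i) (Sum.inl j)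
      simp [sgn] at this
      simp
      linarith
    · ext i j
      rcases i with i | i <;> rcases j with j | j
      · simp [H0, nilX]
      · fin_cases j
        · simpa [H0, nilX] using hB i
        · simp [H0, nilX]
      · have h0 := hX (Sum.inr i) (Sum.inl j)
        have h1 := hB j
        fin_cases i
        · simp [sgn] at h0
          simp [H0, nilX]
          linarith
        · simp [sgn] at h0
          simp [H0, nilX]
          linarith
      · have h0 := hX (Sum.inr i) (Sum.inr j)
        fin_cases i <;> fin_cases j <;> simp [sgn] at h0 <;> simp [H0, nilX] <;> linarith

/-- Elements `diag(Y, 1, 1)`, `Y ∈ SO(m)`, of `M₁`. -/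
def mGrp {m : ℕ} (Y : Matrix (Fin m) (Fin m) ℝ) : Matrix (Idx m) (Idx m) ℝ :=
  Matrix.fromBlocks Y 0 0 1

/-- Elements `exp(t H₀)` of `A₁`. -/
noncomputable def aGrp (m : ℕ) (t : ℝ) : Matrix (Idx m) (Idx m) ℝ :=
  Matrix.fromBlocks 1 0 0 !![Real.cosh t, Real.sinh t; Real.sinh t, Real.cosh t]

/-- Elements `n_α = exp(X_α)` of `N₁`. -/
noncomputable def nGrp {m : ℕ} (α : Fin m → ℝ) : Matrix (Idx m) (Idx m) ℝ :=
  1 + nilX α + (1 / 2 : ℝ) • (nilX α * nilX α)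

theorem nilX_sq {m : ℕ} (α β : Fin m → ℝ) :
    nilX α * nilX β = (α ⬝ᵥ β) • Matrix.fromBlocks 0 0 0 !![-1, 1; -1, 1] := by
  ext i j
  rcases i with i | i <;> rcases j with j | j
  · simp [nilX, Matrix.mul_apply]
  · simp [nilX, Matrix.mul_apply]
  · simp [nilX, Matrix.mul_apply]
  · fin_cases i <;> fin_cases j <;> simp [nilX, Matrix.mul_apply, dotProduct]

theorem mGrp_mul {m : ℕ} (Y Z : Matrix (Fin m) (Fin m) ℝ) : mGrp Y * mGrp Z = mGrp (Y * Z) := by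
  simp [mGrp, Matrix.fromBlocks_multiply]

theorem mGrp_one (m : ℕ) : mGrp (1 : Matrix (Fin m) (Fin m) ℝ) = 1 := by
  simp [mGrp]

theorem aGrp_mul (m : ℕ) (s t : ℝ) : aGrp m s * aGrp m t = aGrp m (s + t) := by
  simp only [aGrp, Matrix.fromBlocks_multiply]
  simp [Real.cosh_add, Real.sinh_add, add_comm]

theorem aGrp_zero (m : ℕ) : aGrp m 0 = 1 := by
  simp [aGrp, ← Matrix.one_fin_two]

theorem nGrp_zero (m : ℕ) : nGrp (0 : Fin m → ℝ) = 1 := by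
  simp [nGrp, nilX_zero]

theorem nilX_add {m : ℕ} (α β : Fin m → ℝ) : nilX (α + β) = nilX α + nilX β := by
  ext i j
  rcases i with i | i <;> rcases j with j | j
  · simp [nilX]
  · fin_cases j <;> simp [nilX]; ring
  · fin_cases i <;> simp [nilX]
  · simp [nilX]

theorem nilX_cube {m : ℕ} (α β γ : Fin m → ℝ) : nilX α * (nilX β * nilX γ) = 0 := by
  rw [nilX_sq]
  ext i j
  rcases i with i | i <;> rcases j with j | j
  · simp [nilX, Matrix.mul_apply]
  · fin_cases j <;> simp [nilX, Matrix.mul_apply]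
  · simp [nilX, Matrix.mul_apply]
  · simp [nilX, Matrix.mul_apply]

theorem nGrp_mul {m : ℕ} (α β : Fin m → ℝ) : nGrp α * nGrp β = nGrp (α + β) := by
  have hc : nilX β * nilX α = nilX α * nilX β := by rw [nilX_sq, nilX_sq, dotProduct_comm]
  have h1 : nilX α * nilX α * nilX β = 0 := by rw [mul_assoc, nilX_cube]
  have h2 : nilX α * nilX α * (nilX β * nilX β) = 0 := by rw [mul_assoc, nilX_cube, mul_zero]
  simp only [nGrp, nilX_add, mul_add, add_mul, mul_one, one_mul, Matrix.smul_mul, Matrix.mul_smul,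
    h1, h2, nilX_cube, hc, smul_add, smul_zero]
  module

theorem nGrp_mul_mGrp {m : ℕ} (α : Fin m → ℝ) {Y : Matrix (Fin m) (Fin m) ℝ}
    (hY : Y * Yᵀ = 1) : nGrp α * mGrp Y = mGrp Y * nGrp (Yᵀ *ᵥ α) := by
  have h1 : nilX α * mGrp Y = mGrp Y * nilX (Yᵀ *ᵥ α) := by
    have hv : ∀ i, ∑ x, Y i x * (Yᵀ *ᵥ α) x = α i := by
      intro i
      have := congrFun (Matrix.mulVec_mulVec α Y Yᵀ) i
      rw [hY, Matrix.one_mulVec] at this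
      exact this
    ext i j
    rcases i with i | i <;> rcases j with j | j
    · simp [nilX, mGrp, Matrix.mul_apply]
    · fin_cases j <;> simp [nilX, mGrp, Matrix.mul_apply, Matrix.one_apply, hv]
    · fin_cases i <;>
        simp [nilX, mGrp, Matrix.mul_apply, Matrix.one_apply, Matrix.mulVec, dotProduct, mul_comm]
    · fin_cases j <;> simp [nilX, mGrp, Matrix.mul_apply]
  simp only [nGrp, mul_add, add_mul, mul_one, one_mul, Matrix.smul_mul, Matrix.mul_smul, h1]
  congr 2
  rw [mul_assoc, h1, ← mul_assoc, h1, mul_assoc]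

theorem nGrp_mul_aGrp {m : ℕ} (α : Fin m → ℝ) (t : ℝ) :
    nGrp α * aGrp m t = aGrp m t * nGrp (Real.exp (-t) • α) := by
  have h1 : nilX α * aGrp m t = aGrp m t * nilX (Real.exp (-t) • α) := by
    have e1 : Real.exp (-t) = Real.cosh t - Real.sinh t := (Real.cosh_sub_sinh t).symm
    have e2 := Real.cosh_sq_sub_sinh_sq t
    unfold aGrp
    generalize Real.exp (-t) = r at e1 ⊢
    generalize Real.cosh t = p at e1 e2 ⊢
    generalize Real.sinh t = q at e1 e2 ⊢
    ext i j
    rcases i with i | i <;> rcases j with j | j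
    · simp [nilX, Matrix.mul_apply]
    · fin_cases j <;> simp [nilX, Matrix.mul_apply, Matrix.one_apply, e1] <;> ring
    · fin_cases i <;> simp [nilX, Matrix.mul_apply, Matrix.one_apply, e1] <;>
        linear_combination (-α j) * e2
    · fin_cases j <;> simp [nilX, Matrix.mul_apply]
  simp only [nGrp, mul_add, add_mul, mul_one, one_mul, Matrix.smul_mul, Matrix.mul_smul, h1]
  congr 2
  rw [mul_assoc, h1, ← mul_assoc, h1, mul_assoc]

theorem mGrp_mul_aGrp {m : ℕ} (Y : Matrix (Fin m) (Fin m) ℝ) (t : ℝ) :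
    mGrp Y * aGrp m t = aGrp m t * mGrp Y := by
  simp [mGrp, aGrp, Matrix.fromBlocks_multiply]

theorem man_mul_man {m : ℕ} {Y Z : Matrix (Fin m) (Fin m) ℝ} (hZ : Z * Zᵀ = 1) (s t : ℝ)
    (α β : Fin m → ℝ) :
    (mGrp Y * aGrp m s * nGrp α) * (mGrp Z * aGrp m t * nGrp β)
      = mGrp (Y * Z) * aGrp m (s + t) * nGrp (Real.exp (-t) • (Zᵀ *ᵥ α) + β) := by
  calc (mGrp Y * aGrp m s * nGrp α) * (mGrp Z * aGrp m t * nGrp β)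
      = mGrp Y * aGrp m s * (nGrp α * mGrp Z) * aGrp m t * nGrp β := by simp only [mul_assoc]
    _ = mGrp Y * (aGrp m s * mGrp Z) * (nGrp (Zᵀ *ᵥ α) * aGrp m t) * nGrp β := by
        rw [nGrp_mul_mGrp α hZ]; simp only [mul_assoc]
    _ = (mGrp Y * mGrp Z) * (aGrp m s * aGrp m t)
          * (nGrp (Real.exp (-t) • (Zᵀ *ᵥ α)) * nGrp β) := by
        rw [nGrp_mul_aGrp, ← mGrp_mul_aGrp]; simp only [mul_assoc]
    _ = _ := by rw [mGrp_mul, aGrp_mul, nGrp_mul]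

/-- The parabolic subgroup `P = MAN` of `G`. Since `M = Z_K(𝔞)` contains the kernel `{±1}` of
`G → G₁`, it is the full preimage of `P₁ = M₁A₁N₁`. -/
def parabolic (m : ℕ) : Subgroup (Spin m) where
  carrier := {g | ∃ Y ∈ Matrix.specialOrthogonalGroup (Fin m) ℝ, ∃ (t : ℝ) (α : Fin m → ℝ),
    toMat m g = mGrp Y * aGrp m t * nGrp α}
  one_mem' := ⟨1, one_mem _, 0, 0, by
    rw [map_one, mGrp_one, aGrp_zero, nGrp_zero, mul_one, mul_one]⟩
  mul_mem' := by
    rintro g h ⟨Y, hY, s, α, hg⟩ ⟨Z, hZ, t, β, hh⟩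
    have hZ' : Z * Zᵀ = 1 :=
      (Matrix.mem_orthogonalGroup_iff (Fin m) ℝ).1 (Matrix.mem_specialOrthogonalGroup_iff.1 hZ).1
    exact ⟨Y * Z, mul_mem hY hZ, _, _, by rw [map_mul, hg, hh, man_mul_man hZ']⟩
  inv_mem' := by
    rintro g ⟨Y, hY, s, α, hg⟩
    have hY1 := Matrix.mem_specialOrthogonalGroup_iff.1 hY
    have hY2 : Y * Yᵀ = 1 := (Matrix.mem_orthogonalGroup_iff (Fin m) ℝ).1 hY1.1
    have hY3 : Yᵀ * Y = 1 := (Matrix.mem_orthogonalGroup_iff' (Fin m) ℝ).1 hY1.1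
    refine ⟨Yᵀ, ?_, -s, -(Real.exp s • (Y *ᵥ α)), ?_⟩
    · refine Matrix.mem_specialOrthogonalGroup_iff.2 ⟨?_, ?_⟩
      · refine (Matrix.mem_orthogonalGroup_iff (Fin m) ℝ).2 ?_
        exact hY3
      · rw [Matrix.det_transpose, hY1.2]
    · have key : toMat m g * (mGrp Yᵀ * aGrp m (-s) * nGrp (-(Real.exp s • (Y *ᵥ α)))) = 1 := by
        rw [hg, man_mul_man (by rw [Matrix.transpose_transpose, hY3]), hY2, mGrp_one,
          add_neg_cancel, aGrp_zero, Matrix.transpose_transpose, neg_neg, add_neg_cancel,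
          nGrp_zero, mul_one, mul_one]
      calc toMat m g⁻¹ = toMat m g⁻¹ * (toMat m g *
            (mGrp Yᵀ * aGrp m (-s) * nGrp (-(Real.exp s • (Y *ᵥ α))))) := by rw [key, mul_one]
        _ = _ := by rw [← mul_assoc, toMat_inv_mul, one_mul]

theorem parabolic_mulVec {m : ℕ} {g : Spin m} (hg : g ∈ parabolic m) :
    ∃ c : ℝ, toMat m g *ᵥ nullVec m = c • nullVec m := by
  obtain ⟨Y, -, t, α, h⟩ := hg
  refine ⟨Real.exp t, ?_⟩
  have h1 : nGrp α *ᵥ nullVec m = nullVec m := by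
    rw [nGrp, nilX_sq, Matrix.add_mulVec, Matrix.add_mulVec, Matrix.one_mulVec]
    ext i
    rcases i with i | i
    · simp [Matrix.mulVec, dotProduct, nullVec, nilX]
    · fin_cases i <;> simp [Matrix.mulVec, dotProduct, nullVec, nilX]
  have h2 : aGrp m t *ᵥ nullVec m = Real.exp t • nullVec m := by
    ext i
    rcases i with i | i
    · simp [Matrix.mulVec, dotProduct, nullVec, aGrp]
    · fin_cases i <;> simp [Matrix.mulVec, dotProduct, nullVec, aGrp]
  have h3 : mGrp Y *ᵥ nullVec m = nullVec m := by
    ext i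
    rcases i with i | i
    · simp [Matrix.mulVec, dotProduct, nullVec, mGrp]
    · fin_cases i <;> simp [Matrix.mulVec, dotProduct, nullVec, mGrp]
  rw [h, ← Matrix.mulVec_mulVec, ← Matrix.mulVec_mulVec, h1, h2, Matrix.mulVec_smul, h3]

theorem conj_mem_lieP {m : ℕ} {g : Spin m} (hg : g ∈ parabolic m)
    {X : Matrix (Idx m) (Idx m) ℝ} (hX : X ∈ lieP m) :
    toMat m g * X * toMat m g⁻¹ ∈ lieP m := by
  rw [mem_lieP_iff_eigen] at hX ⊢
  refine ⟨conj_mem_lieG g hX.1, ?_⟩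
  obtain ⟨c, hc⟩ := hX.2
  obtain ⟨d, hd⟩ := parabolic_mulVec hg
  obtain ⟨e, he⟩ := parabolic_mulVec ((parabolic m).inv_mem hg)
  refine ⟨e * c * d, ?_⟩
  rw [← Matrix.mulVec_mulVec, ← Matrix.mulVec_mulVec, he, Matrix.mulVec_smul, hc,
    Matrix.mulVec_smul, Matrix.mulVec_smul, hd, smul_smul, smul_smul]

/-- The adjoint representation of `P` on `𝔭`. -/
noncomputable def adP (m : ℕ) : Representation ℝ (parabolic m) (lieP m) where
  toFun g :=
    { toFun := fun X => ⟨toMat m g * X.1 * toMat m (g : Spin m)⁻¹, conj_mem_lieP g.2 X.2⟩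
      map_add' := fun X Y => by ext1; simp [mul_add, add_mul]
      map_smul' := fun c X => by ext1; simp }
  map_one' := by
    apply LinearMap.ext
    intro X
    ext1
    simp
  map_mul' g h := by
    apply LinearMap.ext
    intro X
    ext1
    simp [mul_assoc]

/-! ### Coadjoint representations, moment map, orbits -/

/-- The coadjoint representation of `G` on `𝔤*`. -/
noncomputable def coadG (m : ℕ) : Representation ℝ (Spin m) (Module.Dual ℝ (lieG m)) :=
  (adG m).dual

/-- The coadjoint representation of `P` on `𝔭*`. -/
noncomputable def coadP (m : ℕ) : Representation ℝ (parabolic m) (Module.Dual ℝ (lieP m)) :=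
  (adP m).dual

/-- The coadjoint orbit `G · f` in `𝔤*`. -/
def orbitG {m : ℕ} (f : Module.Dual ℝ (lieG m)) : Set (Module.Dual ℝ (lieG m)) :=
  Set.range fun g : Spin m => coadG m g f

/-- The orbit `P · f` in `𝔤*` of the subgroup `P` of `G`. -/
def orbitPG {m : ℕ} (f : Module.Dual ℝ (lieG m)) : Set (Module.Dual ℝ (lieG m)) :=
  Set.range fun g : parabolic m => coadG m g f

/-- The coadjoint orbit `P · φ` in `𝔭*`. -/
def orbitP {m : ℕ} (φ : Module.Dual ℝ (lieP m)) : Set (Module.Dual ℝ (lieP m)) :=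
  Set.range fun g : parabolic m => coadP m g φ

/-- The restriction map `𝔤* → 𝔭*`; on a coadjoint orbit of `G` it is the moment map `q`. -/
def moment (m : ℕ) : Module.Dual ℝ (lieG m) →ₗ[ℝ] Module.Dual ℝ (lieP m) :=
  (Submodule.inclusion (lieP_le_lieG m)).dualMap

/-- `ι : 𝔤 → 𝔤*`, `ι(X)(Y) = ½ tr(XY)`. -/
noncomputable def iota (m : ℕ) (X : lieG m) : Module.Dual ℝ (lieG m) where
  toFun Y := (1 / 2 : ℝ) * Matrix.trace (X.1 * Y.1)
  map_add' Y Z := by simp [mul_add]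
  map_smul' c Y := by simp; ring

/-- `pr : 𝔤 → 𝔭*`, `pr(X)(Y) = ½ tr(XY)`. -/
noncomputable def pr (m : ℕ) (X : lieG m) : Module.Dual ℝ (lieP m) := moment m (iota m X)

/-- `𝒪` is a coadjoint orbit of `P` in `𝔭*`. -/
def IsOrbitP {m : ℕ} (𝒪 : Set (Module.Dual ℝ (lieP m))) : Prop := ∃ φ, 𝒪 = orbitP φ

/-- The subspace `𝔩* ⊆ 𝔭*`, `𝔩 = 𝔪 + 𝔞 ≅ 𝔭/𝔫`: the functionals on `𝔭` vanishing on `𝔫`. -/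
def leviDual (m : ℕ) : Set (Module.Dual ℝ (lieP m)) :=
  {φ | ∀ X : lieP m, X.1 ∈ lieN m → φ X = 0}

/-- An orbit has depth zero if it is contained in `𝔩*`, and depth one otherwise. -/
def DepthOne {m : ℕ} (𝒪 : Set (Module.Dual ℝ (lieP m))) : Prop := ¬ 𝒪 ⊆ leviDual m

/-! ### Elliptic elements of `𝔤*` for `m = 2n - 1` -/

/-- The index in `{1, …, m+2}` of (zero-based) number `j`. -/
def idx (m j : ℕ) (h : j < m + 2) : Idx m := finSumFinEquiv.symm ⟨j, h⟩

/-- `t_a`, with diagonal blocks `(0, a_i; -a_i, 0)` for `i = 1, …, n` and a last diagonal entry `0`.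
Here `n = k + 1` and `m + 2 = 2n + 1 = 2k + 3`. -/
def tMat {k : ℕ} (a : Fin (k + 1) → ℝ) : Matrix (Idx (2 * k + 1)) (Idx (2 * k + 1)) ℝ :=
  ∑ i : Fin (k + 1),
    (Matrix.single (idx (2 * k + 1) (2 * i) (by omega)) (idx (2 * k + 1) (2 * i + 1) (by omega)) (a i)
      - Matrix.single (idx (2 * k + 1) (2 * i + 1) (by omega)) (idx (2 * k + 1) (2 * i) (by omega))
        (a i))

theorem sgn_idx (m j : ℕ) (h : j < m + 2) (h' : j < m + 1) : sgn m (idx m j h) = 1 := by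
  unfold idx
  by_cases hj : j < m
  · have : finSumFinEquiv.symm (⟨j, h⟩ : Fin (m + 2)) = Sum.inl ⟨j, hj⟩ := by
      rw [Equiv.symm_apply_eq]; rfl
    rw [this]; rfl
  · have e : j = m := by omega
    subst e
    have : finSumFinEquiv.symm (⟨j, h⟩ : Fin (j + 2)) = Sum.inr 0 := by
      rw [Equiv.symm_apply_eq]; rfl
    rw [this]; rfl

theorem single_sub_single_mem {m : ℕ} {p q : Idx m} (hp : sgn m p = 1) (hq : sgn m q = 1) (c : ℝ) :
    Matrix.single p q c - Matrix.single q p c ∈ lieG m := by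
  rw [mem_lieG_iff_entry]
  intro i j
  simp only [Matrix.sub_apply, Matrix.single_apply]
  by_cases h1 : p = i <;> by_cases h2 : q = j <;> by_cases h3 : q = i <;> by_cases h4 : p = j <;>
    simp [h1, h2, h3, h4] <;> subst_vars <;> simp_all

theorem tMat_mem {k : ℕ} (a : Fin (k + 1) → ℝ) : tMat a ∈ lieG (2 * k + 1) :=
  Submodule.sum_mem _ fun i _ =>
    single_sub_single_mem (sgn_idx _ _ _ (by omega)) (sgn_idx _ _ _ (by omega)) _

/-- `f_a = ι(t_a) ∈ 𝔤*`. -/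
noncomputable def fElt {k : ℕ} (a : Fin (k + 1) → ℝ) : Module.Dual ℝ (lieG (2 * k + 1)) :=
  iota _ ⟨tMat a, tMat_mem a⟩

/-! ### Normal forms and invariants of the depth one orbits -/

/-- `X_{Y,β,c}` with rows `(Y, βᵗ, βᵗ)`, `(-β, 0, c)`, `(β, c, 0)`. -/
def xMat {m : ℕ} (Y : Matrix (Fin m) (Fin m) ℝ) (β : Fin m → ℝ) (c : ℝ) :
    Matrix (Idx m) (Idx m) ℝ :=
  Matrix.fromBlocks Y (Matrix.of fun i => ![β i, β i]) (Matrix.of ![-β, β]) !![0, c; c, 0]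

theorem xMat_mem {m : ℕ} (Y : so m) (β : Fin m → ℝ) (c : ℝ) : xMat Y.1 β c ∈ lieG m := by
  rw [mem_lieG_iff_entry]
  intro i j
  rcases i with i | i <;> rcases j with j | j
  · simp [sgn, xMat, so_entry Y.2 i j]
  · fin_cases j <;> simp [sgn, xMat]
  · fin_cases i <;> simp [sgn, xMat]
  · fin_cases i <;> fin_cases j <;> simp [sgn, xMat]

/-- `pr(X_{Y,β,0})` is a normal form of `𝒪`: it lies in `𝒪`, with `β ≠ 0` and `Yβᵗ = 0`.
Every depth one orbit has one. -/
def IsNormalForm {m : ℕ} (𝒪 : Set (Module.Dual ℝ (lieP m))) (Y : so m) (β : Fin m → ℝ) : Prop :=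
  β ≠ 0 ∧ Y.1 *ᵥ β = 0 ∧ pr m ⟨xMat Y.1 β 0, xMat_mem Y β 0⟩ ∈ 𝒪

/-- The skew-symmetric `(m+1) × (m+1)` matrix `Z_{Y,β} = (Y, βᵗ/|β|; -β/|β|, 0)`, `m + 1 = 2n`,
`n = k + 1`, where `|β|` is the Euclidean norm. -/
noncomputable def zMat {k : ℕ} (Y : Matrix (Fin (2 * k + 1)) (Fin (2 * k + 1)) ℝ)
    (β : Fin (2 * k + 1) → ℝ) : Matrix (Fin (2 * (k + 1))) (Fin (2 * (k + 1))) ℝ :=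
  Matrix.reindex (finSumFinEquiv.trans (finCongr (by ring))) (finSumFinEquiv.trans (finCongr (by ring)))
    (Matrix.fromBlocks Y (Matrix.of fun i (_ : Fin 1) => β i / √(β ⬝ᵥ β))
      (Matrix.of fun (_ : Fin 1) j => -(β j / √(β ⬝ᵥ β))) 0)

/-- The Pfaffian of a skew-symmetric `2n × 2n` matrix. -/
noncomputable def pfaffian {n : ℕ} (A : Matrix (Fin (2 * n)) (Fin (2 * n)) ℝ) : ℝ :=
  (1 / (2 ^ n * n.factorial : ℝ)) * ∑ σ : Equiv.Perm (Fin (2 * n)),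
    ((Equiv.Perm.sign σ : ℤ) : ℝ) *
      ∏ i : Fin n, A (σ ⟨2 * i, by omega⟩) (σ ⟨2 * i + 1, by omega⟩)

/-- The sign of the Pfaffian of the depth one orbit `𝒪` is `ε`. -/
def HasPfaffianSign {k : ℕ} (𝒪 : Set (Module.Dual ℝ (lieP (2 * k + 1)))) (ε : SignType) : Prop :=
  ∃ Y β, IsNormalForm 𝒪 Y β ∧ SignType.sign (pfaffian (zMat Y.1 β)) = ε

/-- The singular values of a matrix `Y`, with multiplicity: square roots of the eigenvalues
of `Yᵗ Y`. -/
noncomputable def singularValues {m : ℕ} (Y : Matrix (Fin m) (Fin m) ℝ) : Multiset ℝ :=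
  (Yᵀ * Y).charpoly.roots.map Real.sqrt

/-- The depth one orbit `𝒪` has singular values `(x₁, …, x_{n-1})`, `n - 1 = k`: for a normal form
`pr(X_{Y,β,0})`, the singular values of `Y` are `{x₁, x₁, …, x_{n-1}, x_{n-1}, 0}`. -/
def HasSingularValues {k : ℕ} (𝒪 : Set (Module.Dual ℝ (lieP (2 * k + 1)))) (x : Fin k → ℝ) :
    Prop :=
  ∃ Y β, IsNormalForm 𝒪 Y β ∧
    singularValues Y.1 = Finset.univ.val.map x + Finset.univ.val.map x + {0}

/-- `a₁ ≥ x₁ ≥ a₂ ≥ ⋯ ≥ a_{n-1} ≥ x_{n-1} ≥ |a_n|`, `n = k + 1`. -/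
def Interlaces {k : ℕ} (a : Fin (k + 1) → ℝ) (x : Fin k → ℝ) : Prop :=
  ∀ i : Fin k, x i ≤ a i.castSucc ∧
    (if i.succ = Fin.last k then |a (Fin.last k)| else a i.succ) ≤ x i

/-- `a₁ > a₂ > ⋯ > a_{n-1} > |a_n| > 0`, `n = k + 1`. -/
def IsRegularParam {k : ℕ} (a : Fin (k + 1) → ℝ) : Prop :=
  (∀ i : Fin k, (if i.succ = Fin.last k then |a (Fin.last k)| else a i.succ) < a i.castSucc) ∧
    0 < |a (Fin.last k)|

end SpinOrbit

open SpinOrbit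

/-! Write `ν` for `nullVec`. The group `P` is the stabilizer of the ray through `ν`, and `pr X`
records precisely the `𝔰𝔬(m)` block of `X` and the vector `X ν`; what it forgets is a summand in `𝔫`
(`pr_eq_iff`, `eq_nilX`). The main invariant is the bordered determinant `bord X ν r`, that is `det
(r - X, ν; ⟨ν, ·⟩, 0)`. It is unchanged when an element of `𝔫` is added to `X` (`bord_add_nilX`), so
it descends to a function of `pr X`, and it is equivariant under isometries (`bord_conj`).

This invariant is computed twice. On a normal form, `r * bord = 4|β|² det(r - Y)` (`bord_xMat`). For
`X = g t_a g⁻¹` it can be moved back to `t_a` and the null vector `u = g⁻¹ν`, where it equals `∑ w_i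
∏_{j≠i} (r² + a_j²)` with `w_i = a_i² |z_i|²`, `z_i` being the `i`-th pair of coordinates of `u`
(`bord_tMat`). Comparing at `r² = -s` gives `∑ w_i ∏_{j≠i} (a_j² - s) = 4|β|² ∏ (x_l² - s)`.
Polynomials of the left-hand form with nonnegative weights, not all zero, are the positive multiples
of those whose zeros interlace the `a_j²` (`interlace_of_weights`, `exists_weights`).

The Pfaffian sign comes from the bivector `X I_{m+1,1} = g t_a gᵗ`. Modulo `ν` it becomes a matrix
like `Z_{Y,β}`, and it is congruent to the space part of `t_a` by a matrix whose determinant is the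
time coordinate of `g⁻¹ν`. This is positive because `G` preserves the future cone, so the sign is
that of `∏ a_i`, hence that of the last entry (`sign_spacePf`).

Conversely, interlacing values give weights, weights give a future null vector, and `G` is
transitive on these, so some point of the orbit has the prescribed invariants. Two normal forms with
the same characteristic polynomial and the same nonzero Pfaffian sign are `P`-conjugate
(`exists_parabolic_of_charpoly_eq`), which puts every admissible `P`-orbit in the image.

For separation of orbits: equal restrictions have equal bordered determinants, hence equal weights.
Null vectors `g⁻¹ν`, `g'⁻¹ν` with equal weights differ by a torus element `s` commuting with `t_a`,
and `g' s g⁻¹` fixes `ν`, so it lies in `P` (`exists_parabolic_of_pr_eq`). -/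

namespace SpinOrbit

/-! ### The Lorentz form, and the image of `Spin` in the matrices: determinant, future cone,
products of reflections. -/

/-- The Lorentzian bilinear form on `ℝ^{m+2}`. -/
noncomputable def lip {m : ℕ} (v w : Idx m → ℝ) : ℝ := v ⬝ᵥ (lorentz m *ᵥ w)

theorem lip_eq {m : ℕ} (v w : Idx m → ℝ) :
    lip v w = ∑ i : Fin m, v (.inl i) * w (.inl i) + v (.inr 0) * w (.inr 0)
      - v (.inr 1) * w (.inr 1) := by
  simp [lip, lorentz, Matrix.mulVec_diagonal, dotProduct, sgn]
  ring

theorem lip_comm {m : ℕ} (v w : Idx m → ℝ) : lip v w = lip w v := by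
  simp only [lip_eq, mul_comm]

theorem lip_add_left {m : ℕ} (u v w : Idx m → ℝ) : lip (u + v) w = lip u w + lip v w :=
  add_dotProduct _ _ _

theorem lip_smul_left {m : ℕ} (c : ℝ) (v w : Idx m → ℝ) : lip (c • v) w = c * lip v w :=
  smul_dotProduct _ _ _

theorem lip_sub_left {m : ℕ} (u v w : Idx m → ℝ) : lip (u - v) w = lip u w - lip v w :=
  sub_dotProduct _ _ _

theorem lip_add_right {m : ℕ} (u v w : Idx m → ℝ) : lip u (v + w) = lip u v + lip u w := by
  rw [lip_comm, lip_add_left, lip_comm v, lip_comm w]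

theorem lip_sub_right {m : ℕ} (u v w : Idx m → ℝ) : lip u (v - w) = lip u v - lip u w := by
  rw [lip_comm, lip_sub_left, lip_comm v, lip_comm w]

theorem lip_smul_right {m : ℕ} (c : ℝ) (v w : Idx m → ℝ) : lip v (c • w) = c * lip v w := by
  rw [lip_comm, lip_smul_left, lip_comm w]

theorem lip_mulVec {m : ℕ} {g : Matrix (Idx m) (Idx m) ℝ} (hg : gᵀ * lorentz m * g = lorentz m)
    (v w : Idx m → ℝ) : lip (g *ᵥ v) (g *ᵥ w) = lip v w := by
  unfold lip
  conv_rhs => rw [← hg]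
  rw [← Matrix.mulVec_mulVec, ← Matrix.mulVec_mulVec, Matrix.dotProduct_mulVec v,
    Matrix.vecMul_transpose]

theorem quadForm_eq_lip {m : ℕ} (v : Idx m → ℝ) : quadForm m v = lip v v := by
  have h := polar_quadForm v v
  rw [QuadraticMap.polar_self] at h
  have : (2 : ℝ) * quadForm m v = 2 * lip v v := by simpa [lip] using h
  linarith

/-- The reflection in `vᗮ`, for `v` of norm one. -/
noncomputable def lrefl {m : ℕ} (v : Idx m → ℝ) : Matrix (Idx m) (Idx m) ℝ :=
  1 - (2 : ℝ) • Matrix.vecMulVec v (lorentz m *ᵥ v)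

theorem lrefl_mulVec {m : ℕ} (v w : Idx m → ℝ) :
    lrefl v *ᵥ w = w - (2 * lip v w) • v := by
  rw [lrefl, Matrix.sub_mulVec, Matrix.one_mulVec, Matrix.smul_mulVec, Matrix.vecMulVec_mulVec]
  have : (lorentz m *ᵥ v) ⬝ᵥ w = lip v w := by
    rw [lip_comm, lip, dotProduct_comm]
  rw [this]
  ext i
  simp
  ring

/-- The reflection in `w`, multiplied by `⟨w, w⟩`, preserves the future cone. -/
theorem future_of_conj {m : ℕ} (w v : Idx m → ℝ) (hw : lip w w ≠ 0) (hv : lip v v ≤ 0)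
    (hv1 : 0 < v (.inr 1)) :
    0 < lip w w * v (.inr 1) - 2 * lip w v * w (.inr 1) := by
  have e := lip_eq w w
  have e2 := lip_eq v v
  have e3 := lip_eq w v
  set s := v (.inr 1)
  set r := w (.inr 1)
  -- After multiplication by `s > 0` the claim is a sum of squares plus `r² (-⟨v, v⟩)`. If this
  -- vanished, `r v` and `s w` would coincide and `w` would be null.
  have key : s * (lip w w * s - 2 * lip w v * r)
      = (∑ i : Fin m, (r * v (.inl i) - s * w (.inl i)) ^ 2
          + (r * v (.inr 0) - s * w (.inr 0)) ^ 2) + r ^ 2 * (- lip v v) := by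
    have : ∑ i : Fin m, (r * v (.inl i) - s * w (.inl i)) ^ 2
        = r ^ 2 * ∑ i : Fin m, v (.inl i) * v (.inl i)
          - 2 * r * s * ∑ i : Fin m, w (.inl i) * v (.inl i)
          + s ^ 2 * ∑ i : Fin m, w (.inl i) * w (.inl i) := by
      simp only [Finset.mul_sum, ← Finset.sum_sub_distrib, ← Finset.sum_add_distrib]
      exact Finset.sum_congr rfl fun i _ => by ring
    rw [this, e, e2, e3]
    ring
  have h0 : 0 ≤ ∑ i : Fin m, (r * v (.inl i) - s * w (.inl i)) ^ 2 :=
    Finset.sum_nonneg fun i _ => sq_nonneg _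
  have h1 : 0 ≤ (r * v (.inr 0) - s * w (.inr 0)) ^ 2 := sq_nonneg _
  have h2 : 0 ≤ r ^ 2 * (- lip v v) := mul_nonneg (sq_nonneg _) (by linarith)
  by_contra hneg
  have hle : s * (lip w w * s - 2 * lip w v * r) ≤ 0 :=
    mul_nonpos_of_nonneg_of_nonpos hv1.le (not_lt.1 hneg)
  have h0' : ∑ i : Fin m, (r * v (.inl i) - s * w (.inl i)) ^ 2 = 0 := by linarith
  have h1' : (r * v (.inr 0) - s * w (.inr 0)) ^ 2 = 0 := by linarith
  have h2' : r ^ 2 * (- lip v v) = 0 := by linarith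
  have a0 : ∀ i, r * v (.inl i) = s * w (.inl i) := by
    intro i
    have := (Finset.sum_eq_zero_iff_of_nonneg (fun i _ => sq_nonneg _)).1 h0' i (Finset.mem_univ _)
    have := pow_eq_zero_iff (two_ne_zero) |>.1 this
    linarith
  have a1 : r * v (.inr 0) = s * w (.inr 0) := by
    have := pow_eq_zero_iff (two_ne_zero) |>.1 h1'
    linarith
  apply hw
  have : s ^ 2 * lip w w = r ^ 2 * lip v v := by
    rw [e, e2, mul_sub, mul_sub, mul_add, mul_add, Finset.mul_sum, Finset.mul_sum]
    congr 1
    · congr 1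
      · exact Finset.sum_congr rfl fun i _ => by
          linear_combination (-(s * w (.inl i)) - (r * v (.inl i))) * a0 i
      · linear_combination (-(s * w (.inr 0)) - (r * v (.inr 0))) * a1
    · ring
  have : s ^ 2 * lip w w = 0 := by linarith
  rcases mul_eq_zero.1 this with h | h
  · exact absurd h (by positivity)
  · exact h

/-- Data attached to an element `x` of the Lipschitz group: the matrix `R` of conjugation by `x`
and the norm `c = x x*`, whose sign says whether `R` preserves the future cone. -/
def ConjData {k : ℕ} (x : (CliffordAlgebra (quadForm (2 * k + 1)))ˣ) : Prop :=
  ∃ (c : ℝ) (R : Matrix (Idx (2 * k + 1)) (Idx (2 * k + 1)) ℝ),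
    (x : CliffordAlgebra (quadForm (2 * k + 1))) * star (x : CliffordAlgebra _)
      = algebraMap ℝ _ c ∧
    (∀ v, (x : CliffordAlgebra (quadForm (2 * k + 1))) * CliffordAlgebra.ι _ v
      * ((x⁻¹ : (CliffordAlgebra (quadForm (2 * k + 1)))ˣ) : CliffordAlgebra _)
        = CliffordAlgebra.ι _ (R *ᵥ v)) ∧
    R.det = 1 ∧ (∀ v, lip (R *ᵥ v) (R *ᵥ v) = lip v v) ∧
    ∀ v, lip v v ≤ 0 → 0 < v (.inr 1) → 0 < c * (R *ᵥ v) (.inr 1)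

theorem unit_vector_inv {m : ℕ} {x : (CliffordAlgebra (quadForm m))ˣ} {w : Idx m → ℝ}
    (hw : CliffordAlgebra.ι (quadForm m) w = x) :
    lip w w ≠ 0 ∧ ((x⁻¹ : (CliffordAlgebra (quadForm m))ˣ) : CliffordAlgebra (quadForm m))
      = (lip w w)⁻¹ • CliffordAlgebra.ι (quadForm m) w := by
  have hsq := CliffordAlgebra.ι_sq_scalar (quadForm m) w
  have hq : lip w w ≠ 0 := by
    intro h0
    rw [quadForm_eq_lip, h0, map_zero, hw] at hsq
    have := x.mul_left_eq_zero.1 hsq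
    exact x.ne_zero this
  refine ⟨hq, ?_⟩
  have h1 : (x : CliffordAlgebra (quadForm m)) * ((lip w w)⁻¹ • CliffordAlgebra.ι (quadForm m) w)
      = 1 := by
    rw [mul_smul_comm, ← hw, hsq, quadForm_eq_lip,
      Algebra.algebraMap_eq_smul_one, smul_smul, inv_mul_cancel₀ hq, one_smul]
  exact left_inv_eq_right_inv x.inv_mul h1

/-- Conjugation by a vector `w` is minus the reflection in `w`. The dimension `2k + 3` is odd, so
its determinant is `1`. Since `star` negates vectors, the norm is `c = -⟨w, w⟩`, which is why
`future_of_conj` applies. -/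
theorem conjData_vector {k : ℕ} (x : (CliffordAlgebra (quadForm (2 * k + 1)))ˣ)
    (hx : (x : CliffordAlgebra (quadForm (2 * k + 1))) ∈
      Set.range (CliffordAlgebra.ι (quadForm (2 * k + 1)))) : ConjData x := by
  obtain ⟨w, hw⟩ := hx
  have hsq := CliffordAlgebra.ι_sq_scalar (quadForm (2 * k + 1)) w
  obtain ⟨hq, hinv⟩ := unit_vector_inv hw
  have hR : ∀ v, ((2 / lip w w) • Matrix.vecMulVec w (lorentz (2 * k + 1) *ᵥ w) - 1) *ᵥ v
      = (2 * lip w v / lip w w) • w - v := by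
    intro v
    rw [Matrix.sub_mulVec, Matrix.one_mulVec, Matrix.smul_mulVec, Matrix.vecMulVec_mulVec]
    have : (lorentz (2 * k + 1) *ᵥ w) ⬝ᵥ v = lip w v := by
      rw [lip_comm, lip, dotProduct_comm]
    rw [this]
    ext i
    simp
    ring
  refine ⟨-lip w w, (2 / lip w w) • Matrix.vecMulVec w (lorentz (2 * k + 1) *ᵥ w) - 1,
    ?_, ?_, ?_, ?_, ?_⟩
  · rw [← hw, CliffordAlgebra.star_ι, mul_neg, hsq, quadForm_eq_lip, map_neg]
  · intro v
    rw [hinv, ← hw, mul_smul_comm, CliffordAlgebra.ι_mul_ι_mul_ι, ← map_smul, polar_quadForm, hR,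
      quadForm_eq_lip, smul_sub, smul_smul, smul_smul, inv_mul_cancel₀ hq, one_smul]
    congr 3
    simp only [lip]; ring
  · have e : (2 / lip w w) • Matrix.vecMulVec w (lorentz (2 * k + 1) *ᵥ w) - 1
        = -(1 + Matrix.replicateCol Unit (-(2 / lip w w) • w)
            * Matrix.replicateRow Unit (lorentz (2 * k + 1) *ᵥ w)) := by
      rw [← Matrix.vecMulVec_eq, Matrix.smul_vecMulVec, neg_smul]
      abel
    rw [e, Matrix.det_neg, Matrix.det_one_add_replicateCol_mul_replicateRow, dotProduct_smul]
    have : (lorentz (2 * k + 1) *ᵥ w) ⬝ᵥ w = lip w w := by rw [lip, dotProduct_comm]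
    rw [this]
    have h3 : Fintype.card (Idx (2 * k + 1)) = 2 * (k + 1) + 1 := by simp; ring
    rw [h3, pow_succ, pow_mul]
    simp
    field_simp
    norm_num
  · intro v
    rw [hR]
    simp only [lip_sub_left, lip_sub_right, lip_smul_left, lip_smul_right]
    rw [lip_comm v w]
    field_simp
    ring
  · intro v hv hv1
    rw [hR]
    have := future_of_conj w v hq hv hv1
    simp
    field_simp
    linarith

theorem conjData_of_mem {k : ℕ} {x : (CliffordAlgebra (quadForm (2 * k + 1)))ˣ}
    (hx : x ∈ lipschitzGroup (quadForm (2 * k + 1))) : ConjData x := by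
  unfold lipschitzGroup at hx
  induction hx using Subgroup.closure_induction'' with
  | mem x hx => exact conjData_vector x hx
  | inv_mem x hx =>
    apply conjData_vector
    obtain ⟨w, hw⟩ := hx
    exact ⟨(lip w w)⁻¹ • w, by rw [map_smul, (unit_vector_inv hw).2]⟩
  | one =>
    refine ⟨1, 1, ?_, ?_, ?_, ?_, ?_⟩ <;> simp
  | mul x y _ _ hx hy =>
    obtain ⟨c, R, h1, h2, h3, h4, h5⟩ := hx
    obtain ⟨d, S, k1, k2, k3, k4, k5⟩ := hy
    refine ⟨c * d, R * S, ?_, ?_, ?_, ?_, ?_⟩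
    · rw [Units.val_mul, star_mul, mul_assoc, ← mul_assoc y.val, k1,
        Algebra.commutes, ← mul_assoc, h1, map_mul]
    · intro v
      rw [← Matrix.mulVec_mulVec, ← h2, ← k2, mul_inv_rev, Units.val_mul, Units.val_mul]
      simp only [mul_assoc]
    · rw [Matrix.det_mul, h3, k3, one_mul]
    · intro v
      rw [← Matrix.mulVec_mulVec, h4, k4]
    · intro v hv hv1
      rw [← Matrix.mulVec_mulVec]
      have := k5 v hv hv1
      -- For `d < 0` the matrix `S` sends `v` into the past, so the hypothesis on `R` is applied to
      -- `-(S *ᵥ v)`; both signs then cancel in the product `c * d`.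
      rcases lt_trichotomy d 0 with hd | hd | hd
      · have hs : 0 < (-(S *ᵥ v)) (Sum.inr 1) := by
          rw [Pi.neg_apply]; nlinarith
        have := h5 (-(S *ᵥ v)) (by
          have := k4 v
          rw [← Matrix.mulVec_neg, k4, show -v = (-1 : ℝ) • v by simp, lip_smul_left,
            lip_smul_right]
          linarith) hs
        rw [Matrix.mulVec_neg, Pi.neg_apply] at this
        nlinarith
      · simp [hd] at this
      · have := h5 (S *ᵥ v) (by rw [k4]; exact hv) (by nlinarith)
        nlinarith

/-- Unitarity of an element of `spinGroup` forces the norm `c` to be `1`, so the sign in `ConjData`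
disappears and the future cone is preserved. -/
theorem toMat_spec {k : ℕ} (g : Spin (2 * k + 1)) : (toMat _ g).det = 1 ∧
    ∀ v, lip v v ≤ 0 → 0 < v (.inr 1) → 0 < (toMat _ g *ᵥ v) (.inr 1) := by
  obtain ⟨c, R, h1, h2, h3, h4, h5⟩ := conjData_of_mem
    (spinGroup.units_mem_lipschitzGroup (x := spinGroup.toUnits g) g.2)
  have hR : toMat _ g = R := by
    apply Matrix.ext_of_mulVec_single
    intro i
    rw [toMat_mulVec]
    apply iota_injective
    rw [iota_vecEnd, ← h2]
    rfl
  have hc : c = 1 := by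
    have : (g : CliffordAlgebra (quadForm (2 * k + 1))) * star (g : CliffordAlgebra _) = 1 :=
      pinGroup.mul_star_self_of_mem (spinGroup.mem_pin g.2)
    have h1' : (g : CliffordAlgebra (quadForm (2 * k + 1))) * star (g : CliffordAlgebra _)
      = algebraMap ℝ _ c := h1
    rw [this, ← map_one (algebraMap ℝ (CliffordAlgebra (quadForm (2 * k + 1))))] at h1'
    exact ((algebraMap ℝ (CliffordAlgebra (quadForm (2 * k + 1)))).injective h1').symm
  rw [hR]
  refine ⟨h3, fun v hv hv1 => ?_⟩
  have := h5 v hv hv1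
  rwa [hc, one_mul] at this

theorem det_toMat {k : ℕ} (g : Spin (2 * k + 1)) : (toMat _ g).det = 1 := (toMat_spec g).1

theorem toMat_future {k : ℕ} (g : Spin (2 * k + 1)) {v : Idx (2 * k + 1) → ℝ} (hv : lip v v ≤ 0)
    (hv1 : 0 < v (.inr 1)) : 0 < (toMat _ g *ᵥ v) (.inr 1) := (toMat_spec g).2 v hv hv1

theorem iota_mul_iota_mem {m : ℕ} {v w : Idx m → ℝ} (hv : lip v v = 1) (hw : lip w w = 1) :
    CliffordAlgebra.ι (quadForm m) v * CliffordAlgebra.ι (quadForm m) w ∈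
      spinGroup (quadForm m) := by
  have sq : ∀ {v : Idx m → ℝ}, lip v v = 1 →
      CliffordAlgebra.ι (quadForm m) v * CliffordAlgebra.ι (quadForm m) v = 1 := by
    intro v hv
    rw [CliffordAlgebra.ι_sq_scalar, quadForm_eq_lip, hv, map_one]
  let U : ∀ v : Idx m → ℝ, lip v v = 1 → (CliffordAlgebra (quadForm m))ˣ :=
    fun v hv => ⟨CliffordAlgebra.ι (quadForm m) v, CliffordAlgebra.ι (quadForm m) v, sq hv, sq hv⟩
  have hU : ∀ v hv, U v hv ∈ lipschitzGroup (quadForm m) :=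
    fun v hv => Subgroup.subset_closure ⟨v, rfl⟩
  refine spinGroup.mem_iff.2 ⟨pinGroup.mem_iff.2 ⟨⟨U v hv * U w hw, mul_mem (hU v hv) (hU w hw),
    rfl⟩, ?_⟩, CliffordAlgebra.ι_mul_ι_mem_evenOdd_zero _ _ _⟩
  rw [Unitary.mem_iff]
  simp only [star_mul, CliffordAlgebra.star_ι, neg_mul_neg]
  constructor
  · rw [mul_assoc, ← mul_assoc _ _ (CliffordAlgebra.ι (quadForm m) w), sq hv, one_mul, sq hw]
  · rw [mul_assoc, ← mul_assoc _ _ (CliffordAlgebra.ι (quadForm m) v), sq hw, one_mul, sq hv]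

/-- The source of all elements of `G` constructed below. Each unit vector acts by minus a
reflection, and in a product of two the minus signs cancel. -/
theorem lrefl_mul_lrefl_mem {m : ℕ} {v w : Idx m → ℝ} (hv : lip v v = 1) (hw : lip w w = 1) :
    lrefl v * lrefl w ∈ MonoidHom.mrange (toMat m) := by
  have sq : ∀ {v : Idx m → ℝ}, lip v v = 1 →
      CliffordAlgebra.ι (quadForm m) v * CliffordAlgebra.ι (quadForm m) v = 1 := by
    intro v hv
    rw [CliffordAlgebra.ι_sq_scalar, quadForm_eq_lip, hv, map_one]
  have conj : ∀ {v : Idx m → ℝ}, lip v v = 1 → ∀ x,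
      CliffordAlgebra.ι (quadForm m) v * CliffordAlgebra.ι (quadForm m) x
        * CliffordAlgebra.ι (quadForm m) v = CliffordAlgebra.ι (quadForm m) (-(lrefl v *ᵥ x)) := by
    intro v hv x
    rw [CliffordAlgebra.ι_mul_ι_mul_ι, polar_quadForm, quadForm_eq_lip, hv, lrefl_mulVec, neg_sub,
      one_smul, lip]
  let g : Spin m := ⟨_, iota_mul_iota_mem hv hw⟩
  have hg : ((g⁻¹ : Spin m) : CliffordAlgebra (quadForm m))
      = CliffordAlgebra.ι (quadForm m) w * CliffordAlgebra.ι (quadForm m) v := by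
    have h1 : ((g⁻¹ : Spin m) : CliffordAlgebra (quadForm m)) * g = 1 :=
      congrArg Subtype.val (inv_mul_cancel g)
    have h2 : (g : CliffordAlgebra (quadForm m))
        * (CliffordAlgebra.ι (quadForm m) w * CliffordAlgebra.ι (quadForm m) v) = 1 := by
      change CliffordAlgebra.ι (quadForm m) v * CliffordAlgebra.ι (quadForm m) w * _ = 1
      rw [mul_assoc, ← mul_assoc _ _ (CliffordAlgebra.ι (quadForm m) v), sq hw, one_mul, sq hv]
    exact left_inv_eq_right_inv h1 h2
  refine ⟨g, Matrix.ext_of_mulVec_single fun i => ?_⟩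
  rw [toMat_mulVec]
  apply iota_injective
  rw [iota_vecEnd, hg, ← Matrix.mulVec_mulVec]
  have e : ∀ x, (g : CliffordAlgebra (quadForm m)) * CliffordAlgebra.ι (quadForm m) x
      * (CliffordAlgebra.ι (quadForm m) w * CliffordAlgebra.ι (quadForm m) v)
      = CliffordAlgebra.ι (quadForm m) v * (CliffordAlgebra.ι (quadForm m) w
        * CliffordAlgebra.ι (quadForm m) x * CliffordAlgebra.ι (quadForm m) w)
        * CliffordAlgebra.ι (quadForm m) v := by
    intro x
    change CliffordAlgebra.ι (quadForm m) v * CliffordAlgebra.ι (quadForm m) w * _ * _ = _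
    simp only [mul_assoc]
  rw [e, conj hw, conj hv, Matrix.mulVec_neg, neg_neg]

end SpinOrbit

/-! ### Lifting rotations, boosts and unipotents to `Spin`; the parabolic as the stabilizer of a
null line. -/

namespace SpinOrbit

/-- The coordinates `1, …, m+1` followed by the time coordinate. -/
def spaceTime (m : ℕ) : (Fin m ⊕ Fin 1) ⊕ Fin 1 ≃ Idx m :=
  (Equiv.sumAssoc _ _ _).trans (Equiv.sumCongr (Equiv.refl _) finSumFinEquiv)

@[simp] theorem spaceTime_inl_inl {m : ℕ} (i : Fin m) : spaceTime m (.inl (.inl i)) = .inl i := rfl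
@[simp] theorem spaceTime_inl_inr {m : ℕ} (i : Fin 1) : spaceTime m (.inl (.inr i)) = .inr 0 := by
  fin_cases i; rfl
@[simp] theorem spaceTime_inr {m : ℕ} (i : Fin 1) : spaceTime m (.inr i) = .inr 1 := by
  fin_cases i; rfl

@[simp] theorem spaceTime_symm_last (m : ℕ) : (spaceTime m).symm (.inr 1) = .inr 0 := by
  rw [Equiv.symm_apply_eq, spaceTime_inr]

theorem lip_eq_dotProduct {m : ℕ} (v w : Idx m → ℝ) :
    lip v w = (fun p => v (spaceTime m (.inl p))) ⬝ᵥ (fun p => w (spaceTime m (.inl p)))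
      - v (.inr 1) * w (.inr 1) := by
  rw [lip_eq]
  simp [dotProduct]

/-- The element `diag(O, 1)`, for `O` an `(m+1) × (m+1)` matrix. -/
def kGrp {m : ℕ} (O : Matrix (Fin m ⊕ Fin 1) (Fin m ⊕ Fin 1) ℝ) : Matrix (Idx m) (Idx m) ℝ :=
  Matrix.reindex (spaceTime m) (spaceTime m) (Matrix.fromBlocks O 0 0 1)

theorem kGrp_mul {m : ℕ} (A B : Matrix (Fin m ⊕ Fin 1) (Fin m ⊕ Fin 1) ℝ) :
    kGrp (A * B) = kGrp A * kGrp B := by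
  simp [kGrp, Matrix.submatrix_mul_equiv, Matrix.fromBlocks_multiply]

theorem kGrp_one (m : ℕ) : kGrp (1 : Matrix (Fin m ⊕ Fin 1) (Fin m ⊕ Fin 1) ℝ) = 1 := by
  simp [kGrp]

theorem det_kGrp {m : ℕ} (A : Matrix (Fin m ⊕ Fin 1) (Fin m ⊕ Fin 1) ℝ) :
    (kGrp A).det = A.det := by
  simp [kGrp]

theorem kGrp_mulVec_inl {m : ℕ} (O : Matrix (Fin m ⊕ Fin 1) (Fin m ⊕ Fin 1) ℝ) (v : Idx m → ℝ)
    (p : Fin m ⊕ Fin 1) : (kGrp O *ᵥ v) (spaceTime m (.inl p))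
      = (O *ᵥ fun p => v (spaceTime m (.inl p))) p := by
  simp only [kGrp, Matrix.reindex_apply]
  rw [Matrix.submatrix_mulVec_equiv]
  simp [Matrix.fromBlocks_mulVec, Function.comp_def]

theorem kGrp_mulVec_last {m : ℕ} (O : Matrix (Fin m ⊕ Fin 1) (Fin m ⊕ Fin 1) ℝ) (v : Idx m → ℝ) :
    (kGrp O *ᵥ v) (.inr 1) = v (.inr 1) := by
  rw [← spaceTime_inr 0]
  simp only [kGrp, Matrix.reindex_apply]
  rw [Matrix.submatrix_mulVec_equiv]
  simp [Matrix.fromBlocks_mulVec, Function.comp_def]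

theorem idx_ext {m : ℕ} {v w : Idx m → ℝ}
    (h : ∀ p, v (spaceTime m (.inl p)) = w (spaceTime m (.inl p)))
    (h1 : v (.inr 1) = w (.inr 1)) : v = w := by
  funext i
  obtain ⟨j, rfl⟩ := (spaceTime m).surjective i
  rcases j with j | j
  · exact h j
  · simpa using h1

/-- A spatial vector, with time coordinate zero. -/
def spaceVec {m : ℕ} (u : Fin m ⊕ Fin 1 → ℝ) : Idx m → ℝ := Sum.elim u 0 ∘ (spaceTime m).symm

@[simp] theorem spaceVec_inl {m : ℕ} (u : Fin m ⊕ Fin 1 → ℝ) (p) :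
    spaceVec u (spaceTime m (.inl p)) = u p := by simp [spaceVec]

@[simp] theorem spaceVec_last {m : ℕ} (u : Fin m ⊕ Fin 1 → ℝ) :
    spaceVec u (.inr 1 : Idx m) = 0 := by
  rw [← spaceTime_inr 0]; simp [spaceVec]

theorem lip_spaceVec {m : ℕ} (u : Fin m ⊕ Fin 1 → ℝ) (v : Idx m → ℝ) :
    lip (spaceVec u) v = u ⬝ᵥ (fun p => v (spaceTime m (.inl p))) := by
  simp [lip_eq_dotProduct]

theorem kGrp_reflection {m : ℕ} (u : Fin m ⊕ Fin 1 → ℝ) :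
    kGrp (1 - (2 : ℝ) • Matrix.vecMulVec u u) = lrefl (spaceVec u) := by
  refine Matrix.ext_of_mulVec_single fun i => idx_ext (fun p => ?_) ?_
  · rw [kGrp_mulVec_inl, lrefl_mulVec, lip_spaceVec, Matrix.sub_mulVec, Matrix.one_mulVec,
      Matrix.smul_mulVec, Matrix.vecMulVec_mulVec]
    simp
    ring
  · rw [kGrp_mulVec_last, lrefl_mulVec]
    simp

theorem lrefl_mul_self {m : ℕ} {v : Idx m → ℝ} (hv : lip v v = 1) : lrefl v * lrefl v = 1 := by
  refine Matrix.ext_of_mulVec_single fun i => ?_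
  rw [← Matrix.mulVec_mulVec, lrefl_mulVec, lrefl_mulVec, lip_sub_right, lip_smul_right, hv,
    Matrix.one_mulVec]
  module

theorem det_lrefl_spaceVec {m : ℕ} {u : Fin m ⊕ Fin 1 → ℝ} (hu : u ⬝ᵥ u = 1) :
    (lrefl (spaceVec u)).det = -1 := by
  rw [← kGrp_reflection, det_kGrp]
  have e : 1 - (2 : ℝ) • Matrix.vecMulVec u u
      = 1 + Matrix.replicateCol Unit (-(2 : ℝ) • u) * Matrix.replicateRow Unit u := by
    rw [← Matrix.vecMulVec_eq, Matrix.smul_vecMulVec, neg_smul]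
    abel
  rw [e, Matrix.det_one_add_replicateCol_mul_replicateRow, dotProduct_smul, hu]
  norm_num

-- Only products of an even number of reflections are supplied by `lrefl_mul_lrefl_mem`. The fixed
-- reflection in `e` keeps track of the parity: each new reflection is paired either with it or with
-- a copy of it already present. A zero vector in the list contributes the identity.
open Submodule in
theorem reflections_mem {m : ℕ} (l : List (EuclideanSpace ℝ (Fin m ⊕ Fin 1)))
    {e : Fin m ⊕ Fin 1 → ℝ} (he : e ⬝ᵥ e = 1) :
    ∃ A : Matrix (Fin m ⊕ Fin 1) (Fin m ⊕ Fin 1) ℝ,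
      (∀ x : EuclideanSpace ℝ (Fin m ⊕ Fin 1),
        A *ᵥ x.ofLp = ((l.map fun v => reflection (ℝ ∙ v)ᗮ).prod x).ofLp) ∧
      (kGrp A ∈ MonoidHom.mrange (toMat m) ∨
        lrefl (spaceVec e) * kGrp A ∈ MonoidHom.mrange (toMat m)) := by
  have he' : lip (spaceVec e) (spaceVec e) = 1 := by rw [lip_spaceVec]; simpa using he
  induction l with
  | nil => exact ⟨1, by simp, Or.inl (by rw [kGrp_one]; exact one_mem _)⟩
  | cons v l ih =>
    obtain ⟨A, hA, h⟩ := ih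
    by_cases hv : v = 0
    · refine ⟨A, fun x => ?_, h⟩
      rw [hA, List.map_cons, List.prod_cons, LinearIsometryEquiv.coe_mul, Function.comp_apply,
        reflection_orthogonal_apply, reflection_singleton_apply, hv]
      simp
    · set u : Fin m ⊕ Fin 1 → ℝ := ‖v‖⁻¹ • v.ofLp with hu
      have hn : ‖v‖ ≠ 0 := norm_ne_zero_iff.2 hv
      have hvv : v.ofLp ⬝ᵥ v.ofLp = ‖v‖ ^ 2 := by
        rw [← real_inner_self_eq_norm_sq, EuclideanSpace.inner_eq_star_dotProduct]
        simp
      have huu : u ⬝ᵥ u = 1 := by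
        rw [hu, smul_dotProduct, dotProduct_smul, hvv]
        simp only [smul_eq_mul]
        field_simp
      have hu' : lip (spaceVec u) (spaceVec u) = 1 := by rw [lip_spaceVec]; simpa using huu
      refine ⟨(1 - (2 : ℝ) • Matrix.vecMulVec u u) * A, fun x => ?_, ?_⟩
      · rw [← Matrix.mulVec_mulVec, hA, List.map_cons, List.prod_cons,
          LinearIsometryEquiv.coe_mul, Function.comp_apply, reflection_orthogonal_apply, reflection_singleton_apply]
        generalize (l.map fun v => reflection (ℝ ∙ v)ᗮ).prod x = y
        rw [Matrix.sub_mulVec, Matrix.one_mulVec, Matrix.smul_mulVec, Matrix.vecMulVec_mulVec,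
          EuclideanSpace.inner_eq_star_dotProduct, hu, smul_dotProduct, dotProduct_comm y.ofLp]
        ext i
        simp
        field_simp
      · rw [kGrp_mul, kGrp_reflection]
        rcases h with h | h
        · right
          rw [← mul_assoc]
          exact mul_mem (lrefl_mul_lrefl_mem he' hu') h
        · left
          have := mul_mem (lrefl_mul_lrefl_mem hu' he') h
          rwa [mul_assoc, ← mul_assoc (lrefl (spaceVec e)) (lrefl (spaceVec e)),
            lrefl_mul_self he', one_mul] at this

/-- By Cartan–Dieudonné `O` is a product of reflections. An odd number is excluded by determinants,
because images of `Spin` have determinant `1`. -/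
theorem kGrp_mem {k : ℕ} {O : Matrix (Fin (2 * k + 1) ⊕ Fin 1) (Fin (2 * k + 1) ⊕ Fin 1) ℝ}
    (hO : Oᵀ * O = 1) (hd : O.det = 1) : kGrp O ∈ MonoidHom.mrange (toMat (2 * k + 1)) := by
  have hO' : O ∈ unitary (Matrix (Fin (2 * k + 1) ⊕ Fin 1) (Fin (2 * k + 1) ⊕ Fin 1) ℝ) := by
    rw [Unitary.mem_iff]
    exact ⟨hO, mul_eq_one_comm.1 hO⟩
  obtain ⟨l, -, hl⟩ := LinearIsometryEquiv.reflections_generate_dim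
    (Unitary.linearIsometryEquiv ⟨_, Unitary.map_mem
      (Matrix.toEuclideanCLM (n := Fin (2 * k + 1) ⊕ Fin 1) (𝕜 := ℝ)) hO'⟩)
  have he : (Pi.single (.inr 0) 1 : Fin (2 * k + 1) ⊕ Fin 1 → ℝ) ⬝ᵥ Pi.single (.inr 0) 1 = 1 := by
    simp
  obtain ⟨A, hA, h⟩ := reflections_mem l he
  have hAO : A = O := by
    refine Matrix.ext_of_mulVec_single fun i => ?_
    have := hA (WithLp.toLp 2 (Pi.single i 1))
    rw [← hl] at this
    exact this
  subst hAO
  rcases h with h | ⟨g, hg⟩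
  · exact h
  · have := det_toMat g
    rw [hg, Matrix.det_mul, det_lrefl_spaceVec he, det_kGrp, hd] at this
    norm_num at this

theorem mGrp_eq_kGrp {m : ℕ} (Y : Matrix (Fin m) (Fin m) ℝ) :
    mGrp Y = kGrp (Matrix.fromBlocks Y 0 0 1) := by
  refine Matrix.ext_of_mulVec_single fun i => idx_ext (fun p => ?_) ?_
  · rw [kGrp_mulVec_inl]
    rcases p with p | p
    · simp [mGrp, Matrix.mulVec, dotProduct]
    · fin_cases p
      simp [mGrp, Matrix.mulVec, dotProduct]
  · rw [kGrp_mulVec_last]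
    simp [mGrp, Matrix.mulVec, dotProduct, Matrix.one_apply]

theorem mGrp_mem {k : ℕ} {Y : Matrix (Fin (2 * k + 1)) (Fin (2 * k + 1)) ℝ}
    (hY : Yᵀ * Y = 1) (hd : Y.det = 1) : mGrp Y ∈ MonoidHom.mrange (toMat (2 * k + 1)) := by
  rw [mGrp_eq_kGrp]
  apply kGrp_mem
  · simp [Matrix.fromBlocks_transpose, Matrix.fromBlocks_multiply, hY]
  · simp [hd]

/-- A boost by `t` is the product of two reflections whose unit vectors are at hyperbolic angle `t /
2`. -/
theorem aGrp_mem (m : ℕ) (t : ℝ) : aGrp m t ∈ MonoidHom.mrange (toMat m) := by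
  have h1 : lip (Sum.elim 0 ![Real.cosh (t / 2), Real.sinh (t / 2)] : Idx m → ℝ)
      (Sum.elim 0 ![Real.cosh (t / 2), Real.sinh (t / 2)]) = 1 := by
    have := Real.cosh_sq_sub_sinh_sq (t / 2)
    rw [lip_eq]; simp; linarith
  have h2 : lip (Sum.elim 0 ![1, 0] : Idx m → ℝ) (Sum.elim 0 ![1, 0]) = 1 := by
    rw [lip_eq]; simp
  have e : aGrp m t = lrefl (Sum.elim 0 ![Real.cosh (t / 2), Real.sinh (t / 2)])
      * lrefl (Sum.elim 0 ![1, 0]) := by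
    have c1 : Real.cosh t = 2 * Real.cosh (t / 2) ^ 2 - 1 := by
      have := Real.cosh_two_mul (t / 2)
      have h3 := Real.cosh_sq_sub_sinh_sq (t / 2)
      rw [mul_div_cancel₀ _ two_ne_zero] at this
      linarith
    have c2 : Real.sinh t = 2 * Real.sinh (t / 2) * Real.cosh (t / 2) := by
      have := Real.sinh_two_mul (t / 2)
      rwa [mul_div_cancel₀ _ two_ne_zero] at this
    have c3 := Real.cosh_sq_sub_sinh_sq (t / 2)
    refine Matrix.ext_of_mulVec_single fun i => ?_
    generalize (Pi.single i 1 : Idx m → ℝ) = x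
    rw [← Matrix.mulVec_mulVec, lrefl_mulVec, lrefl_mulVec]
    simp only [lip_eq]
    ext j
    rcases j with j | j
    · simp [aGrp, Matrix.mulVec, dotProduct, Matrix.one_apply]
    · fin_cases j
      · simp [aGrp, Matrix.mulVec, dotProduct, c1, c2]
        linear_combination 0 * c3
      · simp [aGrp, Matrix.mulVec, dotProduct, c1, c2]
        linear_combination (2 * x (.inr 1)) * c3
  rw [e]
  exact lrefl_mul_lrefl_mem h1 h2

theorem nGrp_mulVec {m : ℕ} (α : Fin m → ℝ) (x : Idx m → ℝ) :
    nGrp α *ᵥ x = x + (α ⬝ᵥ (fun i => x (.inl i))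
      - (lip (nullVec m) x) * ((α ⬝ᵥ α) / 2)) • nullVec m
      - lip (nullVec m) x • (Sum.elim α 0 : Idx m → ℝ) := by
  have h : nGrp α *ᵥ x = x + nilX α *ᵥ x + (1 / 2 : ℝ) • ((nilX α * nilX α) *ᵥ x) := by
    rw [nGrp, Matrix.add_mulVec, Matrix.add_mulVec, Matrix.one_mulVec, Matrix.smul_mulVec]
  rw [h, nilX_sq]
  ext j
  rcases j with j | j
  · simp [nilX, Matrix.mulVec, dotProduct, lip_eq, nullVec]
    ring
  · fin_cases j <;> simp [nilX, Matrix.mulVec, dotProduct, lip_eq, nullVec] <;> ring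

/-- The unipotent analogue of writing a rotation as two reflections: with `w = α / |α|` and `v = w +
(|α| / 2) ν`, both unit vectors of the degenerate plane spanned by `w` and `ν`, one has `n_α = lrefl
v * lrefl w`. -/
theorem nGrp_mem {m : ℕ} (α : Fin m → ℝ) : nGrp α ∈ MonoidHom.mrange (toMat m) := by
  by_cases hα : α = 0
  · rw [hα, nGrp_zero]; exact one_mem _
  have hpos : 0 < α ⬝ᵥ α :=
    lt_of_le_of_ne (Finset.sum_nonneg fun i _ => mul_self_nonneg _)
      fun h => hα (dotProduct_self_eq_zero.1 h.symm)
  obtain ⟨r, hr, hr2⟩ : ∃ r : ℝ, 0 < r ∧ r * r = α ⬝ᵥ α :=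
    ⟨√(α ⬝ᵥ α), Real.sqrt_pos.2 hpos, Real.mul_self_sqrt hpos.le⟩
  set w : Idx m → ℝ := Sum.elim (r⁻¹ • α) 0 with hw
  set v : Idx m → ℝ := w + (r / 2) • nullVec m with hv
  have hnn : lip (nullVec m) (nullVec m) = 0 := by rw [lip_eq]; simp [nullVec]
  have hnw : lip (nullVec m) w = 0 := by rw [lip_eq]; simp [nullVec, hw]
  have hww : lip w w = 1 := by
    have : ∑ i, r⁻¹ * α i * (r⁻¹ * α i) = r⁻¹ * r⁻¹ * (α ⬝ᵥ α) := by
      rw [dotProduct, Finset.mul_sum]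
      exact Finset.sum_congr rfl fun i _ => by ring
    rw [lip_eq]; simp [hw]; rw [this, ← hr2]
    field_simp
  have hvw : lip v w = 1 := by rw [hv, lip_add_left, lip_smul_left, hnw, hww]; ring
  have hvv : lip v v = 1 := by
    conv_lhs => rw [hv]
    rw [lip_add_left, lip_smul_left, lip_comm w v, hvw, lip_add_right, lip_smul_right, hnw, hnn]
    ring
  have e : nGrp α = lrefl v * lrefl w := by
    refine Matrix.ext_of_mulVec_single fun i => ?_
    generalize (Pi.single i 1 : Idx m → ℝ) = x
    rw [nGrp_mulVec, ← Matrix.mulVec_mulVec, lrefl_mulVec, lrefl_mulVec, lip_sub_right,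
      lip_smul_right, hvw]
    have hwx : α ⬝ᵥ (fun i => x (.inl i)) = r * lip w x := by
      rw [lip_eq, dotProduct]; simp [hw]
      rw [Finset.mul_sum]
      exact Finset.sum_congr rfl fun i _ => by field_simp
    have hvx : lip v x = lip w x + (r / 2) * lip (nullVec m) x := by
      rw [hv, lip_add_left, lip_smul_left]
    have hαw : (Sum.elim α 0 : Idx m → ℝ) = r • w := by
      ext j; rcases j with j | j
      · simp [hw]; field_simp
      · simp [hw]
    rw [hvx, hwx, ← hr2, hαw, hv]
    module
  rw [e]
  exact lrefl_mul_lrefl_mem hvv hww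

/-- An isometry fixing the null vector and `e₁, …, e_m` is the identity. -/
theorem eq_one_of_fix {m : ℕ} {h : Matrix (Idx m) (Idx m) ℝ} (hh : hᵀ * lorentz m * h = lorentz m)
    (h1 : ∀ j : Fin m, h *ᵥ Pi.single (.inl j) 1 = Pi.single (.inl j) 1)
    (h2 : h *ᵥ nullVec m = nullVec m) : h = 1 := by
  have hnull : nullVec m = Pi.single (.inr 0) 1 + Pi.single (.inr 1) 1 := by
    ext j; rcases j with j | j
    · simp [nullVec]
    · fin_cases j <;> simp [nullVec]
  set w := h *ᵥ Pi.single (.inr 1) 1 with hw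
  have a1 : ∀ j : Fin m, w (.inl j) = 0 := by
    intro j
    have := lip_mulVec hh (Pi.single (.inl j) 1) (Pi.single (.inr 1) 1)
    rw [h1, ← hw] at this
    simpa [lip_eq, Pi.single_apply] using this
  have a2 : w (.inr 0) - w (.inr 1) = -1 := by
    have := lip_mulVec hh (nullVec m) (Pi.single (.inr 1) 1)
    rw [h2, ← hw] at this
    simpa [lip_eq, nullVec, Pi.single_apply] using this
  have a3 : w (.inr 0) * w (.inr 0) - w (.inr 1) * w (.inr 1) = -1 := by
    have := lip_mulVec hh (Pi.single (.inr 1) 1) (Pi.single (.inr 1) 1)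
    rw [← hw] at this
    simpa [lip_eq, Pi.single_apply, a1] using this
  -- Dividing the relation `a3` by `a2` gives `w₀ + w₁ = 1`, while `w₀ - w₁ = -1`.
  have a4 : w (.inr 0) = 0 := by nlinarith
  have hw1 : w = Pi.single (.inr 1) 1 := by
    ext j; rcases j with j | j
    · simp [a1]
    · fin_cases j
      · simp [a4]
      · simp; linarith
  refine Matrix.ext_of_mulVec_single fun i => ?_
  rw [Matrix.one_mulVec]
  rcases i with i | i
  · exact h1 i
  · fin_cases i
    · have : (Pi.single (.inr 0) 1 : Idx m → ℝ) = nullVec m - Pi.single (.inr 1) 1 := by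
        rw [hnull]; abel
      simp only [Fin.zero_eta]
      rw [this, Matrix.mulVec_sub, h2, ← hw, hw1]
    · exact hw1

theorem lip_nullVec (m : ℕ) : lip (nullVec m) (nullVec m) = 0 := by rw [lip_eq]; simp [nullVec]

theorem aGrp_mulVec_nullVec (m : ℕ) (t : ℝ) :
    aGrp m t *ᵥ nullVec m = Real.exp t • nullVec m := by
  ext i
  rcases i with i | i
  · simp [Matrix.mulVec, dotProduct, nullVec, aGrp]
  · fin_cases i <;> simp [Matrix.mulVec, dotProduct, nullVec, aGrp]

theorem mGrp_mulVec_nullVec {m : ℕ} (Y : Matrix (Fin m) (Fin m) ℝ) :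
    mGrp Y *ᵥ nullVec m = nullVec m := by
  ext i
  rcases i with i | i
  · simp [Matrix.mulVec, dotProduct, nullVec, mGrp]
  · fin_cases i <;> simp [Matrix.mulVec, dotProduct, nullVec, mGrp]

theorem nGrp_mulVec_nullVec {m : ℕ} (α : Fin m → ℝ) : nGrp α *ᵥ nullVec m = nullVec m := by
  rw [nGrp_mulVec, lip_nullVec]
  have : (fun i => nullVec m (.inl i)) = (0 : Fin m → ℝ) := by ext; simp [nullVec]
  rw [this]
  simp

theorem mGrp_isometry {m : ℕ} {Y : Matrix (Fin m) (Fin m) ℝ} (hY : Yᵀ * Y = 1) :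
    (mGrp Y)ᵀ * lorentz m * mGrp Y = lorentz m := by
  have : lorentz m = Matrix.fromBlocks 1 0 0 (Matrix.diagonal ![1, -1]) := by
    ext i j
    rcases i with i | i <;> rcases j with j | j <;>
      simp [lorentz, sgn, Matrix.diagonal_apply, Matrix.one_apply]
  rw [this]
  simp [mGrp, Matrix.fromBlocks_transpose, Matrix.fromBlocks_multiply, hY]

theorem isometry_mul {m : ℕ} {g h : Matrix (Idx m) (Idx m) ℝ}
    (hg : gᵀ * lorentz m * g = lorentz m) (hh : hᵀ * lorentz m * h = lorentz m) :
    (g * h)ᵀ * lorentz m * (g * h) = lorentz m := by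
  calc (g * h)ᵀ * lorentz m * (g * h) = hᵀ * (gᵀ * lorentz m * g) * h := by
        simp only [Matrix.transpose_mul, mul_assoc]
    _ = _ := by rw [hg, hh]

theorem isometry_of_mem {m : ℕ} {g : Matrix (Idx m) (Idx m) ℝ}
    (hg : g ∈ MonoidHom.mrange (toMat m)) : gᵀ * lorentz m * g = lorentz m := by
  obtain ⟨g, rfl⟩ := hg
  exact toMat_transpose_mul g

theorem isometry_left_inv {m : ℕ} {g : Matrix (Idx m) (Idx m) ℝ}
    (hg : gᵀ * lorentz m * g = lorentz m) : (lorentz m * gᵀ * lorentz m) * g = 1 := by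
  rw [mul_assoc, mul_assoc, ← mul_assoc gᵀ, hg, lorentz_mul_self]

theorem lorentz_transpose (m : ℕ) : (lorentz m)ᵀ = lorentz m := Matrix.diagonal_transpose _

theorem isometry_inv {m : ℕ} {g : Matrix (Idx m) (Idx m) ℝ}
    (hg : gᵀ * lorentz m * g = lorentz m) :
    (lorentz m * gᵀ * lorentz m)ᵀ * lorentz m * (lorentz m * gᵀ * lorentz m) = lorentz m := by
  have h1 : g * (lorentz m * gᵀ * lorentz m) = 1 := mul_eq_one_comm.1 (isometry_left_inv hg)
  have h2 := lorentz_mul_self m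
  calc (lorentz m * gᵀ * lorentz m)ᵀ * lorentz m * (lorentz m * gᵀ * lorentz m)
      = lorentz m * g * (lorentz m * lorentz m) * (lorentz m * gᵀ * lorentz m) := by
        simp only [Matrix.transpose_mul, Matrix.transpose_transpose, lorentz_transpose, mul_assoc]
    _ = lorentz m * (g * (lorentz m * gᵀ * lorentz m)) := by rw [h2, mul_one, mul_assoc]
    _ = lorentz m := by rw [h1, mul_one]

/-- The stabilizer of the null line is the parabolic subgroup. -/
theorem mem_parabolic_of_mulVec {k : ℕ} {g : Spin (2 * k + 1)} {c : ℝ}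
    (h : toMat _ g *ᵥ nullVec _ = c • nullVec _) : g ∈ parabolic (2 * k + 1) := by
  set p := toMat _ g with hp
  have hiso : pᵀ * lorentz _ * p = lorentz _ := toMat_transpose_mul g
  -- The future cone is preserved, so the eigenvalue is positive and can be written `exp (log c)`.
  have hc : 0 < c := by
    have := toMat_future g (lip_nullVec _).le (by simp [nullVec])
    rw [← hp, h] at this
    simpa [nullVec] using this
  set Y : Matrix (Fin (2 * k + 1)) (Fin (2 * k + 1)) ℝ :=
    Matrix.of fun i j => p (.inl i) (.inl j) with hY
  have hcol : ∀ j : Fin (2 * k + 1), p (.inr 0) (.inl j) = p (.inr 1) (.inl j) := by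
    intro j
    have := lip_mulVec hiso (nullVec _) (Pi.single (.inl j) 1)
    rw [h, lip_smul_left, Matrix.mulVec_single_one] at this
    have h2 : lip (nullVec (2 * k + 1)) (p.col (Sum.inl j)) = 0 := by
      have h3 : lip (nullVec (2 * k + 1)) (Pi.single (.inl j) 1) = 0 := by
        simp [lip_eq, nullVec]
      rw [h3] at this
      exact (mul_eq_zero.1 this).resolve_left hc.ne'
    simp [lip_eq, nullVec] at h2
    linarith
  have hYo : Yᵀ * Y = 1 := by
    ext i j
    have := lip_mulVec hiso (Pi.single (.inl i) 1) (Pi.single (.inl j) 1)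
    rw [Matrix.mulVec_single_one, Matrix.mulVec_single_one] at this
    simp [lip_eq, hcol] at this
    rw [Matrix.mul_apply]
    simp only [Matrix.transpose_apply, hY, Matrix.of_apply]
    rw [this]
    simp [Matrix.one_apply, Pi.single_apply, eq_comm]
  set α : Fin (2 * k + 1) → ℝ := fun j => c⁻¹ * p (.inr 1) (.inl j) with hα
  -- The only possible `MAN` factorization, read off from the columns of `p`. It agrees with `p` on
  -- `e₁, …, e_m` and on `ν`, and `eq_one_of_fix` applied to `r⁻¹ p` gives `p = r`.
  set r := mGrp Y * aGrp _ (Real.log c) * nGrp α with hr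
  have hriso : rᵀ * lorentz _ * r = lorentz _ :=
    isometry_mul (isometry_mul (mGrp_isometry hYo) (isometry_of_mem (aGrp_mem _ _)))
      (isometry_of_mem (nGrp_mem α))
  have hrn : r *ᵥ nullVec _ = c • nullVec _ := by
    rw [hr, ← Matrix.mulVec_mulVec, ← Matrix.mulVec_mulVec, nGrp_mulVec_nullVec,
      aGrp_mulVec_nullVec, Matrix.mulVec_smul, mGrp_mulVec_nullVec, Real.exp_log hc]
  have hre : ∀ j : Fin (2 * k + 1), r *ᵥ Pi.single (.inl j) 1 = p *ᵥ Pi.single (.inl j) 1 := by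
    intro j
    have e1 : nGrp α *ᵥ Pi.single (.inl j) 1 = Pi.single (.inl j) 1 + α j • nullVec _ := by
      rw [nGrp_mulVec]
      have h3 : lip (nullVec (2 * k + 1)) (Pi.single (.inl j) 1) = 0 := by
        simp [lip_eq, nullVec]
      rw [h3]
      simp [dotProduct, Pi.single_apply]
    have e2 : aGrp (2 * k + 1) (Real.log c) *ᵥ Pi.single (.inl j) 1 = Pi.single (.inl j) 1 := by
      rw [Matrix.mulVec_single_one]
      ext i; rcases i with i | i <;> simp [aGrp, Matrix.one_apply, Pi.single_apply]
    rw [hr, ← Matrix.mulVec_mulVec, ← Matrix.mulVec_mulVec, e1, Matrix.mulVec_add,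
      Matrix.mulVec_smul, aGrp_mulVec_nullVec, e2, Real.exp_log hc, Matrix.mulVec_add,
      Matrix.mulVec_smul, Matrix.mulVec_smul, mGrp_mulVec_nullVec, Matrix.mulVec_single_one,
      Matrix.mulVec_single_one, smul_smul]
    have : α j * c = p (.inr 1) (.inl j) := by simp [hα]; field_simp
    rw [this]
    ext i; rcases i with i | i
    · simp [mGrp, nullVec, hY]
    · fin_cases i
      · simp [mGrp, nullVec, hcol]
      · simp [mGrp, nullVec]
  have hli := isometry_left_inv hriso
  have hfix : (lorentz _ * rᵀ * lorentz _) * p = 1 := by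
    refine eq_one_of_fix (isometry_mul (isometry_inv hriso) hiso) (fun j => ?_) ?_
    · rw [← Matrix.mulVec_mulVec, ← hre, Matrix.mulVec_mulVec, hli, Matrix.one_mulVec]
    · rw [← Matrix.mulVec_mulVec, h, ← hrn, Matrix.mulVec_mulVec, hli, Matrix.one_mulVec]
  have hpr : p = r := by
    calc p = (r * (lorentz _ * rᵀ * lorentz _)) * p := by
          rw [mul_eq_one_comm.1 hli, one_mul]
      _ = r := by rw [mul_assoc, hfix, mul_one]
  refine ⟨Y, ?_, Real.log c, α, ?_⟩
  · rw [Matrix.mem_specialOrthogonalGroup_iff, Matrix.mem_orthogonalGroup_iff']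
    refine ⟨hYo, ?_⟩
    have h1 := det_toMat g
    obtain ⟨g1, hg1⟩ := aGrp_mem (2 * k + 1) (Real.log c)
    obtain ⟨g2, hg2⟩ := nGrp_mem α
    rw [← hp, hpr, hr, Matrix.det_mul, Matrix.det_mul, ← hg1, ← hg2, det_toMat, det_toMat,
      mul_one, mul_one, mGrp, Matrix.det_fromBlocks_zero₂₁, Matrix.det_one, mul_one] at h1
    exact h1
  · rw [← hp, hpr]

end SpinOrbit

namespace SpinOrbit

/-! ### Moment map and traces -/

theorem lieG_inr_inl {m : ℕ} {X : Matrix (Idx m) (Idx m) ℝ} (hX : X ∈ lieG m) (j : Fin m) :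
    X (.inr 0) (.inl j) = -X (.inl j) (.inr 0) ∧ X (.inr 1) (.inl j) = X (.inl j) (.inr 1) := by
  rw [mem_lieG_iff_entry] at hX
  have h0 := hX (.inr 0) (.inl j)
  have h1 := hX (.inr 1) (.inl j)
  simp [sgn] at h0 h1
  constructor <;> linarith

theorem lieG_inr_inr {m : ℕ} {X : Matrix (Idx m) (Idx m) ℝ} (hX : X ∈ lieG m) :
    X (.inr 0) (.inr 0) = 0 ∧ X (.inr 1) (.inr 1) = 0 ∧
      X (.inr 1) (.inr 0) = X (.inr 0) (.inr 1) := by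
  rw [mem_lieG_iff_entry] at hX
  have h0 := hX (.inr 0) (.inr 0)
  have h1 := hX (.inr 1) (.inr 1)
  have h2 := hX (.inr 0) (.inr 1)
  simp [sgn] at h0 h1 h2
  refine ⟨?_, ?_, ?_⟩ <;> linarith

theorem mulVec_nullVec {m : ℕ} (X : Matrix (Idx m) (Idx m) ℝ) (i : Idx m) :
    (X *ᵥ nullVec m) i = X i (.inr 0) + X i (.inr 1) := by
  simp [Matrix.mulVec, dotProduct, nullVec]

theorem trace_mul_lieP {m : ℕ} {D : Matrix (Idx m) (Idx m) ℝ} (hD : D ∈ lieG m)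
    (Y : Matrix (Fin m) (Fin m) ℝ) (t : ℝ) (α : Fin m → ℝ) :
    Matrix.trace (D * (Matrix.fromBlocks Y 0 0 0 + t • H0 m + nilX α))
      = ∑ i, ∑ j, D (.inl i) (.inl j) * Y j i + 2 * t * (D *ᵥ nullVec m) (.inr 0)
        + 2 * ∑ i, α i * (D *ᵥ nullVec m) (.inl i) := by
  obtain ⟨h1, h2, h3⟩ := lieG_inr_inr hD
  simp only [mulVec_nullVec, h1, zero_add, Matrix.trace, Matrix.diag, Matrix.mul_apply]
  simp [H0, nilX, h3, h1, h2, (lieG_inr_inl hD _).1, (lieG_inr_inl hD _).2,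
    Finset.sum_add_distrib, mul_add, Finset.mul_sum]
  have e : ∀ f : Fin m → ℝ, ∑ i, 2 * f i = ∑ i, f i + ∑ i, f i := fun f => by
    rw [← Finset.sum_add_distrib]; exact Finset.sum_congr rfl fun i _ => by ring
  simp only [e, mul_comm (α _)]
  ring

theorem pr_apply {m : ℕ} (X : lieG m) (Z : lieP m) :
    pr m X Z = (1 / 2 : ℝ) * Matrix.trace (X.1 * Z.1) := rfl

/-- The trace pairing with `𝔭` sees the `𝔰𝔬(m)` block through `𝔪`, and the coordinates of `X ν`
through `𝔞` and `𝔫` (`trace_mul_lieP`). Testing a difference `D` against its own transposed block,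
and against its own components in `D ν`, produces sums of squares, so all of these must vanish. -/
theorem pr_eq_iff {m : ℕ} {X X' : lieG m} : pr m X = pr m X' ↔
    (∀ i j, X.1 (.inl i) (.inl j) = X'.1 (.inl i) (.inl j)) ∧
      X.1 *ᵥ nullVec m = X'.1 *ᵥ nullVec m := by
  have key : pr m X = pr m X' ↔ ∀ Z ∈ lieP m, Matrix.trace ((X.1 - X'.1) * Z) = 0 := by
    constructor
    · intro h Z hZ
      have := congrArg (fun f => f ⟨Z, hZ⟩) h
      simp only [pr_apply] at this
      rw [sub_mul, Matrix.trace_sub]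
      linarith
    · intro h
      refine LinearMap.ext fun Z => ?_
      have := h Z.1 Z.2
      rw [sub_mul, Matrix.trace_sub] at this
      rw [pr_apply, pr_apply]
      linarith
  rw [key]
  have hD : X.1 - X'.1 ∈ lieG m := sub_mem X.2 X'.2
  set D := X.1 - X'.1 with hDdef
  have aux : ((∀ i j, X.1 (.inl i) (.inl j) = X'.1 (.inl i) (.inl j)) ∧
      X.1 *ᵥ nullVec m = X'.1 *ᵥ nullVec m) ↔
      ((∀ i j, D (.inl i) (.inl j) = 0) ∧ D *ᵥ nullVec m = 0) := by
    rw [hDdef, Matrix.sub_mulVec, sub_eq_zero]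
    simp only [Matrix.sub_apply, sub_eq_zero]
  rw [aux]
  constructor
  · intro h
    have hmem : ∀ Y ∈ so m, ∀ (t : ℝ) (α : Fin m → ℝ),
        ∑ i, ∑ j, D (.inl i) (.inl j) * Y j i + 2 * t * (D *ᵥ nullVec m) (.inr 0)
        + 2 * ∑ i, α i * (D *ᵥ nullVec m) (.inl i) = 0 := by
      intro Y hY t α
      rw [← trace_mul_lieP hD]
      exact h _ (mem_lieP.2 ⟨Y, hY, t, α, rfl⟩)
    constructor
    · have hY : (Matrix.of fun i j => D (.inl j) (.inl i) : Matrix (Fin m) (Fin m) ℝ) ∈ so m := by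
        change Matrix.transpose _ = _
        ext i j
        have := (mem_lieG_iff_entry D).1 hD (.inl i) (.inl j)
        simp [sgn] at this
        simp
        linarith
      have h1 := hmem _ hY 0 0
      simp only [Matrix.of_apply] at h1
      simp at h1
      intro i j
      have h2 := (Finset.sum_eq_zero_iff_of_nonneg (fun i _ =>
        Finset.sum_nonneg fun j _ => mul_self_nonneg _)).1 h1 i (Finset.mem_univ _)
      have h3 := (Finset.sum_eq_zero_iff_of_nonneg (fun j _ => mul_self_nonneg _)).1 h2 j
        (Finset.mem_univ _)
      exact mul_self_eq_zero.1 h3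
    · have h1 := hmem 0 (so m).zero_mem 1 0
      simp at h1
      have h2 := hmem 0 (so m).zero_mem 0 (fun i => (D *ᵥ nullVec m) (.inl i))
      simp at h2
      funext i
      rcases i with i | i
      · have h3 := (Finset.sum_eq_zero_iff_of_nonneg (fun i _ => mul_self_nonneg _)).1 h2 i
          (Finset.mem_univ _)
        exact mul_self_eq_zero.1 h3
      · fin_cases i
        · exact h1
        · obtain ⟨k1, k2, k3⟩ := lieG_inr_inr hD
          have := mulVec_nullVec D (.inr 1)
          rw [mulVec_nullVec, k1, zero_add] at h1
          rw [k3, k2, add_zero] at this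
          exact this.trans h1
  · rintro ⟨h1, h2⟩ Z hZ
    obtain ⟨Y, hY, t, α, rfl⟩ := mem_lieP.1 hZ
    rw [trace_mul_lieP hD, h2]
    simp [h1]

/-- Together with `pr_eq_iff` this identifies the fibres of `pr` as the cosets of `𝔫`. -/
theorem eq_nilX {m : ℕ} {D : Matrix (Idx m) (Idx m) ℝ} (hD : D ∈ lieG m)
    (h1 : ∀ i j, D (.inl i) (.inl j) = 0) (h2 : D *ᵥ nullVec m = 0) :
    D = nilX fun i => D (.inl i) (.inr 1) := by
  have h3 : ∀ i, D i (.inr 0) + D i (.inr 1) = 0 := fun i => by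
    rw [← mulVec_nullVec, h2]; rfl
  obtain ⟨k1, k2, k3⟩ := lieG_inr_inr hD
  have h4 := h3 (.inr 0)
  ext i j
  rcases i with i | i <;> rcases j with j | j
  · simp [nilX, h1]
  · have := h3 (.inl i)
    fin_cases j
    · simp [nilX]; linarith
    · simp [nilX]
  · have := h3 (.inl j)
    have := lieG_inr_inl hD j
    fin_cases i
    · simp [nilX]; linarith
    · simp [nilX]; linarith
  · fin_cases i <;> fin_cases j <;> simp [nilX] <;> linarith

theorem coadG_iota {m : ℕ} (g : Spin m) (X : lieG m) : coadG m g (iota m X) = iota m (adG m g X) := by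
  refine LinearMap.ext fun Z => ?_
  change (1 / 2 : ℝ) * Matrix.trace (X.1 * (toMat m g⁻¹ * Z.1 * toMat m g⁻¹⁻¹))
    = (1 / 2 : ℝ) * Matrix.trace (toMat m g * X.1 * toMat m g⁻¹ * Z.1)
  rw [inv_inv]
  congr 1
  rw [← mul_assoc, Matrix.trace_mul_comm]
  simp only [mul_assoc]

theorem moment_coadG {m : ℕ} (g : parabolic m) (f : Module.Dual ℝ (lieG m)) :
    moment m (coadG m g f) = coadP m g (moment m f) := rfl

theorem coadP_pr {m : ℕ} (g : parabolic m) (X : lieG m) :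
    coadP m g (pr m X) = pr m (adG m g X) := by
  rw [pr, pr, ← coadG_iota, moment_coadG]

theorem mem_orbitP_self {m : ℕ} (φ : Module.Dual ℝ (lieP m)) : φ ∈ orbitP φ :=
  ⟨1, by simp⟩

theorem orbitP_eq_of_mem {m : ℕ} {φ ψ : Module.Dual ℝ (lieP m)} (h : ψ ∈ orbitP φ) :
    orbitP ψ = orbitP φ := by
  obtain ⟨g, rfl⟩ := h
  ext χ
  constructor
  · rintro ⟨h, rfl⟩
    exact ⟨h * g, by simp⟩
  · rintro ⟨h, rfl⟩
    refine ⟨h * g⁻¹, ?_⟩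
    simp only
    rw [← Module.End.mul_apply, ← map_mul, inv_mul_cancel_right]

theorem orbitPG_eq_of_mem {m : ℕ} {φ ψ : Module.Dual ℝ (lieG m)} (h : ψ ∈ orbitPG φ) :
    orbitPG ψ = orbitPG φ := by
  obtain ⟨g, rfl⟩ := h
  ext χ
  constructor
  · rintro ⟨h, rfl⟩
    exact ⟨h * g, by simp⟩
  · rintro ⟨h, rfl⟩
    refine ⟨h * g⁻¹, ?_⟩
    simp only
    rw [← Module.End.mul_apply, ← map_mul, ← Subgroup.coe_mul, inv_mul_cancel_right]

theorem moment_image_orbitPG {m : ℕ} (f : Module.Dual ℝ (lieG m)) :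
    moment m '' orbitPG f = orbitP (moment m f) := by
  ext φ
  constructor
  · rintro ⟨_, ⟨g, rfl⟩, rfl⟩
    exact ⟨g, (moment_coadG g f).symm⟩
  · rintro ⟨g, rfl⟩
    exact ⟨_, ⟨g, rfl⟩, moment_coadG g f⟩

/-! ### Bordered determinants -/

/-- The determinant of `λ - X` bordered by `v` and by the functional `⟨v, ·⟩`. -/
noncomputable def bord {m : ℕ} (X : Matrix (Idx m) (Idx m) ℝ) (v : Idx m → ℝ) (r : ℝ) : ℝ :=
  (Matrix.fromBlocks (r • 1 - X) (Matrix.replicateCol Unit v)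
    (Matrix.replicateRow Unit (lorentz m *ᵥ v)) 0).det

theorem bord_smul {m : ℕ} (X : Matrix (Idx m) (Idx m) ℝ) (v : Idx m → ℝ) (r c : ℝ) :
    bord X (c • v) r = c ^ 2 * bord X v r := by
  have e : Matrix.fromBlocks (r • 1 - X) (Matrix.replicateCol Unit (c • v))
      (Matrix.replicateRow Unit (lorentz m *ᵥ (c • v))) 0
      = Matrix.fromBlocks 1 0 0 (c • (1 : Matrix Unit Unit ℝ)) *
        Matrix.fromBlocks (r • 1 - X) (Matrix.replicateCol Unit v)
        (Matrix.replicateRow Unit (lorentz m *ᵥ v)) 0 *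
        Matrix.fromBlocks 1 0 0 (c • (1 : Matrix Unit Unit ℝ)) := by
    simp [Matrix.fromBlocks_multiply, Matrix.mulVec_smul]
  rw [bord, e, Matrix.det_mul, Matrix.det_mul, bord, Matrix.det_fromBlocks_zero₂₁]
  simp
  ring

theorem bord_conj {m : ℕ} {g X X' : Matrix (Idx m) (Idx m) ℝ}
    (hg : gᵀ * lorentz m * g = lorentz m) (h : X' * g = g * X) (v : Idx m → ℝ) (r : ℝ) :
    bord X' (g *ᵥ v) r = bord X v r := by
  have hdet : g.det ≠ 0 := by
    intro h0
    have := congrArg Matrix.det (isometry_left_inv hg)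
    rw [Matrix.det_mul, h0, mul_zero, Matrix.det_one] at this
    exact zero_ne_one this
  have e1 : Matrix.replicateRow Unit (lorentz m *ᵥ (g *ᵥ v)) * g
      = Matrix.replicateRow Unit (lorentz m *ᵥ v) := by
    rw [← Matrix.replicateRow_vecMul]
    congr 1
    rw [← Matrix.mulVec_transpose, Matrix.mulVec_mulVec, Matrix.mulVec_mulVec, hg]
  have e : Matrix.fromBlocks (r • 1 - X') (Matrix.replicateCol Unit (g *ᵥ v))
      (Matrix.replicateRow Unit (lorentz m *ᵥ (g *ᵥ v))) 0 * Matrix.fromBlocks g 0 0 1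
      = Matrix.fromBlocks g 0 0 1 * Matrix.fromBlocks (r • 1 - X) (Matrix.replicateCol Unit v)
        (Matrix.replicateRow Unit (lorentz m *ᵥ v)) 0 := by
    simp [Matrix.fromBlocks_multiply, sub_mul, mul_sub, h, e1, Matrix.replicateCol_mulVec,
      -Matrix.mulVec_mulVec]
  have := congrArg Matrix.det e
  rw [Matrix.det_mul, Matrix.det_mul, Matrix.det_fromBlocks_zero₂₁, Matrix.det_one, mul_one,
    mul_comm] at this
  exact mul_left_cancel₀ hdet this

theorem nilX_eq_vecMulVec {m : ℕ} (α : Fin m → ℝ) :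
    nilX α = Matrix.vecMulVec (nullVec m) (Sum.elim α 0)
      - Matrix.vecMulVec (Sum.elim α 0) (lorentz m *ᵥ nullVec m) := by
  ext i j
  rcases i with i | i <;> rcases j with j | j
  · simp [nilX, nullVec, Matrix.vecMulVec_apply, lorentz, Matrix.mulVec_diagonal, sgn]
  · fin_cases j <;>
      simp [nilX, nullVec, Matrix.vecMulVec_apply, lorentz, Matrix.mulVec_diagonal, sgn]
  · fin_cases i <;>
      simp [nilX, nullVec, Matrix.vecMulVec_apply, lorentz, Matrix.mulVec_diagonal, sgn]
  · simp [nilX, nullVec, Matrix.vecMulVec_apply, lorentz, Matrix.mulVec_diagonal, sgn]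

/-- By `nilX_eq_vecMulVec`, adding `nilX α` adds multiples of the bordering column and of the
bordering row to the main block. Elementary operations undo both, so `bord · ν r` depends only on
`pr`. -/
theorem bord_add_nilX {m : ℕ} (X : Matrix (Idx m) (Idx m) ℝ) (α : Fin m → ℝ) (r : ℝ) :
    bord (X + nilX α) (nullVec m) r = bord X (nullVec m) r := by
  set ν := nullVec m
  set β : Idx m → ℝ := Sum.elim α 0
  have e : Matrix.fromBlocks (r • 1 - (X + nilX α)) (Matrix.replicateCol Unit ν)
      (Matrix.replicateRow Unit (lorentz m *ᵥ ν)) 0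
      = Matrix.fromBlocks 1 (Matrix.replicateCol Unit β) 0 1 *
        Matrix.fromBlocks (r • 1 - X) (Matrix.replicateCol Unit ν)
        (Matrix.replicateRow Unit (lorentz m *ᵥ ν)) 0 *
        Matrix.fromBlocks 1 0 (Matrix.replicateRow Unit (-β)) 1 := by
    rw [nilX_eq_vecMulVec]
    simp only [Matrix.fromBlocks_multiply, Matrix.one_mul, Matrix.mul_zero, Matrix.zero_mul,
      Matrix.mul_one, add_zero, zero_add, ← Matrix.vecMulVec_eq, Matrix.vecMulVec_neg]
    congr 1
    abel
  rw [bord, e, Matrix.det_mul, Matrix.det_mul, bord, Matrix.det_fromBlocks_zero₂₁,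
    Matrix.det_fromBlocks_zero₁₂]
  simp

/-- A Schur complement in which a solution `y` of the linear system replaces the resolvent, so that
`r - X` need not be inverted. -/
theorem bord_eq_of_solve {m : ℕ} {X : Matrix (Idx m) (Idx m) ℝ} {v y : Idx m → ℝ} {r : ℝ}
    (h : (r • 1 - X) *ᵥ y = v) : bord X v r = -((r • 1 - X).det * lip v y) := by
  have hv : ∀ i : Unit, (Matrix.replicateRow Unit (lorentz m *ᵥ v) *ᵥ y) i = lip v y := by
    intro i
    change (lorentz m *ᵥ v) ⬝ᵥ y = _
    rw [lip_comm, lip, dotProduct_comm]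
  have e : Matrix.fromBlocks (r • 1 - X) (Matrix.replicateCol Unit v)
      (Matrix.replicateRow Unit (lorentz m *ᵥ v)) 0 *
        Matrix.fromBlocks 1 (Matrix.replicateCol Unit (-y)) 0 1
      = Matrix.fromBlocks (r • 1 - X) 0 (Matrix.replicateRow Unit (lorentz m *ᵥ v))
        (-(lip v y) • 1) := by
    simp only [Matrix.fromBlocks_multiply, Matrix.mul_zero,
      Matrix.mul_one, add_zero, ← Matrix.replicateCol_mulVec, Matrix.mulVec_neg, h]
    congr 1
    · ext; simp
    · ext i
      simp [hv]
  have := congrArg Matrix.det e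
  rw [Matrix.det_mul, Matrix.det_fromBlocks_zero₂₁, Matrix.det_fromBlocks_zero₁₂] at this
  simpa [bord] using this

/-- The Schur complement of the lower block `r • 1` has no correction term: the columns `β, β` meet
the rows `-β, β` and cancel. -/
theorem det_smul_one_sub_xMat {m : ℕ} (Y : Matrix (Fin m) (Fin m) ℝ) (β : Fin m → ℝ) {r : ℝ}
    (hr : r ≠ 0) : (r • 1 - xMat Y β 0).det = r ^ 2 * (r • 1 - Y).det := by
  have e : r • 1 - xMat Y β 0 = Matrix.fromBlocks (r • 1 - Y)
      (-(Matrix.of fun i => ![β i, β i])) (-(Matrix.of ![-β, β])) (r • 1) := by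
    rw [xMat, ← Matrix.fromBlocks_one, Matrix.fromBlocks_smul, sub_eq_add_neg,
      Matrix.fromBlocks_neg, Matrix.fromBlocks_add, sub_eq_add_neg, smul_zero, smul_zero, zero_add,
      zero_add]
    congr 1
    ext i j
    fin_cases i <;> fin_cases j <;> simp
  have : Invertible (r • (1 : Matrix (Fin 2) (Fin 2) ℝ)) := by
    refine ⟨r⁻¹ • 1, ?_, ?_⟩ <;> simp [smul_smul, hr]
  have hinv : ⅟(r • (1 : Matrix (Fin 2) (Fin 2) ℝ)) = r⁻¹ • 1 := by
    apply invOf_eq_right_inv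
    simp [smul_smul, hr]
  have h0 : (-(Matrix.of fun i => ![β i, β i]) : Matrix (Fin m) (Fin 2) ℝ)
      * ⅟(r • (1 : Matrix (Fin 2) (Fin 2) ℝ)) * (-(Matrix.of ![-β, β])) = 0 := by
    rw [hinv]
    ext i j
    simp [Matrix.mul_apply]
  rw [e, Matrix.det_fromBlocks₂₂, h0, sub_zero]
  simp

theorem xMat_mulVec_nullVec {m : ℕ} (Y : Matrix (Fin m) (Fin m) ℝ) (β : Fin m → ℝ) (c : ℝ) :
    xMat Y β c *ᵥ nullVec m = Sum.elim ((2 : ℝ) • β) (fun _ => c) := by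
  funext i
  rw [mulVec_nullVec]
  rcases i with i | i
  · simp [xMat]; ring
  · fin_cases i <;> simp [xMat]

theorem bord_xMat {m : ℕ} {Y : Matrix (Fin m) (Fin m) ℝ} {β : Fin m → ℝ} (h : Y *ᵥ β = 0)
    {r : ℝ} (hr : r ≠ 0) :
    r * bord (xMat Y β 0) (nullVec m) r = 4 * (β ⬝ᵥ β) * (r • 1 - Y).det := by
  -- The solution is the Neumann series `ν / r + X ν / r² + X² ν / r³`, which stops there: `X ν` is
  -- twice `β` and, since `Y β = 0`, `X² ν` is a multiple of the vector `(0, -1, 1)`, which `X`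
  -- kills.
  have hs : (r • 1 - xMat Y β 0) *ᵥ (Sum.elim ((2 / r ^ 2) • β)
      ![1 / r - 2 * (β ⬝ᵥ β) / r ^ 3, 1 / r + 2 * (β ⬝ᵥ β) / r ^ 3]) = nullVec m := by
    have z : !![(0 : ℝ), 0; 0, 0] = 0 := by ext i j; fin_cases i <;> fin_cases j <;> rfl
    rw [Matrix.sub_mulVec, Matrix.smul_mulVec, Matrix.one_mulVec, xMat, z, Matrix.fromBlocks_mulVec,
      Sum.elim_comp_inl, Sum.elim_comp_inr, Matrix.mulVec_smul, h, Matrix.zero_mulVec]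
    funext i
    rcases i with i | i
    · simp [nullVec]
      simp [dotProduct]
      field_simp
      ring
    · fin_cases i
      · simp [nullVec]
        field_simp
        ring
      · simp [nullVec]
        field_simp
        ring
  rw [bord_eq_of_solve hs, det_smul_one_sub_xMat Y β hr, lip_eq]
  simp [nullVec]
  field_simp
  ring

end SpinOrbit

/-! ### Coordinates in pairs, and the bordered determinant of `t_a`. -/

namespace SpinOrbit

/-- The pairs of coordinates `2i, 2i+1` of `Fin (2 * n)`. -/
def pairs (n : ℕ) : Fin 2 × Fin n ≃ Fin (2 * n) :=
  (Equiv.prodComm _ _).trans (finProdFinEquiv.trans (finCongr (mul_comm n 2)))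

theorem pairs_val {n : ℕ} (p : Fin 2 × Fin n) : (pairs n p : ℕ) = p.1 + 2 * p.2 := by
  simp [pairs, finProdFinEquiv]

/-- The identification of index sets in the definition of `zMat`. -/
def spaceFin (k : ℕ) : Fin (2 * k + 1) ⊕ Fin 1 ≃ Fin (2 * (k + 1)) :=
  finSumFinEquiv.trans (finCongr (by ring))

/-- The pairs of space coordinates on which the compact torus acts. -/
def spacePairs (k : ℕ) : Fin 2 × Fin (k + 1) ≃ Fin (2 * k + 1) ⊕ Fin 1 :=
  (pairs (k + 1)).trans (spaceFin k).symm

/-- The block diagonal skew matrix with blocks `(0, a_i; -a_i, 0)`. -/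
def blockSkew {k : ℕ} (a : Fin (k + 1) → ℝ) :
    Matrix (Fin (2 * k + 1) ⊕ Fin 1) (Fin (2 * k + 1) ⊕ Fin 1) ℝ :=
  Matrix.reindex (spacePairs k) (spacePairs k) (Matrix.blockDiagonal fun i => !![0, a i; -a i, 0])

/-- The coordinate `2i + b` of `ℝ^{m+2}`. -/
def pairIdx {k : ℕ} (p : Fin 2 × Fin (k + 1)) : Idx (2 * k + 1) :=
  spaceTime _ (.inl (spacePairs k p))

theorem pairIdx_injective {k : ℕ} : Function.Injective (pairIdx (k := k)) := fun p q h => by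
  simpa [pairIdx] using h

theorem idx_eq_spaceTime {k j : ℕ} (h : j < 2 * k + 1 + 2) (h' : j < 2 * (k + 1)) :
    idx (2 * k + 1) j h = spaceTime _ (.inl ((spaceFin k).symm ⟨j, h'⟩)) := by
  unfold idx
  rw [Equiv.symm_apply_eq]
  by_cases hj : j < 2 * k + 1
  · have : (spaceFin k).symm ⟨j, h'⟩ = .inl ⟨j, hj⟩ := by
      rw [Equiv.symm_apply_eq]; rfl
    rw [this]; ext; simp
  · have : (spaceFin k).symm ⟨j, h'⟩ = .inr 0 := by
      rw [Equiv.symm_apply_eq]; ext; change j = 2 * k + 1; omega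
    rw [this]; ext; simp; omega

theorem spaceTime_inl_ne_last {m : ℕ} (p : Fin m ⊕ Fin 1) : spaceTime m (.inl p) ≠ .inr 1 := by
  intro h
  rw [← spaceTime_inr 0, EmbeddingLike.apply_eq_iff_eq] at h
  exact Sum.inl_ne_inr h

theorem pairIdx_eq_idx {k : ℕ} (b : Fin 2) (i : Fin (k + 1)) :
    pairIdx (b, i) = idx (2 * k + 1) (2 * i + b) (by omega) := by
  rw [idx_eq_spaceTime _ (by omega)]
  unfold pairIdx spacePairs
  rw [Equiv.trans_apply]
  congr 3
  ext
  rw [pairs_val]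
  simp [add_comm]

theorem tMat_eq {k : ℕ} (a : Fin (k + 1) → ℝ) : tMat a =
    Matrix.reindex (spaceTime _) (spaceTime _) (Matrix.fromBlocks (blockSkew a) 0 0 0) := by
  have h : tMat a = ∑ i, (Matrix.single (pairIdx (0, i)) (pairIdx (1, i)) (a i)
      - Matrix.single (pairIdx (1, i)) (pairIdx (0, i)) (a i)) := by
    unfold tMat
    refine Finset.sum_congr rfl fun i _ => ?_
    rw [pairIdx_eq_idx, pairIdx_eq_idx]
    rfl
  have hs : ∀ p : Fin 2 × Fin (k + 1), pairIdx p ≠ .inr 1 := fun p => spaceTime_inl_ne_last _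
  rw [h]
  ext x y
  obtain ⟨x, rfl⟩ := (spaceTime _).surjective x
  obtain ⟨y, rfl⟩ := (spaceTime _).surjective y
  rw [Matrix.sum_apply]
  rcases x with x | x <;> rcases y with y | y
  · obtain ⟨⟨b, i⟩, rfl⟩ := (spacePairs k).surjective x
    obtain ⟨⟨c, j⟩, rfl⟩ := (spacePairs k).surjective y
    have e1 : ∀ p, spaceTime _ (.inl (spacePairs k p)) = pairIdx p := fun _ => rfl
    simp only [e1, Matrix.sub_apply, Matrix.single_apply, pairIdx_injective.eq_iff, Prod.mk.injEq]
    simp only [pairIdx, blockSkew, Matrix.reindex_apply, Matrix.submatrix_apply,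
      Equiv.symm_apply_apply, Matrix.fromBlocks_apply₁₁, Matrix.blockDiagonal_apply]
    by_cases hij : i = j
    · subst hij
      fin_cases b <;> fin_cases c <;> simp
    · have : ∀ x, x = i → x ≠ j := fun x hx hy => hij (hx.symm.trans hy)
      rw [if_neg hij]
      refine Finset.sum_eq_zero fun x _ => ?_
      by_cases hx : x = i
      · have := this x hx
        simp [this]
      · simp [hx]
  · simp [hs]
  · simp [hs]
  · simp [hs]

theorem sum_idx {k : ℕ} (f : Idx (2 * k + 1) → ℝ) :
    ∑ x, f x = ∑ i, (f (pairIdx (0, i)) + f (pairIdx (1, i))) + f (.inr 1) := by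
  rw [← Equiv.sum_comp (spaceTime _), Fintype.sum_sum_type, ← Equiv.sum_comp (spacePairs k),
    Fintype.sum_prod_type]
  simp [Finset.sum_add_distrib, pairIdx]

theorem lip_eq_pairs {k : ℕ} (u v : Idx (2 * k + 1) → ℝ) :
    lip u v = ∑ i, (u (pairIdx (0, i)) * v (pairIdx (0, i)) + u (pairIdx (1, i)) * v (pairIdx (1, i)))
      - u (.inr 1) * v (.inr 1) := by
  have hs : ∀ p : Fin 2 × Fin (k + 1), sgn (2 * k + 1) (pairIdx p) = 1 := by
    rintro ⟨b, i⟩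
    rw [pairIdx_eq_idx]
    exact sgn_idx _ _ _ (by omega)
  rw [lip, dotProduct, sum_idx]
  simp only [lorentz, Matrix.mulVec_diagonal, hs]
  simp [sgn]
  ring

theorem tMat_mulVec {k : ℕ} (a : Fin (k + 1) → ℝ) (v : Idx (2 * k + 1) → ℝ) :
    (∀ i, (tMat a *ᵥ v) (pairIdx (0, i)) = a i * v (pairIdx (1, i))) ∧
    (∀ i, (tMat a *ᵥ v) (pairIdx (1, i)) = -(a i * v (pairIdx (0, i)))) ∧
    (tMat a *ᵥ v) (.inr 1) = 0 := by
  have key : ∀ b i, (tMat a *ᵥ v) (pairIdx (b, i))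
      = ∑ j, ((!![0, a i; -a i, 0] : Matrix (Fin 2) (Fin 2) ℝ) b j) * v (pairIdx (j, i)) := by
    intro b i
    rw [tMat_eq]
    simp only [Matrix.reindex_apply]
    rw [Matrix.submatrix_mulVec_equiv]
    simp only [Function.comp_def, pairIdx, Equiv.symm_apply_apply, Equiv.symm_symm,
      Matrix.fromBlocks_mulVec, Sum.elim_inl, Matrix.zero_mulVec,
      add_zero, blockSkew, Matrix.reindex_apply]
    rw [Matrix.submatrix_mulVec_equiv]
    simp only [Function.comp_def, Equiv.symm_apply_apply, Equiv.symm_symm, Matrix.mulVec,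
      dotProduct, Fintype.sum_prod_type, Matrix.blockDiagonal_apply]
    simp
  refine ⟨fun i => by simp [key], fun i => by simp [key], ?_⟩
  rw [← spaceTime_inr 0, tMat_eq]
  simp only [Matrix.reindex_apply]
  rw [Matrix.submatrix_mulVec_equiv]
  simp [Matrix.fromBlocks_mulVec, Function.comp_def]

theorem idx_ext_pairs {k : ℕ} {v w : Idx (2 * k + 1) → ℝ}
    (h0 : ∀ i, v (pairIdx (0, i)) = w (pairIdx (0, i)))
    (h1 : ∀ i, v (pairIdx (1, i)) = w (pairIdx (1, i)))
    (h2 : v (.inr 1) = w (.inr 1)) : v = w := by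
  refine idx_ext (fun p => ?_) h2
  obtain ⟨⟨b, i⟩, rfl⟩ := (spacePairs k).surjective p
  fin_cases b
  · exact h0 i
  · exact h1 i

theorem det_smul_one_sub_tMat {k : ℕ} (a : Fin (k + 1) → ℝ) (r : ℝ) :
    (r • 1 - tMat a).det = r * ∏ i, (r ^ 2 + a i ^ 2) := by
  have e : r • 1 - tMat a = Matrix.reindex (spaceTime _) (spaceTime _)
      (Matrix.fromBlocks (Matrix.reindex (spacePairs k) (spacePairs k)
        (Matrix.blockDiagonal fun i => !![r, -a i; a i, r])) 0 0 (r • 1)) := by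
    have h1 : (1 : Matrix (Idx (2 * k + 1)) (Idx (2 * k + 1)) ℝ)
        = Matrix.reindex (spaceTime _) (spaceTime _) 1 := by simp
    have h2 : (1 : Matrix (Fin (2 * k + 1) ⊕ Fin 1) (Fin (2 * k + 1) ⊕ Fin 1) ℝ)
        = Matrix.reindex (spacePairs k) (spacePairs k) (Matrix.blockDiagonal 1) := by simp
    rw [tMat_eq, h1, ← Matrix.fromBlocks_one, h2]
    ext x y
    obtain ⟨x, rfl⟩ := (spaceTime _).surjective x
    obtain ⟨y, rfl⟩ := (spaceTime _).surjective y
    rcases x with x | x <;> rcases y with y | y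
    · obtain ⟨⟨b, i⟩, rfl⟩ := (spacePairs k).surjective x
      obtain ⟨⟨c, j⟩, rfl⟩ := (spacePairs k).surjective y
      simp only [Matrix.reindex_apply, Matrix.smul_apply, Matrix.sub_apply, Matrix.submatrix_apply,
        Equiv.symm_apply_apply, Matrix.fromBlocks_apply₁₁, Matrix.blockDiagonal_apply, blockSkew]
      by_cases hij : i = j
      · subst hij
        fin_cases b <;> fin_cases c <;> simp
      · simp [hij]
    · simp [spaceTime_inl_ne_last]
    · simp [(spaceTime_inl_ne_last _).symm]
    · simp
  rw [e, Matrix.det_reindex_self, Matrix.det_fromBlocks_zero₂₁, Matrix.det_reindex_self,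
    Matrix.det_blockDiagonal]
  simp only [Matrix.det_fin_two_of]
  simp
  rw [mul_comm]
  congr 1
  exact Finset.prod_congr rfl fun i _ => by ring

/-- The weight `|z_i|² a_i²` of the `i`-th pair of coordinates. -/
def pairWeight {k : ℕ} (a : Fin (k + 1) → ℝ) (u : Idx (2 * k + 1) → ℝ) (i : Fin (k + 1)) : ℝ :=
  (u (pairIdx (0, i)) ^ 2 + u (pairIdx (1, i)) ^ 2) * a i ^ 2

/-- The matrix `r - t_a` splits into `2 × 2` blocks and the scalar `r`, so the system in
`bord_eq_of_solve` is solved explicitly on each pair of coordinates. -/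
theorem bord_tMat {k : ℕ} (a : Fin (k + 1) → ℝ) {u : Idx (2 * k + 1) → ℝ}
    (hu : lip u u = 0) {r : ℝ} (hr : r ≠ 0) :
    bord (tMat a) u r
      = ∑ i, pairWeight a u i * ∏ j ∈ Finset.univ.erase i, (r ^ 2 + a j ^ 2) := by
  have hpos : ∀ i, r ^ 2 + a i ^ 2 ≠ 0 := fun i => by positivity
  obtain ⟨y, hy0, hy1, hy2⟩ : ∃ y : Idx (2 * k + 1) → ℝ,
      (∀ i, y (pairIdx (0, i)) = (r * u (pairIdx (0, i)) + a i * u (pairIdx (1, i)))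
        / (r ^ 2 + a i ^ 2)) ∧
      (∀ i, y (pairIdx (1, i)) = (r * u (pairIdx (1, i)) - a i * u (pairIdx (0, i)))
        / (r ^ 2 + a i ^ 2)) ∧ y (.inr 1) = u (.inr 1) / r := by
    refine ⟨fun x => Sum.elim (fun p => (fun q : Fin 2 × Fin (k + 1) =>
        (![(r * u (pairIdx (0, q.2)) + a q.2 * u (pairIdx (1, q.2))) / (r ^ 2 + a q.2 ^ 2),
          (r * u (pairIdx (1, q.2)) - a q.2 * u (pairIdx (0, q.2))) / (r ^ 2 + a q.2 ^ 2)] : Fin 2 → ℝ)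
          q.1) ((spacePairs k).symm p))
        (fun _ => u (.inr 1) / r) ((spaceTime _).symm x), ?_, ?_, ?_⟩
    · intro i; simp [pairIdx]
    · intro i; simp [pairIdx]
    · simp
  obtain ⟨t0, t1, t2⟩ := tMat_mulVec a y
  have hs : (r • 1 - tMat a) *ᵥ y = u := by
    rw [Matrix.sub_mulVec, Matrix.smul_mulVec, Matrix.one_mulVec]
    refine idx_ext_pairs (fun i => ?_) (fun i => ?_) ?_
    · have := hpos i
      simp only [Pi.sub_apply, Pi.smul_apply, smul_eq_mul, t0, hy0, hy1]
      field_simp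
      ring
    · have := hpos i
      simp only [Pi.sub_apply, Pi.smul_apply, smul_eq_mul, t1, hy0, hy1]
      field_simp
      ring
    · simp only [Pi.sub_apply, Pi.smul_apply, smul_eq_mul, t2, hy2]
      field_simp
      ring
  -- Nullity of `u` rewrites the time term `u_last² / r` as the sum of all `|z_i|² / r`. The weights
  -- arise from `r / (r² + a²) - 1 / r = -a² / (r (r² + a²))`.
  have hl : lip u y = -∑ i, pairWeight a u i / (r * (r ^ 2 + a i ^ 2)) := by
    have e : u (.inr 1) * (u (.inr 1) / r)
        = ∑ i, (u (pairIdx (0, i)) ^ 2 + u (pairIdx (1, i)) ^ 2) / r := by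
      rw [lip_eq_pairs] at hu
      rw [← Finset.sum_div, ← mul_div_assoc]
      congr 1
      simp only [pow_two]
      linarith
    rw [lip_eq_pairs, hy2, e, ← Finset.sum_neg_distrib, ← Finset.sum_sub_distrib]
    refine Finset.sum_congr rfl fun i _ => ?_
    have := hpos i
    rw [hy0, hy1, pairWeight]
    field_simp
    ring
  rw [bord_eq_of_solve hs, det_smul_one_sub_tMat, hl, mul_neg, neg_neg, Finset.mul_sum]
  refine Finset.sum_congr rfl fun i _ => ?_
  rw [← Finset.mul_prod_erase _ _ (Finset.mem_univ i)]
  have := hpos i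
  field_simp

end SpinOrbit

/-! ### Pfaffians under congruence, and the Pfaffian sign along the orbit of `t_a`. -/

namespace SpinOrbit

theorem pairs_zero {n : ℕ} (i : Fin n) : pairs n (0, i) = ⟨2 * i, by omega⟩ := by
  ext; simp [pairs_val]

theorem pairs_one {n : ℕ} (i : Fin n) : pairs n (1, i) = ⟨2 * i + 1, by omega⟩ := by
  ext; simp [pairs_val, add_comm]

theorem pfaffian_eq {n : ℕ} (A : Matrix (Fin (2 * n)) (Fin (2 * n)) ℝ) :
    pfaffian A = (1 / (2 ^ n * n.factorial : ℝ)) * ∑ σ : Equiv.Perm (Fin (2 * n)),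
      ((Equiv.Perm.sign σ : ℤ) : ℝ) * ∏ i : Fin n, A (σ (pairs n (0, i))) (σ (pairs n (1, i))) := by
  simp only [pfaffian, pairs_zero, pairs_one]

/-- A function on `Fin (2 * n)` as a family of pairs. -/
def pairsArrow (n : ℕ) (α : Type*) : (Fin (2 * n) → α) ≃ (Fin n → α × α) :=
  (Equiv.arrowCongr (pairs n).symm (Equiv.refl α)).trans
    { toFun := fun f i => (f (0, i), f (1, i))
      invFun := fun g q => ![(g q.2).1, (g q.2).2] q.1
      left_inv := fun f => by ext ⟨b, i⟩; fin_cases b <;> rfl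
      right_inv := fun g => by ext i <;> rfl }

theorem prod_pairs {n : ℕ} (f : Fin (2 * n) → ℝ) :
    ∏ j, f j = ∏ i, (f (pairs n (0, i)) * f (pairs n (1, i))) := by
  rw [← Equiv.prod_comp (pairs n), Fintype.prod_prod_type, Fin.prod_univ_two,
    Finset.prod_mul_distrib]

/-- After expanding each entry of `U A Uᵀ`, the sum over permutations becomes, for each choice `f`
of column indices, the determinant of `U` with columns selected by `f`. It vanishes when `f` repeats
an index, and otherwise is the sign of `f` times `det U`. -/
theorem pfaffian_mul_mul_transpose {n : ℕ} (U A : Matrix (Fin (2 * n)) (Fin (2 * n)) ℝ) :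
    pfaffian (U * A * Uᵀ) = U.det * pfaffian A := by
  have h1 : ∀ σ : Equiv.Perm (Fin (2 * n)),
      ∏ i : Fin n, (U * A * Uᵀ) (σ (pairs n (0, i))) (σ (pairs n (1, i)))
      = ∑ f : Fin (2 * n) → Fin (2 * n), (∏ i, A (f (pairs n (0, i))) (f (pairs n (1, i))))
        * ∏ j, U (σ j) (f j) := by
    intro σ
    have e : ∀ p q, (U * A * Uᵀ) p q = ∑ x : Fin (2 * n) × Fin (2 * n),
        A x.1 x.2 * (U p x.1 * U q x.2) := by
      intro p q
      rw [Fintype.sum_prod_type, Finset.sum_comm, Matrix.mul_apply]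
      refine Finset.sum_congr rfl fun y _ => ?_
      rw [Matrix.mul_apply, Finset.sum_mul]
      refine Finset.sum_congr rfl fun x _ => ?_
      rw [Matrix.transpose_apply]
      ring
    simp only [e]
    rw [Finset.prod_univ_sum, Fintype.piFinset_univ, ← Equiv.sum_comp (pairsArrow n _)]
    refine Finset.sum_congr rfl fun f _ => ?_
    rw [prod_pairs, ← Finset.prod_mul_distrib]
    rfl
  have h2 : ∀ f : Fin (2 * n) → Fin (2 * n),
      ∑ σ : Equiv.Perm (Fin (2 * n)), ((Equiv.Perm.sign σ : ℤ) : ℝ) * ∏ j, U (σ j) (f j)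
        = (U.submatrix id f).det := by
    intro f
    rw [Matrix.det_apply']
    rfl
  have h3 : ∑ σ : Equiv.Perm (Fin (2 * n)), ((Equiv.Perm.sign σ : ℤ) : ℝ) *
      ∏ i : Fin n, (U * A * Uᵀ) (σ (pairs n (0, i))) (σ (pairs n (1, i)))
      = ∑ f : Fin (2 * n) → Fin (2 * n), (∏ i, A (f (pairs n (0, i))) (f (pairs n (1, i))))
        * (U.submatrix id f).det := by
    simp only [h1, Finset.mul_sum, ← h2]
    rw [Finset.sum_comm]
    refine Finset.sum_congr rfl fun f _ => Finset.sum_congr rfl fun σ _ => by ring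
  have h4 : ∑ f : Fin (2 * n) → Fin (2 * n), (∏ i, A (f (pairs n (0, i))) (f (pairs n (1, i))))
        * (U.submatrix id f).det
      = ∑ σ : Equiv.Perm (Fin (2 * n)), (∏ i, A (σ (pairs n (0, i))) (σ (pairs n (1, i))))
        * (((Equiv.Perm.sign σ : ℤ) : ℝ) * U.det) := by
    symm
    refine Finset.sum_of_injOn (fun σ => (σ : Fin (2 * n) → Fin (2 * n)))
      (fun σ _ τ _ h => Equiv.coe_fn_injective h) (fun _ _ => Finset.mem_coe.2 (Finset.mem_univ _))
      ?_ ?_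
    · intro f _ hf
      have hninj : ¬ Function.Injective f := fun hinj =>
        hf ⟨Equiv.ofBijective f (Finite.injective_iff_bijective.1 hinj), by simp, rfl⟩
      simp only [Function.Injective, not_forall] at hninj
      obtain ⟨i, j, hij, hne⟩ := hninj
      rw [Matrix.det_zero_of_column_eq hne, mul_zero]
      intro x
      simp [hij]
    · intro σ _
      rw [← Matrix.det_permute']
  rw [pfaffian_eq, pfaffian_eq, h3, h4, mul_left_comm]
  congr 1
  rw [Finset.mul_sum]
  exact Finset.sum_congr rfl fun σ _ => by ring

/-- A permutation of `Fin 2 × Fin n` mapping pairs to pairs. -/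
theorem sign_of_pairs {n : ℕ} (σ : Equiv.Perm (Fin 2 × Fin n))
    (h : ∀ i, (σ (0, i)).2 = (σ (1, i)).2) :
    ((Equiv.Perm.sign σ : ℤ) : ℝ)
      = ∏ i, (!![0, 1; -1, 0] : Matrix (Fin 2) (Fin 2) ℝ) (σ (0, i)).1 (σ (1, i)).1 := by
  have hne : ∀ i, (σ (0, i)).1 ≠ (σ (1, i)).1 := fun i hi => by
    have := σ.injective (Prod.ext hi (h i))
    simp at this
  have hinj : Function.Injective fun i => (σ (0, i)).2 := by
    intro i j hij
    simp only at hij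
    have : (σ (0, j)).1 = (σ (0, i)).1 ∨ (σ (0, j)).1 = (σ (1, i)).1 := by
      have := hne i
      omega
    rcases this with hb | hb
    · have := σ.injective (Prod.ext hb hij.symm)
      simpa using this.symm
    · have := σ.injective (Prod.ext hb (hij.symm.trans (h i)))
      simp at this
  set τ : Equiv.Perm (Fin n) := Equiv.ofBijective _ (Finite.injective_iff_bijective.1 hinj) with hτ
  set ρ : Fin n → Equiv.Perm (Fin 2) :=
    fun i => if (σ (0, i)).1 = 0 then 1 else Equiv.swap 0 1 with hρ
  -- Swaps inside the pairs come first, then a permutation `τ` of the pairs. The latter acts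
  -- identically on both members of a pair, hence is even, and only the swaps contribute to the
  -- sign.
  have hσ : σ = (Equiv.prodCongrRight fun _ : Fin 2 => τ) * Equiv.prodCongrLeft ρ := by
    ext1 ⟨b, i⟩
    rw [Equiv.Perm.mul_apply]
    have := hne i
    fin_cases b
    · refine Prod.ext ?_ rfl
      simp only [hρ]
      by_cases h0 : (σ (0, i)).1 = 0
      · simp [h0]
      · have : (σ (0, i)).1 = 1 := by omega
        simp [this]
    · refine Prod.ext ?_ (h i).symm
      simp only [hρ]
      by_cases h0 : (σ (0, i)).1 = 0
      · have : (σ (1, i)).1 = 1 := by omega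
        simp [h0, this]
      · have h1 : (σ (0, i)).1 = 1 := by omega
        have : (σ (1, i)).1 = 0 := by omega
        simp [h1, this]
  have hs : Equiv.Perm.sign σ = ∏ i, Equiv.Perm.sign (ρ i) := by
    rw [hσ, map_mul, Equiv.Perm.sign_prodCongrRight, Equiv.Perm.sign_prodCongrLeft]
    simp
  rw [hs]
  push_cast
  refine Finset.prod_congr rfl fun i _ => ?_
  have := hne i
  simp only [hρ]
  by_cases h0 : (σ (0, i)).1 = 0
  · have : (σ (1, i)).1 = 1 := by omega
    simp [h0, this]
  · have h1 : (σ (0, i)).1 = 1 := by omega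
    have : (σ (1, i)).1 = 0 := by omega
    simp [h1, this]

/-- The standard symplectic matrix. -/
def stdSkew (n : ℕ) : Matrix (Fin (2 * n)) (Fin (2 * n)) ℝ :=
  Matrix.reindex (pairs n) (pairs n) (Matrix.blockDiagonal fun _ => !![0, 1; -1, 0])

/-- A nonzero term belongs to a permutation mapping pairs to pairs; by `sign_of_pairs` its product
is its own sign, so the term is a square. The identity contributes a positive term. Only signs
matter later, so the value is not needed. -/
theorem pfaffian_stdSkew_pos (n : ℕ) : 0 < pfaffian (stdSkew n) := by
  rw [pfaffian_eq]
  refine mul_pos (by positivity) ?_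
  have key : ∀ σ : Equiv.Perm (Fin (2 * n)), 0 ≤ ((Equiv.Perm.sign σ : ℤ) : ℝ) *
      ∏ i : Fin n, stdSkew n (σ (pairs n (0, i))) (σ (pairs n (1, i))) := by
    intro σ
    set τ : Equiv.Perm (Fin 2 × Fin n) := (pairs n).symm.permCongr σ with hτ
    have hs : Equiv.Perm.sign σ = Equiv.Perm.sign τ := (Equiv.Perm.sign_permCongr _ _).symm
    have hterm : ∀ i, stdSkew n (σ (pairs n (0, i))) (σ (pairs n (1, i)))
        = if (τ (0, i)).2 = (τ (1, i)).2 then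
          (!![0, 1; -1, 0] : Matrix (Fin 2) (Fin 2) ℝ) (τ (0, i)).1 (τ (1, i)).1 else 0 := by
      intro i
      simp [stdSkew, hτ, Matrix.blockDiagonal_apply, Equiv.permCongr_apply]
    simp only [hterm]
    by_cases h : ∀ i, (τ (0, i)).2 = (τ (1, i)).2
    · simp only [h, if_true]
      rw [hs, ← sign_of_pairs τ h]
      exact mul_self_nonneg _
    · push Not at h
      obtain ⟨i, hi⟩ := h
      rw [Finset.prod_eq_zero (Finset.mem_univ i) (by rw [if_neg hi]), mul_zero]
  refine Finset.sum_pos' (fun σ _ => key σ) ⟨1, Finset.mem_univ _, ?_⟩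
  simp [stdSkew, Matrix.blockDiagonal_apply]

/-- If `A v = 0` with `v ≠ 0`, the orthogonal projection `U` along `v` satisfies `U A Uᵀ = A` but
has determinant `0`, so the Pfaffian vanishes. -/
theorem mulVec_eq_zero_of_pfaffian {n : ℕ} {A : Matrix (Fin (2 * n)) (Fin (2 * n)) ℝ}
    (hA : Aᵀ = -A) (hpf : pfaffian A ≠ 0) {v : Fin (2 * n) → ℝ} (hv : A *ᵥ v = 0) : v = 0 := by
  by_contra hne
  have hvv : v ⬝ᵥ v ≠ 0 := fun h => hne (dotProduct_self_eq_zero.1 h)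
  set U : Matrix (Fin (2 * n)) (Fin (2 * n)) ℝ := 1 - (v ⬝ᵥ v)⁻¹ • Matrix.vecMulVec v v with hU
  have hdet : U.det = 0 := by
    have e : U = 1 + Matrix.replicateCol Unit (-(v ⬝ᵥ v)⁻¹ • v) * Matrix.replicateRow Unit v := by
      rw [hU, ← Matrix.vecMulVec_eq, Matrix.smul_vecMulVec, neg_smul]
      abel
    rw [e, Matrix.det_one_add_replicateCol_mul_replicateRow, dotProduct_smul]
    simp [hvv]
  have hAv : v ᵥ* A = 0 := by
    rw [← Matrix.mulVec_transpose, hA, Matrix.neg_mulVec, hv, neg_zero]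
  have h1 : U * A = A := by
    rw [hU, sub_mul, one_mul, Matrix.smul_mul, Matrix.vecMulVec_mul, hAv]
    simp
  have h2 : A * Uᵀ = A := by
    rw [hU, Matrix.transpose_sub, Matrix.transpose_smul, Matrix.transpose_vecMulVec,
      Matrix.transpose_one, mul_sub, mul_one, Matrix.mul_smul, Matrix.mul_vecMulVec, hv]
    simp
  have := pfaffian_mul_mul_transpose U A
  rw [h1, h2, hdet, zero_mul] at this
  exact hpf this

/-- The Pfaffian of a matrix indexed by the space coordinates. -/
noncomputable def spacePf {k : ℕ} (A : Matrix (Fin (2 * k + 1) ⊕ Fin 1) (Fin (2 * k + 1) ⊕ Fin 1) ℝ) :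
    ℝ := pfaffian (Matrix.reindex (spaceFin k) (spaceFin k) A)

theorem spacePf_mul_mul_transpose {k : ℕ}
    (U A : Matrix (Fin (2 * k + 1) ⊕ Fin 1) (Fin (2 * k + 1) ⊕ Fin 1) ℝ) :
    spacePf (U * A * Uᵀ) = U.det * spacePf A := by
  rw [spacePf, spacePf, ← Matrix.det_reindex_self (spaceFin k) U, ← pfaffian_mul_mul_transpose]
  simp [Matrix.submatrix_mul_equiv]

theorem spacePf_blockSkew {k : ℕ} (a : Fin (k + 1) → ℝ) :
    spacePf (blockSkew a) = (∏ i, a i) * pfaffian (stdSkew (k + 1)) := by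
  set U : Matrix (Fin (2 * (k + 1))) (Fin (2 * (k + 1))) ℝ :=
    Matrix.reindex (pairs _) (pairs _) (Matrix.blockDiagonal fun i => !![a i, 0; 0, 1]) with hU
  have e : Matrix.reindex (spaceFin k) (spaceFin k) (blockSkew a) = U * stdSkew (k + 1) * Uᵀ := by
    rw [hU, stdSkew, Matrix.transpose_reindex, Matrix.blockDiagonal_transpose]
    simp only [Matrix.reindex_apply, Matrix.submatrix_mul_equiv, ← Matrix.blockDiagonal_mul,
      blockSkew, Matrix.submatrix_submatrix]
    have : ∀ i, !![a i, 0; 0, 1] * !![0, 1; -1, 0] * (!![a i, 0; 0, 1])ᵀ = !![0, a i; -a i, 0] := by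
      intro i
      ext x y
      fin_cases x <;> fin_cases y <;> simp [Matrix.mul_apply]
    simp only [this]
    congr 1 <;> exact funext fun x => by simp [spacePairs]
  rw [spacePf, e, pfaffian_mul_mul_transpose, hU, Matrix.det_reindex_self,
    Matrix.det_blockDiagonal]
  simp

/-- The matrix `Z_{Y,γ}` indexed by the space coordinates. -/
def skewExt {m : ℕ} (Y : Matrix (Fin m) (Fin m) ℝ) (γ : Fin m → ℝ) :
    Matrix (Fin m ⊕ Fin 1) (Fin m ⊕ Fin 1) ℝ :=
  Matrix.fromBlocks Y (Matrix.of fun i _ => γ i) (Matrix.of fun _ j => -γ j) 0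

theorem pfaffian_zMat {k : ℕ} (Y : Matrix (Fin (2 * k + 1)) (Fin (2 * k + 1)) ℝ)
    (β : Fin (2 * k + 1) → ℝ) :
    pfaffian (zMat Y β) = spacePf (skewExt Y ((√(β ⬝ᵥ β))⁻¹ • β)) := by
  have : (√(β ⬝ᵥ β))⁻¹ • β = fun i => β i / √(β ⬝ᵥ β) := by
    ext i; simp [div_eq_inv_mul]
  rw [this]
  rfl

theorem spacePf_skewExt_smul {k : ℕ} (Y : Matrix (Fin (2 * k + 1)) (Fin (2 * k + 1)) ℝ)
    (γ : Fin (2 * k + 1) → ℝ) (c : ℝ) :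
    spacePf (skewExt Y (c • γ)) = c * spacePf (skewExt Y γ) := by
  have e : skewExt Y (c • γ) = Matrix.fromBlocks 1 0 0 (c • 1) * skewExt Y γ
      * (Matrix.fromBlocks 1 0 0 (c • 1))ᵀ := by
    simp only [skewExt, Matrix.fromBlocks_transpose, Matrix.fromBlocks_multiply]
    ext x y
    rcases x with x | x <;> rcases y with y | y <;> simp
  rw [e, spacePf_mul_mul_transpose, Matrix.det_fromBlocks_zero₂₁]
  simp

theorem spacePf_skewExt_conj {k : ℕ} (U Y : Matrix (Fin (2 * k + 1)) (Fin (2 * k + 1)) ℝ)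
    (γ : Fin (2 * k + 1) → ℝ) :
    spacePf (skewExt (U * Y * Uᵀ) (U *ᵥ γ)) = U.det * spacePf (skewExt Y γ) := by
  have e : skewExt (U * Y * Uᵀ) (U *ᵥ γ) = Matrix.fromBlocks U 0 0 1 * skewExt Y γ
      * (Matrix.fromBlocks U 0 0 1)ᵀ := by
    simp only [skewExt, Matrix.fromBlocks_transpose, Matrix.fromBlocks_multiply]
    ext x y
    rcases x with x | x <;> rcases y with y | y <;>
      simp [Matrix.mul_apply, Matrix.mulVec, dotProduct, mul_comm]
  rw [e, spacePf_mul_mul_transpose, Matrix.det_fromBlocks_zero₂₁]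
  simp

/-- The transvection sending `nullVec` to the last basis vector. -/
def nullShear (m : ℕ) : Matrix (Idx m) (Idx m) ℝ := Matrix.transvection (.inr 0) (.inr 1) (-1)

theorem nullShear_mulVec {m : ℕ} (v : Idx m → ℝ) :
    nullShear m *ᵥ v = v - v (.inr 1) • Pi.single (.inr 0) 1 := by
  rw [nullShear, Matrix.transvection, Matrix.add_mulVec, Matrix.one_mulVec, Matrix.single_mulVec,
    sub_eq_add_neg]
  congr 1
  ext i
  by_cases hi : i = .inr 0
  · subst hi; simp
  · simp [hi]

theorem nullShear_nullVec (m : ℕ) : nullShear m *ᵥ nullVec m = Pi.single (.inr 1) 1 := by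
  rw [nullShear_mulVec]
  ext i
  rcases i with i | i
  · simp [nullVec]
  · fin_cases i <;> simp [nullVec]

/-- The action of `g` followed by the projection along `nullVec`, on space vectors. -/
def projMat {m : ℕ} (g : Matrix (Idx m) (Idx m) ℝ) :
    Matrix (Fin m ⊕ Fin 1) (Fin m ⊕ Fin 1) ℝ :=
  (nullShear m * g).submatrix (fun p => spaceTime m (.inl p)) (fun p => spaceTime m (.inl p))

/-- Exchange the last basis vector for `u`, at the cost of the factor `u_last`. Then `nullShear * g`
sends `u` to the last basis vector, and the matrix becomes block triangular with corner `projMat g`.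
-/
theorem det_projMat {m : ℕ} {g : Matrix (Idx m) (Idx m) ℝ} {u : Idx m → ℝ}
    (hu : g *ᵥ u = nullVec m) : (projMat g).det = g.det * u (.inr 1) := by
  set R : Matrix (Idx m) (Idx m) ℝ := Matrix.updateCol 1 (.inr 1) u with hR
  have hdet : (nullShear m * g * R).det = g.det * u (.inr 1) := by
    rw [Matrix.det_mul, Matrix.det_mul, nullShear, Matrix.det_transvection_of_ne _ _ (by simp),
      one_mul, hR, ← Matrix.cramer_apply, Matrix.cramer_one]
    rfl
  have hR1 : ∀ p, R *ᵥ Pi.single (spaceTime m (.inl p)) 1 = Pi.single (spaceTime m (.inl p)) 1 := by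
    intro p
    rw [Matrix.mulVec_single_one]
    ext x
    rw [Matrix.col_apply, hR, Matrix.updateCol_ne (spaceTime_inl_ne_last p), Matrix.one_apply,
      Pi.single_apply]
  have hR2 : R *ᵥ Pi.single (.inr 1) 1 = u := by
    rw [Matrix.mulVec_single_one]
    ext x
    rw [Matrix.col_apply, hR, Matrix.updateCol_self]
  have e : nullShear m * g * R = Matrix.reindex (spaceTime m) (spaceTime m)
      (Matrix.fromBlocks (projMat g) 0 (Matrix.of fun _ q => (nullShear m * g) (.inr 1)
        (spaceTime m (.inl q))) 1) := by
    refine Matrix.ext_of_mulVec_single fun y => ?_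
    obtain ⟨y, rfl⟩ := (spaceTime m).surjective y
    rcases y with y | y
    · rw [← Matrix.mulVec_mulVec, hR1, Matrix.mulVec_single_one, Matrix.mulVec_single_one]
      refine idx_ext (fun p => ?_) ?_
      · simp [projMat]
      · simp
    · rw [spaceTime_inr, ← Matrix.mulVec_mulVec, hR2, ← Matrix.mulVec_mulVec, hu,
        nullShear_nullVec, Matrix.mulVec_single_one]
      refine idx_ext (fun p => ?_) ?_
      · simp [spaceTime_inl_ne_last]
      · simp
  rw [← hdet, e, Matrix.det_reindex_self, Matrix.det_fromBlocks_zero₁₂, Matrix.det_one, mul_one]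

theorem tMat_space {k : ℕ} (a : Fin (k + 1) → ℝ) (p q) :
    tMat a (spaceTime _ (.inl p)) (spaceTime _ (.inl q)) = blockSkew a p q := by
  rw [tMat_eq]
  simp only [Matrix.reindex_apply, Matrix.submatrix_apply, Equiv.symm_apply_apply,
    Matrix.fromBlocks_apply₁₁]

theorem tMat_last_right {k : ℕ} (a : Fin (k + 1) → ℝ) (x) : tMat a x (.inr 1) = 0 := by
  obtain ⟨x, rfl⟩ := (spaceTime _).surjective x
  rw [tMat_eq, ← spaceTime_inr 0]
  simp only [Matrix.reindex_apply, Matrix.submatrix_apply, Equiv.symm_apply_apply]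
  rcases x with x | x <;> rfl

theorem tMat_last_left {k : ℕ} (a : Fin (k + 1) → ℝ) (y) : tMat a (.inr 1) y = 0 := by
  obtain ⟨y, rfl⟩ := (spaceTime _).surjective y
  rw [tMat_eq, ← spaceTime_inr 0]
  simp only [Matrix.reindex_apply, Matrix.submatrix_apply, Equiv.symm_apply_apply]
  rcases y with y | y <;> rfl

theorem sum_spaceTime {m : ℕ} (f : Idx m → ℝ) :
    ∑ x, f x = ∑ p, f (spaceTime m (.inl p)) + f (.inr 1) := by
  rw [← Equiv.sum_comp (spaceTime m), Fintype.sum_sum_type]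
  simp

/-- The time row and column of `t_a` vanish, so the time index contributes nothing to the triple
product and may be dropped. -/
theorem projMat_blockSkew {k : ℕ} (g : Matrix (Idx (2 * k + 1)) (Idx (2 * k + 1)) ℝ)
    (a : Fin (k + 1) → ℝ) :
    projMat g * blockSkew a * (projMat g)ᵀ
      = (nullShear _ * (g * tMat a * gᵀ) * (nullShear _)ᵀ).submatrix
        (fun p => spaceTime _ (.inl p)) (fun p => spaceTime _ (.inl p)) := by
  have e : nullShear _ * (g * tMat a * gᵀ) * (nullShear _)ᵀ
      = (nullShear _ * g) * tMat a * (nullShear _ * g)ᵀ := by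
    simp only [Matrix.transpose_mul, mul_assoc]
  rw [e, projMat]
  generalize nullShear _ * g = M
  ext p q
  simp only [Matrix.submatrix_apply, Matrix.mul_apply, Matrix.transpose_apply, sum_spaceTime,
    tMat_last_left, tMat_last_right, tMat_space, mul_zero, zero_mul, add_zero,
    Finset.sum_const_zero]

/-- The image of the bivector of `X` in the quotient by `nullVec`. -/
theorem nullShear_conj {m : ℕ} {X : Matrix (Idx m) (Idx m) ℝ} (hX : X ∈ lieG m)
    {β : Fin m → ℝ} (h : X *ᵥ nullVec m = Sum.elim ((2 : ℝ) • β) 0) :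
    (nullShear m * (X * lorentz m) * (nullShear m)ᵀ).submatrix
        (fun p => spaceTime _ (.inl p)) (fun p => spaceTime _ (.inl p))
      = skewExt (Matrix.of fun i j => X (.inl i) (.inl j)) ((2 : ℝ) • β) := by
  have h1 : ∀ i, X (.inl i) (.inr 0) + X (.inl i) (.inr 1) = 2 * β i := by
    intro i
    rw [← mulVec_nullVec, h]; simp
  obtain ⟨k1, k2, k3⟩ := lieG_inr_inr hX
  have h2 := mulVec_nullVec X (.inr 0)
  rw [h, k1] at h2
  simp at h2
  have hL : ∀ (A : Matrix (Idx m) (Idx m) ℝ) x y, (nullShear m * A * (nullShear m)ᵀ) x y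
      = (A x y - (if x = .inr 0 then A (.inr 1) y else 0))
        - (if y = .inr 0 then A x (.inr 1) - (if x = .inr 0 then A (.inr 1) (.inr 1) else 0)
          else 0) := by
    intro A x y
    rw [nullShear, Matrix.transvection, Matrix.transpose_add, Matrix.transpose_one,
      Matrix.transpose_single]
    simp only [add_mul, mul_add, one_mul, mul_one, Matrix.add_apply]
    by_cases hx : x = .inr 0 <;> by_cases hy : y = .inr 0 <;> simp [hx, hy] <;> ring
  ext p q
  rw [Matrix.submatrix_apply, hL]
  simp only [lorentz, Matrix.mul_diagonal]
  rcases p with p | p <;> rcases q with q | q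
  · simp [skewExt, sgn]
  · simp [skewExt, sgn, ← h1]
  · have := lieG_inr_inl hX q
    simp [skewExt, sgn, ← h1, this.1, this.2]
    ring
  · simp [skewExt, sgn, k1, k2, k3, ← h2]

/-- For `X = g t_a g⁻¹` one has `X I_{m+1,1} = g t_a gᵗ`, an honest congruence. Modulo `ν` it gives
`skewExt Y (2β)` as the congruence of `blockSkew a` by `projMat g`, whose determinant is the time
coordinate of `g⁻¹ν`, positive by `toMat_future`. -/
theorem sign_spacePf {k : ℕ} (a : Fin (k + 1) → ℝ) (ha : ∀ i : Fin k, 0 < a i.castSucc)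
    (g : Spin (2 * k + 1)) {β : Fin (2 * k + 1) → ℝ}
    (h : (toMat _ g * tMat a * toMat _ g⁻¹) *ᵥ nullVec _ = Sum.elim ((2 : ℝ) • β) 0) :
    SignType.sign (spacePf (skewExt
      (Matrix.of fun i j => (toMat _ g * tMat a * toMat _ g⁻¹) (.inl i) (.inl j)) β))
      = SignType.sign (a (Fin.last k)) := by
  have hX := conj_mem_lieG g (tMat_mem a)
  have e := nullShear_conj hX h
  have hinv : toMat _ g⁻¹ = lorentz _ * (toMat _ g)ᵀ * lorentz _ :=
    left_inv_eq_right_inv (toMat_inv_mul g)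
      (mul_eq_one_comm.1 (isometry_left_inv (toMat_transpose_mul g)))
  have htJ : tMat a * lorentz (2 * k + 1) = tMat a := by
    ext x y
    rw [lorentz, Matrix.mul_diagonal]
    obtain ⟨y, rfl⟩ := (spaceTime _).surjective y
    rcases y with (y | y) | y <;> simp [sgn, tMat_last_right]
  have e2 : toMat _ g * tMat a * toMat _ g⁻¹ * lorentz _
      = toMat _ g * tMat a * (toMat _ g)ᵀ := by
    rw [hinv]
    calc _ = toMat _ g * (tMat a * lorentz _) * (toMat _ g)ᵀ * (lorentz _ * lorentz _) := by
          simp only [mul_assoc]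
      _ = _ := by rw [htJ, lorentz_mul_self, mul_one]
  rw [e2, ← projMat_blockSkew] at e
  have hu : toMat _ g *ᵥ (toMat _ g⁻¹ *ᵥ nullVec _) = nullVec _ := by
    rw [Matrix.mulVec_mulVec, toMat_mul_inv, Matrix.one_mulVec]
  have hlast : 0 < (toMat _ g⁻¹ *ᵥ nullVec (2 * k + 1)) (.inr 1) :=
    toMat_future g⁻¹ (lip_nullVec _).le (by simp [nullVec])
  have h3 := congrArg spacePf e
  rw [spacePf_mul_mul_transpose, det_projMat hu, det_toMat, one_mul, spacePf_blockSkew,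
    spacePf_skewExt_smul, Fin.prod_univ_castSucc] at h3
  set s := (toMat _ g⁻¹ *ᵥ nullVec (2 * k + 1)) (.inr 1)
  have hp : 0 < ∏ i : Fin k, a i.castSucc := Finset.prod_pos fun i _ => ha i
  have h4 : spacePf (skewExt
      (Matrix.of fun i j => (toMat _ g * tMat a * toMat _ g⁻¹) (.inl i) (.inl j)) β)
      = (s * (∏ i : Fin k, a i.castSucc) * pfaffian (stdSkew (k + 1)) / 2) * a (Fin.last k) := by
    linear_combination (-1 / 2 : ℝ) * h3
  rw [h4, sign_mul, sign_pos (by have := pfaffian_stdSkew_pos (k + 1); positivity), one_mul]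

end SpinOrbit

/-! ### Interlacing zeros and nonnegative weights. -/

namespace SpinOrbit

theorem prod_erase_eq_succAbove {k : ℕ} (t : Fin (k + 1)) (f : Fin (k + 1) → ℝ) :
    ∏ j ∈ Finset.univ.erase t, f j = ∏ l, f (t.succAbove l) := by
  rw [← Finset.compl_singleton, ← Fin.image_succAbove_univ, Finset.prod_image]
  exact fun x _ y _ h => Fin.succAbove_right_injective h

open Polynomial in
theorem natDegree_prod_C_sub_X_le {ι : Type*} (s : Finset ι) (f : ι → ℝ) :
    (∏ i ∈ s, (C (f i) - X)).natDegree ≤ s.card := by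
  refine (natDegree_prod_le _ _).trans ?_
  refine (Finset.sum_le_card_nsmul _ _ 1 fun i _ => ?_).trans (by simp)
  exact (natDegree_sub_le _ _).trans (by simp)

-- Up to the sign `(-1)^k`, the sum is the coefficient of `X^k` in the Lagrange interpolant of `p`
-- at the `k + 1` nodes, and that interpolant is `p` itself.
open Polynomial in
theorem sum_eval_div_eq_zero {k : ℕ} {b : Fin (k + 1) → ℝ} (hb : Function.Injective b)
    {p : ℝ[X]} (hp : p.degree < k) :
    ∑ t, p.eval (b t) / ∏ j ∈ Finset.univ.erase t, (b j - b t) = 0 := by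
  have h := Lagrange.coeff_eq_sum (s := Finset.univ) (v := b) hb.injOn (P := p)
    (by simpa using hp.trans (by exact_mod_cast Nat.lt_succ_self k))
  rw [coeff_eq_zero_of_degree_lt (by simpa using hp)] at h
  have e : ∀ t, ∏ j ∈ Finset.univ.erase t, (b j - b t)
      = (-1) ^ k * ∏ j ∈ Finset.univ.erase t, (b t - b j) := by
    intro t
    have : (-1 : ℝ) ^ k = ∏ j ∈ Finset.univ.erase t, (-1 : ℝ) := by simp
    rw [this, ← Finset.prod_mul_distrib]
    exact Finset.prod_congr rfl fun j _ => by ring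
  simp only [e, div_mul_eq_div_div_swap]
  rw [← Finset.sum_div, ← h, zero_div]

/-- Upper half of the interlacing inequalities for the zeros of `∑ w_i ∏_{j ≠ i} (b_j - μ)`. -/
theorem interlace_upper {k : ℕ} {b : Fin (k + 1) → ℝ} (hb : StrictAnti b) {w : Fin (k + 1) → ℝ}
    (hw : ∀ i, 0 ≤ w i) {y : Fin k → ℝ} (hy : Antitone y) {c : ℝ} (hc : 0 < c)
    (h : ∀ t, w t * ∏ j ∈ Finset.univ.erase t, (b j - b t) = c * ∏ l, (y l - b t)) (i : Fin k) :
    y i ≤ b i.castSucc := by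
  classical
  by_contra hlt
  rw [not_le] at hlt
  have hD : ∀ t, ∏ j ∈ Finset.univ.erase t, (b j - b t) ≠ 0 := fun t =>
    Finset.prod_ne_zero_iff.2 fun j hj => sub_ne_zero.2 (hb.injective.ne (Finset.ne_of_mem_erase hj))
  set S : Finset (Fin (k + 1)) := Finset.univ.filter (· < i.castSucc) with hS
  set T : Finset (Fin k) := Finset.univ.filter (i < ·) with hT
  have cS : S.card = i := by
    rw [show S = Finset.Iio i.castSucc by ext; simp [hS], Fin.card_Iio, Fin.val_castSucc]
  have cT : T.card = k - 1 - i := by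
    rw [show T = Finset.Ioi i by ext; simp [hT], Fin.card_Ioi]
  -- Assume `y i > b i` for contradiction. This test polynomial has degree at most `k - 1`, so
  -- `sum_eval_div_eq_zero` applies. The factors from `S` kill the terms with `t < i`. For `t ≥ i`
  -- the factors from `T` cancel in the ratio against `∏ (y l - b t)` and leave a positive multiple
  -- of `w t`. Hence every remaining weight is zero.
  set p : Polynomial ℝ := (∏ s ∈ S, (Polynomial.C (b s) - Polynomial.X))
    * ∏ l ∈ T, (Polynomial.C (y l) - Polynomial.X) with hp
  have hpd : p.degree < k := by
    have h1 : p.natDegree ≤ i + (k - 1 - i) := by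
      refine Polynomial.natDegree_mul_le.trans (add_le_add ?_ ?_)
      · exact (natDegree_prod_C_sub_X_le _ _).trans cS.le
      · exact (natDegree_prod_C_sub_X_le _ _).trans cT.le
    refine lt_of_le_of_lt Polynomial.degree_le_natDegree ?_
    exact_mod_cast lt_of_le_of_lt h1 (by omega)
  have heval : ∀ t, p.eval (b t) = (∏ s ∈ S, (b s - b t)) * ∏ l ∈ T, (y l - b t) := by
    intro t
    simp [hp, Polynomial.eval_prod]
  have hsplit : ∀ t, ∏ l, (y l - b t)
      = (∏ l ∈ Finset.univ.filter (¬ i < ·), (y l - b t)) * ∏ l ∈ T, (y l - b t) := by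
    intro t
    rw [mul_comm, hT, Finset.prod_filter_mul_prod_filter_not]
  have hpos1 : ∀ t, i.castSucc ≤ t → 0 < ∏ l ∈ Finset.univ.filter (¬ i < ·), (y l - b t) := by
    intro t ht
    refine Finset.prod_pos fun l hl => ?_
    have h1 : y i ≤ y l := hy (not_lt.1 (Finset.mem_filter.1 hl).2)
    have h2 : b t ≤ b i.castSucc := hb.antitone ht
    linarith
  have hpos2 : ∀ t, i.castSucc ≤ t → 0 < ∏ s ∈ S, (b s - b t) := by
    intro t ht
    refine Finset.prod_pos fun s hs => ?_
    have : b t < b s := hb ((Finset.mem_filter.1 hs).2.trans_le ht)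
    linarith
  have hterm : ∀ t, i.castSucc ≤ t → p.eval (b t) / ∏ j ∈ Finset.univ.erase t, (b j - b t)
      = (∏ s ∈ S, (b s - b t)) / (∏ l ∈ Finset.univ.filter (¬ i < ·), (y l - b t)) * (w t / c) := by
    intro t ht
    have h1 := h t
    have h2 := hpos1 t ht
    rw [hsplit] at h1
    rw [heval]
    have := hD t
    field_simp
    linear_combination (-(∏ s ∈ S, (b s - b t))) * h1
  have hzero : ∀ t, ¬ i.castSucc ≤ t → p.eval (b t) = 0 := by
    intro t ht
    rw [heval, Finset.prod_eq_zero (i := t) (by simpa [hS] using ht) (sub_self _), zero_mul]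
  have hnn : ∀ t ∈ Finset.univ, 0 ≤ p.eval (b t) / ∏ j ∈ Finset.univ.erase t, (b j - b t) := by
    intro t _
    by_cases ht : i.castSucc ≤ t
    · rw [hterm t ht]
      exact mul_nonneg (div_nonneg (hpos2 t ht).le (hpos1 t ht).le) (div_nonneg (hw t) hc.le)
    · rw [hzero t ht, zero_div]
  have hall := (Finset.sum_eq_zero_iff_of_nonneg hnn).1 (sum_eval_div_eq_zero hb.injective hpd)
  have hroot : ∀ t, i.castSucc ≤ t → ∃ l ∈ T, y l = b t := by
    intro t ht
    have h1 := hall t (Finset.mem_univ t)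
    rw [hterm t ht] at h1
    have hw0 : w t = 0 := by
      rcases mul_eq_zero.1 h1 with h1 | h1
      · exact absurd h1 (div_pos (hpos2 t ht) (hpos1 t ht)).ne'
      · exact (div_eq_zero_iff.1 h1).resolve_right hc.ne'
    have h2 := h t
    rw [hw0, zero_mul, hsplit] at h2
    have h3 : ∏ l ∈ T, (y l - b t) = 0 := by
      rcases mul_eq_zero.1 h2.symm with h3 | h3
      · exact absurd h3 hc.ne'
      · exact (mul_eq_zero.1 h3).resolve_left (hpos1 t ht).ne'
    obtain ⟨l, hl, hl0⟩ := Finset.prod_eq_zero_iff.1 h3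
    exact ⟨l, hl, sub_eq_zero.1 hl0⟩
  have : Nonempty (Fin k) := ⟨i⟩
  choose! r hrT hr using hroot
  -- With zero weights, each of the `k + 1 - i` nodes `b t`, `t ≥ i`, must be some `y l` with `l >
  -- i`; only `k - 1 - i` such indices exist.
  have hcard : (Finset.univ.filter (i.castSucc ≤ ·) : Finset (Fin (k + 1))).card ≤ T.card := by
    refine Finset.card_le_card_of_injOn r (fun t ht => hrT t (by simpa using ht)) ?_
    intro s hs t ht hst
    have h1 := hr s (by simpa using hs)
    have h2 := hr t (by simpa using ht)
    rw [hst, h2] at h1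
    exact hb.injective h1.symm
  have : (Finset.univ.filter (i.castSucc ≤ ·) : Finset (Fin (k + 1))).card = k + 1 - i := by
    rw [show Finset.univ.filter (i.castSucc ≤ ·) = Finset.Ici i.castSucc by ext; simp,
      Fin.card_Ici, Fin.val_castSucc]
  omega

/-- The lower bounds are the upper bounds for the data negated and listed in reverse order. -/
theorem interlace_of_weights {k : ℕ} {b : Fin (k + 1) → ℝ} (hb : StrictAnti b)
    {w : Fin (k + 1) → ℝ} (hw : ∀ i, 0 ≤ w i) {y : Fin k → ℝ} (hy : Antitone y) {c : ℝ}
    (hc : 0 < c)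
    (h : ∀ t, w t * ∏ j ∈ Finset.univ.erase t, (b j - b t) = c * ∏ l, (y l - b t)) (i : Fin k) :
    b i.succ ≤ y i ∧ y i ≤ b i.castSucc := by
  refine ⟨?_, interlace_upper hb hw hy hc h i⟩
  have h1 := interlace_upper (b := fun t => -b t.rev) (w := fun t => w t.rev)
    (y := fun l => -y l.rev) (c := c) (fun s t hst => neg_lt_neg (hb (Fin.rev_lt_rev.2 hst)))
    (fun t => hw _) (fun s t hst => neg_le_neg (hy (Fin.rev_le_rev.2 hst))) hc ?_ i.rev
  · simp only [Fin.rev_rev, Fin.rev_castSucc] at h1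
    linarith
  · intro t
    have h2 := h t.rev
    have e1 : ∏ j ∈ Finset.univ.erase t, (-b j.rev - -b t.rev)
        = (-1) ^ k * ∏ j ∈ Finset.univ.erase t.rev, (b j - b t.rev) := by
      have e : (-1 : ℝ) ^ k = ∏ j ∈ Finset.univ.erase t.rev, (-1 : ℝ) := by simp
      rw [e, ← Finset.prod_mul_distrib]
      refine Finset.prod_bij (fun j _ => j.rev) (fun j hj => ?_) (fun _ _ _ _ h => Fin.rev_injective h)
        (fun j hj => ⟨j.rev, ?_, Fin.rev_rev j⟩) (fun j _ => by ring)
      · simpa using hj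
      · simp only [Finset.mem_erase, Finset.mem_univ, and_true] at hj ⊢
        exact fun h => hj (by rw [← h, Fin.rev_rev])
    have e2 : ∏ l : Fin k, (-y l.rev - -b t.rev) = (-1) ^ k * ∏ l, (y l - b t.rev) := by
      have e : (-1 : ℝ) ^ k = ∏ j : Fin k, (-1 : ℝ) := by simp
      rw [e, ← Finset.prod_mul_distrib, ← Equiv.prod_comp Fin.revPerm]
      exact Finset.prod_congr rfl fun j _ => by simp; ring
    rw [e1, e2]
    linear_combination (-1) ^ k * h2

/-- Interlacing zeros come from nonnegative weights. -/
theorem exists_weights {k : ℕ} {b : Fin (k + 1) → ℝ} (hb : StrictAnti b) {y : Fin k → ℝ}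
    (hy : ∀ i, b i.succ ≤ y i ∧ y i ≤ b i.castSucc) {c : ℝ} (hc : 0 < c) :
    ∃ w : Fin (k + 1) → ℝ, (∀ i, 0 ≤ w i) ∧
      ∀ s, ∑ t, w t * ∏ j ∈ Finset.univ.erase t, (b j - s) = c * ∏ l, (y l - s) := by
  have hD : ∀ t, ∏ j ∈ Finset.univ.erase t, (b j - b t) ≠ 0 := fun t =>
    Finset.prod_ne_zero_iff.2 fun j hj => sub_ne_zero.2 (hb.injective.ne (Finset.ne_of_mem_erase hj))
  -- Setting `s = b t` leaves one term on the left and forces this value. Nonnegativity: `y l` is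
  -- matched with `b l` for `l < t` and with `b (l + 1)` for `l ≥ t`; interlacing makes each
  -- quotient nonnegative. Both sides have degree at most `k` and agree at the `k + 1` nodes.
  refine ⟨fun t => c * (∏ l, (y l - b t)) / ∏ j ∈ Finset.univ.erase t, (b j - b t), fun t => ?_,
    fun s => ?_⟩
  · beta_reduce
    rw [prod_erase_eq_succAbove, mul_div_assoc, ← Finset.prod_div_distrib]
    refine mul_nonneg hc.le (Finset.prod_nonneg fun l _ => ?_)
    rcases lt_or_ge l.castSucc t with h | h
    · rw [Fin.succAbove_of_castSucc_lt _ _ h]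
      have h1 := hb h
      have h2 : b t ≤ b l.succ := hb.antitone (Fin.castSucc_lt_iff_succ_le.1 h)
      exact div_nonneg (by linarith [(hy l).1]) (by linarith)
    · rw [Fin.succAbove_of_le_castSucc _ _ h]
      have h1 := hb.antitone h
      have h2 : b l.succ < b t := hb (lt_of_le_of_lt h (Fin.castSucc_lt_succ))
      exact div_nonneg_of_nonpos (by linarith [(hy l).2]) (by linarith)
  · set w : Fin (k + 1) → ℝ :=
      fun t => c * (∏ l, (y l - b t)) / ∏ j ∈ Finset.univ.erase t, (b j - b t) with hw
    set P : Polynomial ℝ := ∑ t, Polynomial.C (w t) *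
      ∏ j ∈ Finset.univ.erase t, (Polynomial.C (b j) - Polynomial.X) with hP
    set Q : Polynomial ℝ := Polynomial.C c * ∏ l, (Polynomial.C (y l) - Polynomial.X) with hQ
    have hPe : ∀ s, P.eval s = ∑ t, w t * ∏ j ∈ Finset.univ.erase t, (b j - s) := by
      intro s; simp [hP, Polynomial.eval_finsetSum, Polynomial.eval_prod]
    have hQe : ∀ s, Q.eval s = c * ∏ l, (y l - s) := by
      intro s; simp [hQ, Polynomial.eval_prod]
    have hdeg : ∀ R : Polynomial ℝ, R.natDegree ≤ k →
        R.degree < (Finset.univ : Finset (Fin (k + 1))).card := by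
      intro R hR
      refine lt_of_le_of_lt Polynomial.degree_le_natDegree ?_
      rw [Finset.card_univ, Fintype.card_fin]
      exact_mod_cast Nat.lt_succ_of_le hR
    have hPQ : P = Q := by
      refine Polynomial.eq_of_degrees_lt_of_eval_index_eq (v := b) Finset.univ hb.injective.injOn
        (hdeg P ?_) (hdeg Q ?_) fun i _ => ?_
      · refine Polynomial.natDegree_sum_le_of_forall_le _ _ fun t _ => ?_
        refine (Polynomial.natDegree_C_mul_le _ _).trans ((natDegree_prod_C_sub_X_le _ _).trans ?_)
        simp
      · refine (Polynomial.natDegree_C_mul_le _ _).trans ((natDegree_prod_C_sub_X_le _ _).trans ?_)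
        simp
      · rw [hPe, hQe, Finset.sum_eq_single i]
        · rw [hw]
          exact div_mul_cancel₀ _ (hD i)
        · intro t _ hti
          rw [Finset.prod_eq_zero (i := i) (by simp [hti.symm]) (sub_self _), mul_zero]
        · simp
    rw [← hPe, ← hQe, hPQ]

end SpinOrbit

/-! ### Singular values of a skew matrix and its characteristic polynomial. -/

namespace SpinOrbit

open Polynomial

theorem eval_charpoly_eq_det {m : ℕ} (Y : Matrix (Fin m) (Fin m) ℝ) (r : ℝ) :
    Y.charpoly.eval r = (r • 1 - Y).det := by
  rw [Matrix.eval_charpoly, Matrix.scalar_apply, Matrix.smul_one_eq_diagonal]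

/-- For skew `Y`, `(r - Y)(r - Y)ᵀ = r² + Yᵀ Y`; the outer minus sign is due to the odd size. -/
theorem eval_charpoly_gram {k : ℕ} {Y : Matrix (Fin (2 * k + 1)) (Fin (2 * k + 1)) ℝ}
    (hY : Yᵀ = -Y) (r : ℝ) :
    (Yᵀ * Y).charpoly.eval (-(r ^ 2)) = -(r • 1 - Y).det ^ 2 := by
  have e1 : (-(r ^ 2)) • (1 : Matrix (Fin (2 * k + 1)) (Fin (2 * k + 1)) ℝ) - Yᵀ * Y
      = -((r • 1 - Y) * (r • 1 - Y)ᵀ) := by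
    rw [Matrix.transpose_sub, Matrix.transpose_smul, Matrix.transpose_one, hY]
    simp only [sub_neg_eq_add, sub_mul, mul_add, Matrix.smul_mul, Matrix.mul_smul, one_mul,
      mul_one, neg_mul]
    module
  rw [eval_charpoly_eq_det, e1, Matrix.det_neg, Matrix.det_mul, Matrix.det_transpose]
  simp [pow_succ, pow_mul]

theorem eq_of_eval_eq_of_ne_zero {p q : ℝ[X]} (h : ∀ r ≠ 0, p.eval r = q.eval r) : p = q := by
  refine Polynomial.eq_of_infinite_eval_eq p q ((Set.finite_singleton (0 : ℝ)).infinite_compl.mono ?_)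
  exact fun r hr => h r hr

theorem isHermitian_gram {m : ℕ} (Y : Matrix (Fin m) (Fin m) ℝ) : (Yᵀ * Y).IsHermitian := by
  have := Matrix.isHermitian_conjTranspose_mul_self Y
  rwa [Matrix.conjTranspose_eq_transpose_of_trivial] at this

theorem roots_charpoly_gram_nonneg {m : ℕ} (Y : Matrix (Fin m) (Fin m) ℝ) :
    ∀ s ∈ (Yᵀ * Y).charpoly.roots, 0 ≤ s := by
  have h := Matrix.posSemidef_conjTranspose_mul_self Y
  rw [Matrix.conjTranspose_eq_transpose_of_trivial] at h
  intro s hs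
  rw [h.1.roots_charpoly_eq_eigenvalues, Multiset.mem_map] at hs
  obtain ⟨i, -, rfl⟩ := hs
  exact h.eigenvalues_nonneg i

theorem exists_antitone_of_multiset {k : ℕ} {s : Multiset ℝ} (h : s.card = k) :
    ∃ y : Fin k → ℝ, Antitone y ∧ Finset.univ.val.map y = s := by
  subst h
  have hl : (s.sort (· ≥ ·)).length = s.card := Multiset.length_sort _
  refine ⟨fun i => (s.sort (· ≥ ·)).get (i.cast hl.symm), fun i j hij => ?_, ?_⟩
  · exact (Multiset.pairwise_sort s (· ≥ ·)).sortedGE.antitone_get (by simpa using hij)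
  · conv_rhs => rw [← Multiset.sort_eq s (· ≥ ·)]
    rw [Fin.univ_val_map]
    congr 1
    refine List.ext_get (by simp [hl]) fun i h1 h2 => by simp

/-- The spectrum of `Yᵀ Y` determines only the square of the characteristic polynomial of `Y`;
monicity then fixes the sign. -/
theorem det_of_singularValues {k : ℕ} {Y : Matrix (Fin (2 * k + 1)) (Fin (2 * k + 1)) ℝ}
    (hY : Yᵀ = -Y) {x : Fin k → ℝ}
    (h : singularValues Y = Finset.univ.val.map x + Finset.univ.val.map x + {0}) (r : ℝ) :
    (r • 1 - Y).det = r * ∏ i, (r ^ 2 + x i ^ 2) := by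
  have hroots : (Yᵀ * Y).charpoly.roots = Finset.univ.val.map (fun i => x i ^ 2)
      + Finset.univ.val.map (fun i => x i ^ 2) + {0} := by
    have h1 := congrArg (Multiset.map (· ^ 2)) h
    rw [singularValues, Multiset.map_map, Multiset.map_congr rfl (g := id)] at h1
    · simpa [Multiset.map_map, Function.comp_def] using h1
    · intro s hs
      exact Real.sq_sqrt (roots_charpoly_gram_nonneg Y s hs)
  have hch : (Yᵀ * Y).charpoly = X * (∏ i, (X - C (x i ^ 2))) ^ 2 := by
    rw [(isHermitian_gram Y).splits_charpoly.eq_prod_roots_of_monic (Matrix.charpoly_monic _),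
      hroots]
    simp only [Multiset.map_add, Multiset.map_map, Multiset.prod_add, Function.comp_def,
      Multiset.map_singleton, Multiset.prod_singleton]
    rw [map_zero, sub_zero, mul_comm, sq]
    rfl
  set q : ℝ[X] := X * ∏ i, (X ^ 2 + C (x i ^ 2)) with hq
  have hqm : q.Monic := monic_X.mul (monic_prod_of_monic _ _ fun i _ =>
    monic_X_pow_add_C _ two_ne_zero)
  have hqe : ∀ r, q.eval r = r * ∏ i, (r ^ 2 + x i ^ 2) := by
    intro r; simp [hq, eval_prod]
  have hsq : Y.charpoly ^ 2 = q ^ 2 := by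
    refine Polynomial.funext fun r => ?_
    have h1 := eval_charpoly_gram hY r
    rw [hch] at h1
    simp only [eval_mul, eval_X, eval_pow, eval_prod, eval_sub, eval_C] at h1
    have e : (∏ i, (-(r ^ 2) - x i ^ 2)) ^ 2 = (∏ i, (r ^ 2 + x i ^ 2)) ^ 2 := by
      rw [← Finset.prod_pow, ← Finset.prod_pow]
      exact Finset.prod_congr rfl fun i _ => by ring
    rw [e] at h1
    rw [eval_pow, eval_pow, hqe, eval_charpoly_eq_det]
    linear_combination h1
  have hpq : Y.charpoly = q := by
    rcases sq_eq_sq_iff_eq_or_eq_neg.1 hsq with h1 | h1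
    · exact h1
    · have h2 := congrArg leadingCoeff h1
      rw [leadingCoeff_neg, Matrix.charpoly_monic, hqm] at h2
      norm_num at h2
  rw [← eval_charpoly_eq_det, hpq, hqe]

/-- If `C · det(r - Y) = r Q(r²)`, the singular values of `Y` are read off from the zeros of `Q`. -/
theorem exists_singularValues {k : ℕ} {Y : Matrix (Fin (2 * k + 1)) (Fin (2 * k + 1)) ℝ}
    (hY : Yᵀ = -Y) {Q : ℝ[X]} {c : ℝ} (hc : c ≠ 0)
    (h : ∀ r ≠ 0, c * (r • 1 - Y).det = r * Q.eval (r ^ 2)) :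
    ∃ y : Fin k → ℝ, Antitone y ∧ (∀ i, 0 ≤ y i) ∧ (∀ s, Q.eval (-s) = c * ∏ i, (y i - s)) ∧
      singularValues Y = (Finset.univ.val.map fun i => √(y i))
        + (Finset.univ.val.map fun i => √(y i)) + {0} := by
  have hpoly : C c * Y.charpoly = X * Q.comp (X ^ 2) := by
    refine eq_of_eval_eq_of_ne_zero fun r hr => ?_
    simp [eval_charpoly_eq_det, h r hr]
  have hdeg : Q.natDegree = k := by
    have h1 := congrArg natDegree hpoly
    have hQ0 : Q.comp (X ^ 2) ≠ 0 := by
      intro h0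
      rw [h0, mul_zero, mul_eq_zero, C_eq_zero] at hpoly
      exact hpoly.elim hc (Matrix.charpoly_monic Y).ne_zero
    rw [natDegree_C_mul hc, Matrix.charpoly_natDegree_eq_dim, Fintype.card_fin, natDegree_X_mul hQ0,
      natDegree_comp, natDegree_X_pow] at h1
    omega
  have hlc : Q.leadingCoeff = c := by
    have h1 := congrArg leadingCoeff hpoly
    rw [leadingCoeff_mul, leadingCoeff_mul, leadingCoeff_C, Matrix.charpoly_monic,
      leadingCoeff_comp (by simp)] at h1
    simpa using h1.symm
  -- Putting `r = √(-s)` for `s < 0` turns the hypothesis into a statement about `Yᵀ Y`. The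
  -- characteristic polynomial of this symmetric matrix splits, hence so does its divisor `Q(-X)`,
  -- and the roots of the latter are the required `y i`.
  have hgram : C (c ^ 2) * (Yᵀ * Y).charpoly = X * Q.comp (-X) ^ 2 := by
    refine Polynomial.eq_of_infinite_eval_eq _ _ ((Set.Iio_infinite (0 : ℝ)).mono fun s hs => ?_)
    have hs' : s < 0 := hs
    have hr : √(-s) ≠ 0 := (Real.sqrt_pos.2 (by linarith)).ne'
    have hr2 : √(-s) ^ 2 = -s := Real.sq_sqrt (by linarith)
    have h1 := h _ hr
    have h2 := eval_charpoly_gram hY (√(-s))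
    rw [hr2, neg_neg] at h2
    rw [hr2] at h1
    simp only [Set.mem_ofPred_eq, eval_mul, eval_C, eval_X, eval_pow, eval_comp, eval_neg, h2]
    have h3 := congrArg (· ^ 2) h1
    simp only [mul_pow, hr2] at h3
    linear_combination -h3
  have hsplit : (Q.comp (-X)).Splits := by
    refine Splits.of_dvd (((isHermitian_gram Y).splits_charpoly).C_mul (c ^ 2)) ?_ ?_
    · exact mul_ne_zero (C_ne_zero.2 (pow_ne_zero 2 hc)) (Matrix.charpoly_monic _).ne_zero
    · rw [hgram]
      exact Dvd.intro_left (X * Q.comp (-X)) (by ring)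
  have hdeg' : (Q.comp (-X)).natDegree = k := by
    rw [natDegree_comp, natDegree_neg, natDegree_X, mul_one, hdeg]
  have hlc' : (Q.comp (-X)).leadingCoeff = c * (-1) ^ k := by
    rw [leadingCoeff_comp (by simp), hlc, hdeg, leadingCoeff_neg, leadingCoeff_X]
  obtain ⟨y, hy, hyr⟩ := exists_antitone_of_multiset (hsplit.natDegree_eq_card_roots.symm.trans hdeg')
  have hQ : Q.comp (-X) = C (c * (-1) ^ k) * ∏ i, (X - C (y i)) := by
    conv_lhs => rw [hsplit.eq_prod_roots, hlc', ← hyr, Multiset.map_map]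
    rfl
  have hch : (Yᵀ * Y).charpoly = X * (∏ i, (X - C (y i))) ^ 2 := by
    rw [hQ] at hgram
    have : C (c ^ 2) * (Yᵀ * Y).charpoly = C (c ^ 2) * (X * (∏ i, (X - C (y i))) ^ 2) := by
      rw [hgram, mul_pow, ← C_pow, mul_pow, ← pow_mul, mul_comm k 2, pow_mul]
      simp only [even_two, Even.neg_pow, one_pow, mul_one]
      ring
    exact mul_left_cancel₀ (C_ne_zero.2 (pow_ne_zero 2 hc)) this
  have hroots : (Yᵀ * Y).charpoly.roots = Finset.univ.val.map y + Finset.univ.val.map y + {0} := by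
    have e : (Yᵀ * Y).charpoly
        = ((Finset.univ.val.map y + Finset.univ.val.map y + {0}).map fun a => X - C a).prod := by
      rw [hch]
      simp only [Multiset.map_add, Multiset.map_map, Multiset.prod_add, Function.comp_def,
        Multiset.map_singleton, Multiset.prod_singleton]
      rw [map_zero, sub_zero, mul_comm X, sq]
      rfl
    rw [e, roots_multiset_prod_X_sub_C]
  refine ⟨y, hy, fun i => ?_, fun s => ?_, ?_⟩
  · exact roots_charpoly_gram_nonneg Y _ (by rw [hroots]; simp)
  · have h1 := congrArg (eval s) hQ
    simp only [eval_comp, eval_neg, eval_X, eval_mul, eval_C, eval_prod, eval_sub] at h1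
    have e : ∏ i, (y i - s) = (-1) ^ k * ∏ i, (s - y i) := by
      have e : (-1 : ℝ) ^ k = ∏ j : Fin k, (-1 : ℝ) := by simp
      rw [e, ← Finset.prod_mul_distrib]
      exact Finset.prod_congr rfl fun j _ => by ring
    rw [h1, e, mul_assoc]
  · rw [singularValues, hroots]
    simp [Function.comp_def]

end SpinOrbit

/-! ### Orthogonal similarity of real skew matrices. -/

namespace SpinOrbit

/-- The functional calculus gives a square root that commutes with everything commuting with `H`. -/
theorem exists_sqrt_commute {m : ℕ} {H : Matrix (Fin m) (Fin m) ℝ} (hH : H.PosSemidef) :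
    ∃ R : Matrix (Fin m) (Fin m) ℝ, Rᵀ = R ∧ R * R = H ∧ ∀ Y, H * Y = Y * H → R * Y = Y * R := by
  have hs : IsSelfAdjoint H := hH.1
  refine ⟨cfc Real.sqrt H, ?_, ?_, fun Y hY => ?_⟩
  · have h : IsSelfAdjoint (cfc Real.sqrt H) := cfc_predicate Real.sqrt H
    have h2 := h.star_eq
    rwa [Matrix.star_eq_conjTranspose, Matrix.conjTranspose_eq_transpose_of_trivial] at h2
  · rw [← cfc_mul Real.sqrt Real.sqrt H]
    conv_rhs => rw [← cfc_id ℝ H]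
    refine cfc_congr fun x hx => ?_
    rw [hH.1.spectrum_real_eq_range_eigenvalues] at hx
    obtain ⟨i, rfl⟩ := hx
    exact Real.mul_self_sqrt (hH.eigenvalues_nonneg i)
  · exact Commute.cfc_real (b := Y) hY Real.sqrt

/-- Polar decomposition: `U = S (SᵀS)^(-1/2)`. Transposing the intertwining relation and using both
skew-symmetries shows that `SᵀS` commutes with `Y`, hence so does its root. -/
theorem exists_orthogonal_of_intertwining {m : ℕ} {Y Y' S : Matrix (Fin m) (Fin m) ℝ}
    (hY : Yᵀ = -Y) (hY' : Y'ᵀ = -Y') (hS : S.det ≠ 0) (h : S * Y = Y' * S) :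
    ∃ U : Matrix (Fin m) (Fin m) ℝ, Uᵀ * U = 1 ∧ U * Y = Y' * U := by
  have hP : (Sᵀ * S).PosSemidef := by
    have := Matrix.posSemidef_conjTranspose_mul_self S
    rwa [Matrix.conjTranspose_eq_transpose_of_trivial] at this
  obtain ⟨R, hRt, hRR, hRc⟩ := exists_sqrt_commute hP
  have hT : Y * Sᵀ = Sᵀ * Y' := by
    have h1 := congrArg Matrix.transpose h
    rw [Matrix.transpose_mul, Matrix.transpose_mul, hY, hY', neg_mul, mul_neg] at h1
    exact neg_injective h1
  have hRY : R * Y = Y * R := by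
    refine hRc Y ?_
    rw [mul_assoc, h, ← mul_assoc, ← hT, mul_assoc]
  have hdR : IsUnit R.det := by
    have h1 := congrArg Matrix.det hRR
    rw [Matrix.det_mul, Matrix.det_mul, Matrix.det_transpose] at h1
    refine isUnit_iff_ne_zero.2 fun h0 => ?_
    rw [h0, zero_mul] at h1
    exact hS (mul_self_eq_zero.1 h1.symm)
  have hRY' : R⁻¹ * Y = Y * R⁻¹ := by
    have h1 := congrArg (fun Z => R⁻¹ * Z * R⁻¹) hRY
    simp only [mul_assoc, Matrix.mul_nonsing_inv R hdR, mul_one] at h1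
    rw [← mul_assoc, ← mul_assoc, Matrix.nonsing_inv_mul R hdR, one_mul] at h1
    exact h1.symm
  refine ⟨S * R⁻¹, ?_, ?_⟩
  · rw [Matrix.transpose_mul, Matrix.transpose_nonsing_inv, hRt, mul_assoc, ← mul_assoc Sᵀ, ← hRR,
      mul_assoc, Matrix.mul_nonsing_inv R hdR, mul_one, Matrix.nonsing_inv_mul R hdR]
  · rw [mul_assoc, hRY', ← mul_assoc, h, mul_assoc]

-- The real polynomial `det (A + X B)` does not vanish at `z`, so it is nonzero and some real number
-- is not a root.
open Polynomial in
theorem exists_det_add_smul_ne_zero {m : ℕ} (A B : Matrix (Fin m) (Fin m) ℝ) (z : ℂ)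
    (h : (A.map (algebraMap ℝ ℂ) + z • B.map (algebraMap ℝ ℂ)).det ≠ 0) :
    ∃ t : ℝ, (A + t • B).det ≠ 0 := by
  set p : ℝ[X] := (A.map C + (X : ℝ[X]) • B.map C).det with hp
  have hz : aeval z p = (A.map (algebraMap ℝ ℂ) + z • B.map (algebraMap ℝ ℂ)).det := by
    rw [hp, AlgHom.map_det]
    congr 1
    ext i j
    simp [Matrix.map_apply]
    exact mul_comm _ _
  have ht : ∀ t : ℝ, p.eval t = (A + t • B).det := by
    intro t
    rw [hp, ← coe_evalRingHom, RingHom.map_det]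
    congr 1
    ext i j
    simp [Matrix.map_apply]
    exact mul_comm _ _
  have hp0 : p ≠ 0 := by
    rintro h0
    rw [h0, map_zero] at hz
    exact h hz.symm
  by_contra! hall
  exact hp0 (Polynomial.funext fun t => by rw [ht, hall, eval_zero])

theorem isHermitian_I_smul {m : ℕ} {Y : Matrix (Fin m) (Fin m) ℝ} (hY : Yᵀ = -Y) :
    (Complex.I • Y.map (algebraMap ℝ ℂ)).IsHermitian := by
  ext i j
  have h : Y j i = -Y i j := congrFun (congrFun hY i) j
  simp [h]

theorem charpoly_I_smul {m : ℕ} {Y Y' : Matrix (Fin m) (Fin m) ℝ} (h : Y.charpoly = Y'.charpoly) :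
    (Complex.I • Y.map (algebraMap ℝ ℂ)).charpoly
      = (Complex.I • Y'.map (algebraMap ℝ ℂ)).charpoly := by
  have key : ∀ (Z : Matrix (Fin m) (Fin m) ℝ) (z : ℂ),
      (Complex.I • Z.map (algebraMap ℝ ℂ)).charpoly.eval z
        = Complex.I ^ m * (Z.charpoly.map (algebraMap ℝ ℂ)).eval (-Complex.I * z) := by
    intro Z z
    rw [Matrix.eval_charpoly, ← Matrix.charpoly_map, Matrix.eval_charpoly]
    have e : Matrix.scalar (Fin m) z - Complex.I • Z.map (algebraMap ℝ ℂ)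
        = Complex.I • (Matrix.scalar (Fin m) (-Complex.I * z) - Z.map (algebraMap ℝ ℂ)) := by
      rw [smul_sub]
      congr 1
      ext i j
      by_cases hij : i = j
      · subst hij
        simp [← mul_assoc]
      · simp [hij]
    rw [e, Matrix.det_smul, Fintype.card_fin]
  exact Polynomial.funext fun z => by rw [key, key, h]

/-- Real skew-symmetric matrices with the same characteristic polynomial are orthogonally
similar. -/
theorem exists_orthogonal_of_charpoly_eq {m : ℕ} {Y Y' : Matrix (Fin m) (Fin m) ℝ}
    (hY : Yᵀ = -Y) (hY' : Y'ᵀ = -Y') (h : Y.charpoly = Y'.charpoly) :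
    ∃ U : Matrix (Fin m) (Fin m) ℝ, Uᵀ * U = 1 ∧ U * Y = Y' * U := by
  have hA := isHermitian_I_smul hY
  have hB := isHermitian_I_smul hY'
  -- `iY` and `iY'` are Hermitian with the same spectrum, so `W`, built from their eigenvector
  -- matrices, is a complex unitary intertwiner.
  have heig : hA.eigenvalues = hB.eigenvalues :=
    (hA.eigenvalues_eq_eigenvalues_iff hB).2 (charpoly_I_smul h)
  have sA := hA.spectral_theorem
  have sB := hB.spectral_theorem
  rw [Unitary.conjStarAlgAut_apply] at sA sB
  rw [← heig] at sB
  set D : Matrix (Fin m) (Fin m) ℂ := Matrix.diagonal (RCLike.ofReal ∘ hA.eigenvalues)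
  set V : Matrix (Fin m) (Fin m) ℂ := (hA.eigenvectorUnitary).1 with hV
  set V' : Matrix (Fin m) (Fin m) ℂ := (hB.eigenvectorUnitary).1 with hV'
  have v1 : star V * V = 1 := Unitary.coe_star_mul_self hA.eigenvectorUnitary
  have v2 : V * star V = 1 := Unitary.coe_mul_star_self hA.eigenvectorUnitary
  have v1' : star V' * V' = 1 := Unitary.coe_star_mul_self hB.eigenvectorUnitary
  set W := V' * star V with hW
  have hWd : W.det ≠ 0 := by
    have h1 : (V * star V') * W = 1 := by
      rw [hW, mul_assoc, ← mul_assoc (star V'), v1', one_mul, v2]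
    intro h0
    have h2 := congrArg Matrix.det h1
    rw [Matrix.det_mul, h0, mul_zero, Matrix.det_one] at h2
    exact zero_ne_one h2
  have hWI : W * Y.map (algebraMap ℝ ℂ) = Y'.map (algebraMap ℝ ℂ) * W := by
    have h1 : W * (Complex.I • Y.map (algebraMap ℝ ℂ)) = (Complex.I • Y'.map (algebraMap ℝ ℂ)) * W := by
      rw [sA, sB, hW]
      simp only [mul_assoc]
      rw [← mul_assoc (star V) V, v1, one_mul, ← mul_assoc (star V') V', v1', one_mul]
    rw [Matrix.mul_smul, Matrix.smul_mul] at h1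
    exact smul_right_injective _ Complex.I_ne_zero h1
  -- `Y` and `Y'` are real, so the real and imaginary parts of `W` intertwine them separately. A
  -- real combination is invertible because `A + iB = W` is.
  set A : Matrix (Fin m) (Fin m) ℝ := W.map Complex.re
  set B : Matrix (Fin m) (Fin m) ℝ := W.map Complex.im
  have hAB : A.map (algebraMap ℝ ℂ) + Complex.I • B.map (algebraMap ℝ ℂ) = W := by
    ext i j
    simp [A, B, mul_comm Complex.I, Complex.re_add_im]
  have hAY : A * Y = Y' * A := by
    ext i j
    have h1 := congrArg Complex.re (congrFun (congrFun hWI i) j)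
    simpa [Matrix.mul_apply, A] using h1
  have hBY : B * Y = Y' * B := by
    ext i j
    have h1 := congrArg Complex.im (congrFun (congrFun hWI i) j)
    simpa [Matrix.mul_apply, B] using h1
  obtain ⟨t, ht⟩ := exists_det_add_smul_ne_zero A B Complex.I (by rw [hAB]; exact hWd)
  refine exists_orthogonal_of_intertwining hY hY' ht ?_
  rw [add_mul, mul_add, Matrix.smul_mul, Matrix.mul_smul, hAY, hBY]

end SpinOrbit

/-! ### Normal forms in `𝔭*` and the action of `M`, `A`, `N` on them. -/

namespace SpinOrbit

theorem pr_eq_pr_xMat {m : ℕ} {X : lieG m} {Y : so m} {β : Fin m → ℝ} :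
    pr m X = pr m ⟨xMat Y.1 β 0, xMat_mem Y β 0⟩ ↔
      (∀ i j, X.1 (.inl i) (.inl j) = Y.1 i j) ∧
        X.1 *ᵥ nullVec m = Sum.elim ((2 : ℝ) • β) 0 := by
  rw [pr_eq_iff]
  simp only [xMat_mulVec_nullVec]
  rfl

theorem nullVec_ne_zero (m : ℕ) : nullVec m ≠ 0 := fun h => by
  have := congrFun h (.inr 1)
  simp [nullVec] at this

theorem toMat_inv_eq {m : ℕ} {g : Spin m} {B : Matrix (Idx m) (Idx m) ℝ} (h : toMat m g * B = 1) :
    toMat m g⁻¹ = B :=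
  left_inv_eq_right_inv (toMat_inv_mul g) h

theorem parabolic_inv_mulVec {k : ℕ} {p : Spin (2 * k + 1)} (hp : p ∈ parabolic (2 * k + 1)) :
    ∃ c : ℝ, c ≠ 0 ∧ toMat _ p⁻¹ *ᵥ nullVec _ = c • nullVec _ := by
  obtain ⟨c, hc⟩ := parabolic_mulVec ((parabolic _).inv_mem hp)
  refine ⟨c, ?_, hc⟩
  rintro rfl
  have h1 : toMat _ p *ᵥ (toMat _ p⁻¹ *ᵥ nullVec _) = nullVec _ := by
    rw [Matrix.mulVec_mulVec, toMat_mul_inv, Matrix.one_mulVec]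
  rw [hc, zero_smul, Matrix.mulVec_zero] at h1
  exact nullVec_ne_zero _ h1.symm

theorem exists_parabolic_nGrp {m : ℕ} (α : Fin m → ℝ) :
    ∃ p : parabolic m, toMat m (p : Spin m) = nGrp α := by
  obtain ⟨g, hg⟩ := nGrp_mem α
  exact ⟨⟨g, 1, one_mem _, 0, α, by rw [hg, mGrp_one, aGrp_zero, one_mul, one_mul]⟩, hg⟩

theorem exists_parabolic_aGrp (k : ℕ) (t : ℝ) :
    ∃ p : parabolic (2 * k + 1), toMat _ (p : Spin (2 * k + 1)) = aGrp _ t := by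
  obtain ⟨g, hg⟩ := aGrp_mem (2 * k + 1) t
  exact ⟨⟨g, mem_parabolic_of_mulVec (c := Real.exp t) (by rw [hg, aGrp_mulVec_nullVec])⟩, hg⟩

theorem exists_parabolic_mGrp {k : ℕ} {U : Matrix (Fin (2 * k + 1)) (Fin (2 * k + 1)) ℝ}
    (hU : Uᵀ * U = 1) (hd : U.det = 1) :
    ∃ p : parabolic (2 * k + 1), toMat _ (p : Spin (2 * k + 1)) = mGrp U := by
  obtain ⟨g, hg⟩ := mGrp_mem hU hd
  exact ⟨⟨g, mem_parabolic_of_mulVec (c := 1) (by rw [hg, mGrp_mulVec_nullVec, one_smul])⟩, hg⟩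

theorem adG_apply {m : ℕ} (g : Spin m) (X : lieG m) :
    (adG m g X).1 = toMat m g * X.1 * toMat m g⁻¹ := rfl

theorem adG_mul {m : ℕ} (g h : Spin m) (X : lieG m) : adG m (g * h) X = adG m g (adG m h X) := by
  rw [map_mul]; rfl

theorem nilX_mem_lieP {m : ℕ} (α : Fin m → ℝ) : nilX α ∈ lieP m :=
  mem_lieP.2 ⟨0, (so m).zero_mem, 0, α, by simp⟩

/-- Conjugation by `N` brings an element with `β ≠ 0` into normal form. -/
theorem exists_normalize {m : ℕ} (X : lieG m) {β : Fin m → ℝ} (hβ : β ≠ 0)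
    (hX : ∀ i, (X.1 *ᵥ nullVec m) (.inl i) = 2 * β i) :
    ∃ (p : parabolic m) (Y : so m), Y.1 *ᵥ β = 0 ∧
      pr m (adG m p X) = pr m ⟨xMat Y.1 β 0, xMat_mem Y β 0⟩ := by
  have hbb : β ⬝ᵥ β ≠ 0 := fun h => hβ (dotProduct_self_eq_zero.1 h)
  obtain ⟨c, hc⟩ : ∃ c, c = X.1 (.inr 0) (.inr 1) := ⟨_, rfl⟩
  obtain ⟨z1, z2, z3⟩ := lieG_inr_inr X.2
  have hXν : X.1 *ᵥ nullVec m = (2 : ℝ) • (Sum.elim β 0 : Idx m → ℝ) + c • nullVec m := by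
    ext i
    rcases i with i | i
    · rw [hX]; simp [nullVec]
    · rw [mulVec_nullVec]
      fin_cases i <;> simp [nullVec, z1, z2, z3, hc]
  set Y₀ : Matrix (Fin m) (Fin m) ℝ := Matrix.of fun i j => X.1 (.inl i) (.inl j) with hY₀
  have hY₀s : ∀ i j, Y₀ j i = -Y₀ i j := by
    intro i j
    have := (mem_lieG_iff_entry X.1).1 X.2 (.inl i) (.inl j)
    simp [sgn] at this
    simp [hY₀]
    linarith
  have hYb : β ⬝ᵥ (Y₀ *ᵥ β) = 0 := by
    have h1 : β ⬝ᵥ (Y₀ *ᵥ β) = -(β ⬝ᵥ (Y₀ *ᵥ β)) := by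
      conv_lhs => rw [Matrix.dotProduct_mulVec, ← Matrix.mulVec_transpose, dotProduct_comm]
      rw [← dotProduct_neg, ← Matrix.neg_mulVec]
      congr 2
      ext i j
      exact hY₀s i j
    linarith
  -- Conjugation by `n_γ` turns the block `Y₀` into `Y₀ - 2βγᵗ + 2γβᵗ` and adds `2 γ·β` to the
  -- coefficient `c` of `ν` in `X ν`. Killing that coefficient needs `γ·β = -c / 2`; killing the new
  -- block on `β` then forces this `γ`, and skewness of `Y₀` makes the two demands consistent.
  set γ : Fin m → ℝ := (-(1 / (2 * (β ⬝ᵥ β)))) • (Y₀ *ᵥ β + c • β) with hγ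
  have hγβ : γ ⬝ᵥ β = -c / 2 := by
    rw [hγ, smul_dotProduct, add_dotProduct, dotProduct_comm (Y₀ *ᵥ β), hYb, smul_dotProduct]
    simp only [smul_eq_mul]
    field_simp
    ring
  obtain ⟨p, hp⟩ := exists_parabolic_nGrp γ
  have hpi : toMat m (p : Spin m)⁻¹ = nGrp (-γ) :=
    toMat_inv_eq (by rw [hp, nGrp_mul, add_neg_cancel, nGrp_zero])
  have hcol : ∀ j, nGrp (-γ) *ᵥ Pi.single (Sum.inl j) 1
      = (Pi.single (Sum.inl j) 1 : Idx m → ℝ) - γ j • nullVec m := by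
    intro j
    have h0 : lip (nullVec m) (Pi.single (Sum.inl j) 1) = 0 := by
      rw [lip_eq]; simp [nullVec]
    rw [nGrp_mulVec, h0]
    have h1 : -γ ⬝ᵥ (fun i => (Pi.single (Sum.inl j) 1 : Idx m → ℝ) (.inl i)) = -γ j := by
      simp [dotProduct, Pi.single_apply]
    rw [h1]
    simp [sub_eq_add_neg]
  have hblk : ∀ i j, (adG m p X).1 (.inl i) (.inl j) = Y₀ i j - 2 * γ j * β i + 2 * γ i * β j := by
    intro i j
    have e1 : (adG m p X).1 (.inl i) (.inl j)
        = (nGrp γ *ᵥ (X.1 *ᵥ (nGrp (-γ) *ᵥ Pi.single (Sum.inl j) 1))) (.inl i) := by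
      rw [adG_apply, hp, hpi, Matrix.mulVec_mulVec, Matrix.mulVec_mulVec, Matrix.mulVec_single_one]
      simp [mul_assoc, Matrix.col]
    have hl : lip (nullVec m) (X.1 *ᵥ Pi.single (Sum.inl j) 1) = -(2 * β j) := by
      have h3 := hX j
      rw [mulVec_nullVec] at h3
      rw [lip_eq, Matrix.mulVec_single_one]
      simp [nullVec, (lieG_inr_inl X.2 j).1, (lieG_inr_inl X.2 j).2]
      linarith
    have hl2 : lip (nullVec m) (Sum.elim β 0 : Idx m → ℝ) = 0 := by
      rw [lip_eq]; simp [nullVec]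
    rw [e1, hcol, Matrix.mulVec_sub, Matrix.mulVec_smul, hXν, nGrp_mulVec]
    simp only [lip_sub_right, lip_smul_right, lip_add_right, hl, hl2, lip_nullVec]
    simp [nullVec, hY₀]
    ring
  have hν : (adG m p X).1 *ᵥ nullVec m = Sum.elim ((2 : ℝ) • β) 0 := by
    have hl2 : lip (nullVec m) (Sum.elim β 0 : Idx m → ℝ) = 0 := by
      rw [lip_eq]; simp [nullVec]
    rw [adG_apply, hp, hpi, ← Matrix.mulVec_mulVec, ← Matrix.mulVec_mulVec, nGrp_mulVec_nullVec, hXν,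
      nGrp_mulVec]
    simp only [lip_smul_right, lip_add_right, hl2, lip_nullVec]
    have h4 : γ ⬝ᵥ (fun i => ((2 : ℝ) • (Sum.elim β 0 : Idx m → ℝ) + c • nullVec m) (.inl i))
        = -c := by
      have : (fun i => ((2 : ℝ) • (Sum.elim β 0 : Idx m → ℝ) + c • nullVec m) (.inl i))
          = (2 : ℝ) • β := by
        ext i; simp [nullVec]
      rw [this, dotProduct_smul, hγβ, smul_eq_mul]
      ring
    rw [h4]
    ext i
    rcases i with i | i <;> simp [nullVec]
  refine ⟨p, ⟨Matrix.of fun i j => Y₀ i j - 2 * γ j * β i + 2 * γ i * β j, ?_⟩, ?_, ?_⟩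
  · change Matrix.transpose _ = -_
    ext i j
    simp only [Matrix.transpose_apply, Matrix.of_apply, Matrix.neg_apply]
    rw [hY₀s i j]
    ring
  · ext i
    have e : (Matrix.of (fun i j => Y₀ i j - 2 * γ j * β i + 2 * γ i * β j) *ᵥ β) i
        = (Y₀ *ᵥ β) i - 2 * β i * (γ ⬝ᵥ β) + 2 * γ i * (β ⬝ᵥ β) := by
      simp only [Matrix.mulVec, dotProduct, Matrix.of_apply, Finset.mul_sum,
        ← Finset.sum_add_distrib, ← Finset.sum_sub_distrib]
      exact Finset.sum_congr rfl fun j _ => by ring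
    have hγi : γ i = -(1 / (2 * (β ⬝ᵥ β))) * ((Y₀ *ᵥ β) i + c * β i) := by
      simp [hγ]
      ring
    rw [e, hγβ, hγi, Pi.zero_apply]
    field_simp
    ring
  · exact pr_eq_pr_xMat.2 ⟨fun i j => hblk i j, hν⟩

theorem adG_mGrp {k : ℕ} {U : Matrix (Fin (2 * k + 1)) (Fin (2 * k + 1)) ℝ} (hU : Uᵀ * U = 1)
    {p : Spin (2 * k + 1)} (hp : toMat _ p = mGrp U) (Y : so (2 * k + 1))
    (β : Fin (2 * k + 1) → ℝ) {Y' : so (2 * k + 1)} (hY : U * Y.1 = Y'.1 * U) :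
    pr _ (adG _ p ⟨xMat Y.1 β 0, xMat_mem Y β 0⟩)
      = pr _ ⟨xMat Y'.1 (U *ᵥ β) 0, xMat_mem Y' _ 0⟩ := by
  have hU' : U * Uᵀ = 1 := mul_eq_one_comm.1 hU
  have hpi : toMat _ p⁻¹ = mGrp Uᵀ := toMat_inv_eq (by rw [hp, mGrp_mul, hU', mGrp_one])
  rw [pr_eq_pr_xMat, adG_apply, hp, hpi]
  constructor
  · intro i j
    have e : mGrp U * xMat Y.1 β 0 * mGrp Uᵀ = Matrix.fromBlocks (U * Y.1 * Uᵀ)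
        (U * Matrix.of fun i => ![β i, β i]) (Matrix.of ![-β, β] * Uᵀ) !![0, 0; 0, 0] := by
      simp [mGrp, xMat, Matrix.fromBlocks_multiply]
    rw [e, Matrix.fromBlocks_apply₁₁, hY, mul_assoc, hU', mul_one]
  · rw [← Matrix.mulVec_mulVec, ← Matrix.mulVec_mulVec, mGrp_mulVec_nullVec, xMat_mulVec_nullVec,
      mGrp, Matrix.fromBlocks_mulVec]
    ext i
    rcases i with i | i <;> simp [Function.comp_def]
    · simp only [Matrix.mulVec, dotProduct, Finset.mul_sum]
      exact Finset.sum_congr rfl fun j _ => by ring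

theorem adG_aGrp {k : ℕ} {t : ℝ} {p : Spin (2 * k + 1)} (hp : toMat _ p = aGrp _ t)
    (Y : so (2 * k + 1)) (β : Fin (2 * k + 1) → ℝ) :
    pr _ (adG _ p ⟨xMat Y.1 β 0, xMat_mem Y β 0⟩)
      = pr _ ⟨xMat Y.1 (Real.exp (-t) • β) 0, xMat_mem Y _ 0⟩ := by
  have hpi : toMat _ p⁻¹ = aGrp _ (-t) :=
    toMat_inv_eq (by rw [hp, aGrp_mul, add_neg_cancel, aGrp_zero])
  rw [pr_eq_pr_xMat, adG_apply, hp, hpi]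
  constructor
  · intro i j
    simp [aGrp, xMat, Matrix.fromBlocks_multiply]
  · rw [← Matrix.mulVec_mulVec, ← Matrix.mulVec_mulVec, aGrp_mulVec_nullVec, Matrix.mulVec_smul,
      xMat_mulVec_nullVec, Matrix.mulVec_smul, aGrp, Matrix.fromBlocks_mulVec]
    ext i
    rcases i with i | i
    · simp [Function.comp_def]; ring
    · fin_cases i <;> simp [dotProduct]

end SpinOrbit

/-! ### Conjugacy of normal forms, and invariants of the points of the image. -/

namespace SpinOrbit

open Polynomial in
theorem charpoly_eq_of_mul_det {m : ℕ} {Y Y' : Matrix (Fin m) (Fin m) ℝ} {c c' : ℝ} (hc : c ≠ 0)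
    (h : ∀ r : ℝ, r ≠ 0 → c * (r • 1 - Y).det = c' * (r • 1 - Y').det) : Y.charpoly = Y'.charpoly := by
  have hp : C c * Y.charpoly = C c' * Y'.charpoly :=
    eq_of_eval_eq_of_ne_zero fun r hr => by simp [eval_charpoly_eq_det, h r hr]
  have h1 := congrArg leadingCoeff hp
  rw [leadingCoeff_mul, leadingCoeff_mul, Matrix.charpoly_monic, Matrix.charpoly_monic,
    leadingCoeff_C, leadingCoeff_C, mul_one, mul_one] at h1
  rw [← h1] at hp
  exact mul_left_cancel₀ (C_ne_zero.2 hc) hp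

theorem dotProduct_self_pos {m : ℕ} {β : Fin m → ℝ} (h : β ≠ 0) : 0 < β ⬝ᵥ β :=
  lt_of_le_of_ne (Finset.sum_nonneg fun _ _ => mul_self_nonneg _)
    fun h0 => h (dotProduct_self_eq_zero.1 h0.symm)

/-- If the Pfaffian of `Z_{Y,β}` is nonzero, the kernel of `Y` is spanned by `β`. -/
theorem exists_smul_of_mulVec_eq_zero {k : ℕ} {Y : Matrix (Fin (2 * k + 1)) (Fin (2 * k + 1)) ℝ}
    (hY : Yᵀ = -Y) {β w : Fin (2 * k + 1) → ℝ} (hβ : Y *ᵥ β = 0)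
    (hpf : spacePf (skewExt Y β) ≠ 0) (hw : Y *ᵥ w = 0) : ∃ c : ℝ, w = c • β := by
  have hZ : (skewExt Y β)ᵀ = -skewExt Y β := by
    rw [skewExt, Matrix.fromBlocks_transpose, Matrix.fromBlocks_neg, hY]
    congr 1 <;> ext <;> simp
  have key : ∀ v : Fin (2 * k + 1) ⊕ Fin 1 → ℝ, skewExt Y β *ᵥ v = 0 → v = 0 := by
    intro v hv
    have h1 := mulVec_eq_zero_of_pfaffian (A := Matrix.reindex (spaceFin k) (spaceFin k) (skewExt Y β))
      (v := v ∘ (spaceFin k).symm) (by rw [Matrix.transpose_reindex, hZ]; rfl) hpf (by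
        rw [Matrix.reindex_apply, Matrix.submatrix_mulVec_equiv]
        simp only [Function.comp_assoc, Equiv.symm_symm, Equiv.symm_comp_self, Function.comp_id, hv]
        rfl)
    ext i
    have := congrFun h1 (spaceFin k i)
    simpa using this
  have hβ0 : β ≠ 0 := by
    rintro rfl
    have h1 := key (Sum.elim 0 1) (by
      rw [skewExt, Matrix.fromBlocks_mulVec]
      ext i
      rcases i with i | i <;> simp [Matrix.mulVec, dotProduct])
    have := congrFun h1 (.inr 0)
    simp at this
  have hbb := (dotProduct_self_pos hβ0).ne'
  refine ⟨(β ⬝ᵥ w) / (β ⬝ᵥ β), ?_⟩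
  -- The component of `w` orthogonal to `β`, extended by zero, is killed by `skewExt Y β`.
  have h1 := key (Sum.elim (w - ((β ⬝ᵥ w) / (β ⬝ᵥ β)) • β) 0) (by
    rw [skewExt, Matrix.fromBlocks_mulVec]
    simp only [Sum.elim_comp_inl, Sum.elim_comp_inr, Matrix.mulVec_zero, add_zero]
    rw [Matrix.mulVec_sub, Matrix.mulVec_smul, hβ, hw, smul_zero, sub_zero]
    ext i
    rcases i with i | i
    · rfl
    · have e : ((Matrix.of fun (_ : Fin 1) j => -β j) *ᵥ (w - ((β ⬝ᵥ w) / (β ⬝ᵥ β)) • β)) i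
          = -(β ⬝ᵥ (w - ((β ⬝ᵥ w) / (β ⬝ᵥ β)) • β)) := by
        simp [Matrix.mulVec, dotProduct]
      simp only [Sum.elim_inr]
      rw [e, dotProduct_sub, dotProduct_smul, smul_eq_mul, div_mul_cancel₀ _ hbb, sub_self]
      simp)
  ext i
  have := congrFun h1 (.inl i)
  simpa [sub_eq_zero] using this

/-- Normal forms with the same characteristic polynomial and Pfaffian sign are conjugate. -/
theorem exists_parabolic_of_charpoly_eq {k : ℕ} {Y Y' : so (2 * k + 1)}
    {β β' : Fin (2 * k + 1) → ℝ} (hYβ : Y.1 *ᵥ β = 0)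
    (hYβ' : Y'.1 *ᵥ β' = 0) (hch : Y.1.charpoly = Y'.1.charpoly)
    (hsign : SignType.sign (spacePf (skewExt Y.1 β)) = SignType.sign (spacePf (skewExt Y'.1 β')))
    (hne : spacePf (skewExt Y'.1 β') ≠ 0) :
    ∃ p : parabolic (2 * k + 1), pr _ (adG _ p ⟨xMat Y.1 β 0, xMat_mem Y β 0⟩)
      = pr _ ⟨xMat Y'.1 β' 0, xMat_mem Y' β' 0⟩ := by
  obtain ⟨U, hU, hUY, hUd⟩ : ∃ U : Matrix (Fin (2 * k + 1)) (Fin (2 * k + 1)) ℝ,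
      Uᵀ * U = 1 ∧ U * Y.1 = Y'.1 * U ∧ U.det = 1 := by
    obtain ⟨U, hU, hUY⟩ := exists_orthogonal_of_charpoly_eq Y.2 Y'.2 hch
    have hd : U.det * U.det = 1 := by
      have := congrArg Matrix.det hU
      rwa [Matrix.det_mul, Matrix.det_transpose, Matrix.det_one] at this
    rcases mul_self_eq_one_iff.1 hd with h1 | h1
    · exact ⟨U, hU, hUY, h1⟩
    -- The size `2k + 1` is odd, so negating `U` changes its determinant from `-1` to `1` and keeps
    -- both relations.
    · refine ⟨-U, ?_, ?_, ?_⟩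
      · rw [Matrix.transpose_neg, neg_mul_neg, hU]
      · rw [neg_mul, mul_neg, hUY]
      · rw [Matrix.det_neg, h1, Fintype.card_fin]
        simp [pow_succ, pow_mul]
  have hU' : U * Uᵀ = 1 := mul_eq_one_comm.1 hU
  obtain ⟨c, hc⟩ := exists_smul_of_mulVec_eq_zero Y'.2 hYβ' hne (w := U *ᵥ β) (by
    rw [Matrix.mulVec_mulVec, ← hUY, ← Matrix.mulVec_mulVec, hYβ, Matrix.mulVec_zero])
  -- Conjugation by `U ∈ SO(m)` keeps the Pfaffian, and scaling `β'` by `c` multiplies it by `c`;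
  -- equal nonzero signs force `c > 0`. An element of `A` then rescales to `β'`, which a negative
  -- `c` would not allow.
  have hcpos : 0 < c := by
    have h1 := spacePf_skewExt_conj U Y.1 β
    rw [hUd, one_mul, hUY, mul_assoc, hU', mul_one, hc, spacePf_skewExt_smul] at h1
    rw [← h1, sign_mul] at hsign
    have h2 : SignType.sign (spacePf (skewExt Y'.1 β')) ≠ 0 := sign_ne_zero.2 hne
    rw [← sign_eq_one_iff]
    exact mul_right_cancel₀ h2 (by rw [hsign, one_mul])
  obtain ⟨p, hp⟩ := exists_parabolic_mGrp hU hUd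
  obtain ⟨q, hq⟩ := exists_parabolic_aGrp k (Real.log c)
  refine ⟨q * p, ?_⟩
  rw [Subgroup.coe_mul, adG_mul, ← coadP_pr, adG_mGrp hU hp Y β hUY, coadP_pr, adG_aGrp hq]
  have e : Real.exp (-Real.log c) • (U *ᵥ β) = β' := by
    rw [hc, smul_smul, Real.exp_neg, Real.exp_log hcpos, inv_mul_cancel₀ hcpos.ne', one_smul]
  simp only [e]

/-- The element `t_a` of `𝔤`. -/
def tElt {k : ℕ} (a : Fin (k + 1) → ℝ) : lieG (2 * k + 1) := ⟨tMat a, tMat_mem a⟩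

theorem moment_coadG_fElt {k : ℕ} (a : Fin (k + 1) → ℝ) (g : Spin (2 * k + 1)) :
    moment _ (coadG _ g (fElt a)) = pr _ (adG _ g (tElt a)) := by
  rw [fElt, coadG_iota]; rfl

theorem lip_toMat_nullVec {m : ℕ} (g : Spin m) :
    lip (toMat m g *ᵥ nullVec m) (toMat m g *ᵥ nullVec m) = 0 := by
  rw [lip_mulVec (toMat_transpose_mul g), lip_nullVec]

theorem bord_adG {m : ℕ} (g : Spin m) (X : lieG m) (r : ℝ) :
    bord (adG m g X).1 (nullVec m) r = bord X.1 (toMat m g⁻¹ *ᵥ nullVec m) r := by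
  have h := bord_conj (toMat_transpose_mul g) (X := X.1) (X' := (adG m g X).1)
    (by rw [adG_apply, mul_assoc, toMat_inv_mul, mul_one]) (toMat m g⁻¹ *ᵥ nullVec m) r
  rwa [Matrix.mulVec_mulVec, toMat_mul_inv, Matrix.one_mulVec] at h

theorem bord_eq_of_pr_eq {m : ℕ} {X X' : lieG m} (h : pr m X = pr m X') (r : ℝ) :
    bord X.1 (nullVec m) r = bord X'.1 (nullVec m) r := by
  obtain ⟨h1, h2⟩ := pr_eq_iff.1 h
  have e := eq_nilX (D := X.1 - X'.1) ((lieG m).sub_mem X.2 X'.2)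
    (fun i j => by rw [Matrix.sub_apply, h1, sub_self]) (by rw [Matrix.sub_mulVec, h2, sub_self])
  rw [sub_eq_iff_eq_add'] at e
  rw [e, bord_add_nilX]

/-- The characteristic polynomial of the normal form of a point of the image. -/
theorem det_of_pr_adG {k : ℕ} {a : Fin (k + 1) → ℝ} {g : Spin (2 * k + 1)} {Y : so (2 * k + 1)}
    {β : Fin (2 * k + 1) → ℝ} (hYβ : Y.1 *ᵥ β = 0)
    (h : pr _ (adG _ g (tElt a)) = pr _ ⟨xMat Y.1 β 0, xMat_mem Y β 0⟩) {r : ℝ} (hr : r ≠ 0) :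
    4 * (β ⬝ᵥ β) * (r • 1 - Y.1).det
      = r * ∑ i, pairWeight a (toMat _ g⁻¹ *ᵥ nullVec _) i
          * ∏ j ∈ Finset.univ.erase i, (r ^ 2 + a j ^ 2) := by
  rw [← bord_tMat a (lip_toMat_nullVec g⁻¹) hr, ← bord_xMat hYβ hr]
  have h1 := bord_eq_of_pr_eq h r
  rw [bord_adG] at h1
  rw [← h1]
  rfl

theorem sign_of_pr_adG {k : ℕ} {a : Fin (k + 1) → ℝ} (ha : ∀ i : Fin k, 0 < a i.castSucc)
    {g : Spin (2 * k + 1)} {Y : so (2 * k + 1)} {β : Fin (2 * k + 1) → ℝ}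
    (h : pr _ (adG _ g (tElt a)) = pr _ ⟨xMat Y.1 β 0, xMat_mem Y β 0⟩) :
    SignType.sign (spacePf (skewExt Y.1 β)) = SignType.sign (a (Fin.last k)) := by
  obtain ⟨h1, h2⟩ := pr_eq_pr_xMat.1 h
  rw [← sign_spacePf a ha g (β := β) h2]
  congr 3
  ext i j
  exact (h1 i j).symm

theorem sign_pfaffian_zMat {k : ℕ} (Y : Matrix (Fin (2 * k + 1)) (Fin (2 * k + 1)) ℝ)
    {β : Fin (2 * k + 1) → ℝ} (hβ : β ≠ 0) :
    SignType.sign (pfaffian (zMat Y β)) = SignType.sign (spacePf (skewExt Y β)) := by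
  have h : 0 < (√(β ⬝ᵥ β))⁻¹ := inv_pos.2 (Real.sqrt_pos.2 (dotProduct_self_pos hβ))
  rw [pfaffian_zMat, spacePf_skewExt_smul, sign_mul, sign_pos h, one_mul]

/-- A null future vector is not an eigenvector of `t_a`. -/
theorem tMat_mulVec_ne {k : ℕ} {a : Fin (k + 1) → ℝ} (ha : ∀ i, a i ≠ 0)
    {u : Idx (2 * k + 1) → ℝ} (hu : lip u u = 0) (hu1 : u (.inr 1) ≠ 0) (c : ℝ) :
    tMat a *ᵥ u ≠ c • u := by
  intro h
  obtain ⟨h0, h1, h2⟩ := tMat_mulVec a u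
  rw [h] at h0 h1 h2
  have hc : c = 0 := by simpa [hu1] using h2
  subst hc
  rw [lip_eq_pairs, Finset.sum_eq_zero, zero_sub, neg_eq_zero, mul_self_eq_zero] at hu
  · exact hu1 hu
  · intro i _
    have e0 := h0 i
    have e1 := h1 i
    simp [ha i] at e0 e1
    simp [e0, e1]

/-- Were `β = 0`, `ν` would be an eigenvector of `Ad(g) t_a`, and `g⁻¹ν` one of `t_a`, against
`tMat_mulVec_ne`. So every point of the image can be normalized by `N`. -/
theorem exists_normalForm {k : ℕ} {a : Fin (k + 1) → ℝ} (ha : ∀ i, a i ≠ 0)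
    (g : Spin (2 * k + 1)) : ∃ (p : parabolic (2 * k + 1)) (Y : so (2 * k + 1))
      (β : Fin (2 * k + 1) → ℝ), β ≠ 0 ∧ Y.1 *ᵥ β = 0 ∧
      pr _ (adG _ ((p : Spin (2 * k + 1)) * g) (tElt a)) = pr _ ⟨xMat Y.1 β 0, xMat_mem Y β 0⟩ := by
  set X := adG _ g (tElt a) with hX
  have hβ : (fun i => (X.1 *ᵥ nullVec _) (.inl i) / 2) ≠ 0 := by
    intro h0
    have h1 : X.1 *ᵥ nullVec _ = X.1 (.inr 0) (.inr 1) • nullVec (2 * k + 1) := by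
      obtain ⟨z1, z2, z3⟩ := lieG_inr_inr X.2
      ext i
      rcases i with i | i
      · have := congrFun h0 i
        simp only [Pi.zero_apply, div_eq_zero_iff] at this
        rw [this.resolve_right two_ne_zero]
        simp [nullVec]
      · rw [mulVec_nullVec]
        fin_cases i <;> simp [nullVec, z1, z2, z3]
    have h2 : tMat a *ᵥ (toMat _ g⁻¹ *ᵥ nullVec _)
        = X.1 (.inr 0) (.inr 1) • (toMat _ g⁻¹ *ᵥ nullVec _) := by
      rw [← Matrix.mulVec_smul, ← h1, Matrix.mulVec_mulVec, Matrix.mulVec_mulVec, hX, adG_apply,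
        mul_assoc, ← mul_assoc, toMat_inv_mul, one_mul]
      rfl
    refine tMat_mulVec_ne ha (lip_toMat_nullVec g⁻¹) ?_ _ h2
    exact (toMat_future g⁻¹ (lip_nullVec _).le (by simp [nullVec])).ne'
  obtain ⟨p, Y, hY, hp⟩ := exists_normalize X hβ (fun i => by ring)
  exact ⟨p, Y, _, hβ, hY, by rw [adG_mul, ← hX, hp]⟩

end SpinOrbit

/-! ### The image of the moment map: both inclusions. -/

namespace SpinOrbit

/-- `G` acts transitively on the future null vectors. -/
theorem exists_toMat_mulVec_eq_nullVec {k : ℕ} {u : Idx (2 * k + 1) → ℝ} (hu : lip u u = 0)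
    (hu1 : 0 < u (.inr 1)) : ∃ g : Spin (2 * k + 1), toMat _ g *ᵥ u = nullVec _ := by
  set h := u (.inr 1) with hh
  obtain ⟨g, hg⟩ : ∃ g : Spin (2 * k + 1), toMat _ g *ᵥ u = h • nullVec _ := by
    -- The null vectors `u` and `h ν` have the same time coordinate, so `d` is purely spatial, and
    -- if nonzero the reflection in it exchanges them. The reflection in `e₁` fixes `ν` and makes
    -- the number of reflections even. A boost finally removes the factor `h`.
    set d := u - h • nullVec _ with hd
    have hdu : lip d u = lip d d / 2 := by
      have h1 := lip_comm u (nullVec (2 * k + 1))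
      rw [hd]
      simp only [lip_sub_left, lip_sub_right, lip_smul_left, lip_smul_right, hu, lip_nullVec]
      linear_combination h / 2 * h1
    have hdd : lip d d = ∑ i, d (.inl i) * d (.inl i) + d (.inr 0) * d (.inr 0) := by
      have : d (.inr 1) = 0 := by simp [hd, nullVec, hh]
      rw [lip_eq, this]
      ring
    by_cases h0 : lip d d = 0
    · refine ⟨1, ?_⟩
      have hs : 0 ≤ ∑ i, d (.inl i) * d (.inl i) := Finset.sum_nonneg fun _ _ => mul_self_nonneg _
      have hd0 : d = 0 := by
        have h1 : ∑ i, d (.inl i) * d (.inl i) = 0 := by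
          linarith [mul_self_nonneg (d (.inr 0))]
        have h2 : d (.inr 0) = 0 := mul_self_eq_zero.1 (by linarith)
        ext i
        rcases i with i | i
        · exact mul_self_eq_zero.1
            ((Finset.sum_eq_zero_iff_of_nonneg fun _ _ => mul_self_nonneg _).1 h1 i (Finset.mem_univ i))
        · fin_cases i
          · exact h2
          · simp [hd, nullVec, hh]
      rw [map_one, Matrix.one_mulVec]
      exact sub_eq_zero.1 hd0
    · have hpos : 0 < lip d d := lt_of_le_of_ne (by
        rw [hdd]
        exact add_nonneg (Finset.sum_nonneg fun _ _ => mul_self_nonneg _) (mul_self_nonneg _))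
        (Ne.symm h0)
      have hs : √(lip d d) ≠ 0 := (Real.sqrt_pos.2 hpos).ne'
      have hs2 : √(lip d d) * √(lip d d) = lip d d := Real.mul_self_sqrt hpos.le
      have h1 : lip ((√(lip d d))⁻¹ • d) ((√(lip d d))⁻¹ • d) = 1 := by
        rw [lip_smul_left, lip_smul_right]
        field_simp
        rw [sq, hs2]
      have h2 : lip (Pi.single (Sum.inl 0) 1 : Idx (2 * k + 1) → ℝ) (Pi.single (Sum.inl 0) 1) = 1 := by
        rw [lip_eq]; simp [Pi.single_apply]
      have h3 : lip (Pi.single (Sum.inl 0) 1) (nullVec (2 * k + 1)) = 0 := by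
        rw [lip_eq]; simp [nullVec]
      obtain ⟨g, hg⟩ := lrefl_mul_lrefl_mem h2 h1
      refine ⟨g, ?_⟩
      have h4 : lrefl ((√(lip d d))⁻¹ • d) *ᵥ u = h • nullVec _ := by
        rw [lrefl_mulVec, lip_smul_left, smul_smul, hdu]
        have : 2 * ((√(lip d d))⁻¹ * (lip d d / 2)) * (√(lip d d))⁻¹ = 1 := by
          field_simp
          rw [sq, hs2]
        rw [this, one_smul, hd, sub_sub_cancel]
      rw [hg, ← Matrix.mulVec_mulVec, h4, lrefl_mulVec, lip_smul_right, h3]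
      simp
  obtain ⟨q, hq⟩ := aGrp_mem (2 * k + 1) (-Real.log h)
  refine ⟨q * g, ?_⟩
  rw [map_mul, ← Matrix.mulVec_mulVec, hg, hq, Matrix.mulVec_smul, aGrp_mulVec_nullVec, smul_smul,
    Real.exp_neg, Real.exp_log hu1, mul_inv_cancel₀ hu1.ne', one_smul]

theorem depthOne_of_mem {m : ℕ} {𝒪 : Set (Module.Dual ℝ (lieP m))} {Y : so m} {β : Fin m → ℝ}
    (h : IsNormalForm 𝒪 Y β) : DepthOne 𝒪 := by
  intro hsub
  have h1 := hsub h.2.2 ⟨nilX β, nilX_mem_lieP β⟩ ⟨β, rfl⟩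
  have h2 := trace_mul_lieP (xMat_mem Y β 0) 0 0 β
  have e : Matrix.fromBlocks 0 0 0 0 + (0 : ℝ) • H0 m + nilX β = nilX β := by simp
  rw [e, xMat_mulVec_nullVec] at h2
  rw [pr_apply, h2] at h1
  have h3 := dotProduct_self_pos h.1
  simp [mul_left_comm _ (2 : ℝ), ← Finset.mul_sum] at h1
  exact h3.ne' h1

/-- Makes the chain uniform: `IsRegularParam` takes an absolute value of the last entry only.
Induction from the end of the chain shows that all other entries are positive. -/
theorem castSucc_pos_of_isRegularParam {k : ℕ} {a : Fin (k + 1) → ℝ} (ha : IsRegularParam a) :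
    ∀ i : Fin k, |a i.succ| < a i.castSucc := by
  have key : ∀ j : ℕ, ∀ i : Fin k, (i : ℕ) + j + 1 = k → |a i.succ| < a i.castSucc := by
    intro j
    induction j with
    | zero =>
      intro i hi
      have h := ha.1 i
      have e : i.succ = Fin.last k := Fin.ext (by simpa using hi)
      rwa [if_pos e, ← e] at h
    | succ j ih =>
      intro i hi
      have h := ha.1 i
      have e : i.succ ≠ Fin.last k := fun h => by
        have := congrArg Fin.val h
        simp at this
        omega
      rw [if_neg e] at h
      have h2 := ih ⟨i + 1, by omega⟩ (by simp; omega)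
      have e2 : (⟨i + 1, by omega⟩ : Fin k).castSucc = i.succ := rfl
      rw [e2] at h2
      rwa [abs_of_pos ((abs_nonneg _).trans_lt h2)]
  exact fun i => key (k - 1 - i) i (by omega)

theorem strictAnti_sq_of_isRegularParam {k : ℕ} {a : Fin (k + 1) → ℝ} (ha : IsRegularParam a) :
    StrictAnti fun i => a i ^ 2 := by
  refine Fin.strictAnti_iff_succ_lt.2 fun i => ?_
  have h := castSucc_pos_of_isRegularParam ha i
  rw [← sq_abs (a i.succ)]
  exact pow_lt_pow_left₀ h (abs_nonneg _) two_ne_zero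

theorem ne_zero_of_isRegularParam {k : ℕ} {a : Fin (k + 1) → ℝ} (ha : IsRegularParam a) (i) :
    a i ≠ 0 := by
  refine Fin.lastCases ?_ (fun i => ?_) i
  · exact abs_pos.1 ha.2
  · exact ((abs_nonneg _).trans_lt (castSucc_pos_of_isRegularParam ha i)).ne'

theorem interlaces_iff {k : ℕ} {a : Fin (k + 1) → ℝ} (ha : IsRegularParam a) {x : Fin k → ℝ} :
    Interlaces a x ↔ ∀ i : Fin k, |a i.succ| ≤ x i ∧ x i ≤ a i.castSucc := by
  have e : ∀ i : Fin k, (if i.succ = Fin.last k then |a (Fin.last k)| else a i.succ) = |a i.succ| := by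
    intro i
    split_ifs with h
    · rw [h]
    · obtain ⟨j, hj⟩ := Fin.exists_castSucc_eq.2 h
      rw [← hj, abs_of_pos ((abs_nonneg _).trans_lt (castSucc_pos_of_isRegularParam ha j))]
  simp only [Interlaces, e]
  exact forall_congr' fun i => and_comm

theorem interlaces_sqrt {k : ℕ} {a : Fin (k + 1) → ℝ} (ha : IsRegularParam a) {y : Fin k → ℝ}
    (h : ∀ i : Fin k, a i.succ ^ 2 ≤ y i ∧ y i ≤ a i.castSucc ^ 2) :
    Interlaces a fun i => √(y i) := by
  refine (interlaces_iff ha).2 fun i => ⟨?_, ?_⟩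
  · exact Real.abs_le_sqrt (h i).1
  · exact Real.sqrt_le_iff.2
      ⟨((abs_nonneg _).trans_lt (castSucc_pos_of_isRegularParam ha i)).le, (h i).2⟩

-- The orbit through the point itself is the witness. Its singular values are the roots of the zeros
-- of the weighted sum from `det_of_pr_adG`, and its sign is `sign_of_pr_adG`.
open Polynomial in
theorem image_subset {k : ℕ} {a : Fin (k + 1) → ℝ} (ha : IsRegularParam a)
    (g : Spin (2 * k + 1)) : ∃ 𝒪, (IsOrbitP 𝒪 ∧ DepthOne 𝒪 ∧
        HasPfaffianSign 𝒪 (SignType.sign (a (Fin.last k))) ∧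
        ∃ x : Fin k → ℝ, HasSingularValues 𝒪 x ∧ Interlaces a x) ∧
        pr _ (adG _ g (tElt a)) ∈ 𝒪 := by
  obtain ⟨p, Y, β, hβ, hYβ, hp⟩ := exists_normalForm (ne_zero_of_isRegularParam ha) g
  have hnf : IsNormalForm (orbitP (pr _ (adG _ g (tElt a)))) Y β :=
    ⟨hβ, hYβ, ⟨p, by simp only; rw [coadP_pr, ← adG_mul, hp]⟩⟩
  refine ⟨_, ⟨⟨_, rfl⟩, depthOne_of_mem hnf, ⟨Y, β, hnf, ?_⟩, ?_⟩, mem_orbitP_self _⟩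
  · rw [sign_pfaffian_zMat _ hβ]
    exact sign_of_pr_adG
      (fun i => (abs_nonneg _).trans_lt (castSucc_pos_of_isRegularParam ha i)) hp
  · set w := pairWeight a (toMat _ ((p : Spin (2 * k + 1)) * g)⁻¹ *ᵥ nullVec _) with hw
    set Q : ℝ[X] := ∑ i, C (w i) * ∏ j ∈ Finset.univ.erase i, (X + C (a j ^ 2)) with hQ
    have hQe : ∀ s, Q.eval s = ∑ i, w i * ∏ j ∈ Finset.univ.erase i, (s + a j ^ 2) := by
      intro s; simp [hQ, eval_finsetSum, eval_prod]
    have hc : 0 < 4 * (β ⬝ᵥ β) := mul_pos (by norm_num) (dotProduct_self_pos hβ)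
    obtain ⟨y, hy, -, hyQ, hsv⟩ := exists_singularValues Y.2 (Q := Q) hc.ne' (fun r hr => by
      rw [det_of_pr_adG hYβ hp hr, hQe])
    refine ⟨_, ⟨Y, β, hnf, hsv⟩, interlaces_sqrt ha fun i => ?_⟩
    refine interlace_of_weights (strictAnti_sq_of_isRegularParam ha) (w := w)
      (fun i => by rw [hw, pairWeight]; positivity) hy hc (fun t => ?_) i
    -- At `s = -a_t²` every summand except the one of index `t` has a vanishing factor.
    rw [← hyQ, hQe, Finset.sum_eq_single t]
    · exact congrArg _ (Finset.prod_congr rfl fun j _ => by ring)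
    · intro i _ hit
      rw [Finset.prod_eq_zero (i := t) (by simp [hit.symm]) (by ring), mul_zero]
    · simp

/-- Weights are realized by null vectors. -/
theorem exists_pairWeight_eq {k : ℕ} {a : Fin (k + 1) → ℝ} (ha : ∀ i, a i ≠ 0)
    {w : Fin (k + 1) → ℝ} (hw : ∀ i, 0 ≤ w i) (hw0 : w ≠ 0) :
    ∃ u : Idx (2 * k + 1) → ℝ, lip u u = 0 ∧ 0 < u (.inr 1) ∧ pairWeight a u = w := by
  have hsq : ∀ i, (√(w i) / a i) ^ 2 = w i / a i ^ 2 := fun i => by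
    rw [div_pow, Real.sq_sqrt (hw i)]
  have hnn : ∀ i ∈ Finset.univ, 0 ≤ w i / a i ^ 2 := fun i _ => div_nonneg (hw i) (sq_nonneg _)
  have hpos : 0 < ∑ i, w i / a i ^ 2 := by
    refine lt_of_le_of_ne (Finset.sum_nonneg hnn) fun h0 => hw0 (funext fun i => ?_)
    have := (Finset.sum_eq_zero_iff_of_nonneg hnn).1 h0.symm i (Finset.mem_univ i)
    exact (div_eq_zero_iff.1 this).resolve_right (pow_ne_zero 2 (ha i))
  -- In each pair only the modulus matters, so the second coordinate is taken to be zero. Nullity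
  -- dictates the time coordinate, which is positive because `w ≠ 0`.
  obtain ⟨u, hu0, hu1, hul⟩ : ∃ u : Idx (2 * k + 1) → ℝ,
      (∀ i, u (pairIdx (0, i)) = √(w i) / a i) ∧ (∀ i, u (pairIdx (1, i)) = 0) ∧
      u (.inr 1) = √(∑ i, w i / a i ^ 2) := by
    refine ⟨Sum.elim (fun p => ![√(w ((spacePairs k).symm p).2) / a ((spacePairs k).symm p).2, 0]
      ((spacePairs k).symm p).1) (fun _ => √(∑ i, w i / a i ^ 2)) ∘ (spaceTime _).symm, ?_, ?_, ?_⟩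
    · intro i; simp [pairIdx]
    · intro i; simp [pairIdx]
    · rw [← spaceTime_inr 0]; simp
  refine ⟨u, ?_, ?_, ?_⟩
  · rw [lip_eq_pairs, hul, Real.mul_self_sqrt hpos.le, sub_eq_zero]
    refine Finset.sum_congr rfl fun i _ => ?_
    rw [hu0, hu1, ← hsq]
    ring
  · rw [hul]; exact Real.sqrt_pos.2 hpos
  · ext i
    rw [pairWeight, hu0, hu1, hsq]
    have := ha i
    field_simp
    ring

theorem pairWeight_smul {k : ℕ} (a : Fin (k + 1) → ℝ) (c : ℝ) (u : Idx (2 * k + 1) → ℝ) (i) :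
    pairWeight a (c • u) i = c ^ 2 * pairWeight a u i := by
  simp only [pairWeight, Pi.smul_apply, smul_eq_mul]
  ring

/-- Elements of `P` scale `ν`, so on a `P`-orbit the bordered determinant is defined up to a nonzero
factor. This is needed because `HasPfaffianSign` and `HasSingularValues` may be witnessed by
different normal forms. -/
theorem charpoly_eq_of_normalForms {k : ℕ} {φ : Module.Dual ℝ (lieP (2 * k + 1))}
    {Y Y' : so (2 * k + 1)} {β β' : Fin (2 * k + 1) → ℝ} (h : IsNormalForm (orbitP φ) Y β)
    (h' : IsNormalForm (orbitP φ) Y' β') : Y.1.charpoly = Y'.1.charpoly := by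
  have h1 := h'.2.2
  rw [← orbitP_eq_of_mem h.2.2] at h1
  obtain ⟨p, hp⟩ := h1
  obtain ⟨c, hc, hpν⟩ := parabolic_inv_mulVec p.2
  simp only at hp
  rw [coadP_pr] at hp
  refine charpoly_eq_of_mul_det (c := c ^ 2 * (4 * (β ⬝ᵥ β))) (c' := 4 * (β' ⬝ᵥ β'))
    (mul_ne_zero (pow_ne_zero 2 hc) (mul_pos four_pos (dotProduct_self_pos h.1)).ne') fun r hr => ?_
  have h2 := bord_eq_of_pr_eq hp r
  rw [bord_adG, hpν, bord_smul] at h2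
  rw [mul_assoc, ← bord_xMat h.2.1 hr, ← bord_xMat h'.2.1 hr, ← h2]
  ring

theorem subset_image {k : ℕ} {a : Fin (k + 1) → ℝ} (ha : IsRegularParam a)
    {φ : Module.Dual ℝ (lieP (2 * k + 1))}
    (hpf : HasPfaffianSign (orbitP φ) (SignType.sign (a (Fin.last k)))) {x : Fin k → ℝ}
    (hsv : HasSingularValues (orbitP φ) x) (hx : Interlaces a x) :
    ∃ g, pr _ (adG _ g (tElt a)) = φ := by
  obtain ⟨Y₁, β₁, hn₁, hs₁⟩ := hpf
  obtain ⟨Y₂, β₂, hn₂, hs₂⟩ := hsv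
  have hch := charpoly_eq_of_normalForms hn₁ hn₂
  rw [sign_pfaffian_zMat _ hn₁.1] at hs₁
  rw [interlaces_iff ha] at hx
  obtain ⟨w, hw, hwx⟩ := exists_weights (strictAnti_sq_of_isRegularParam ha) (y := fun i => x i ^ 2)
    (fun i => ⟨sq_le_sq' (by linarith [neg_abs_le (a i.succ), (hx i).1])
      ((le_abs_self _).trans (hx i).1),
      pow_le_pow_left₀ ((abs_nonneg _).trans (hx i).1) (hx i).2 2⟩) one_pos
  -- At `s = -1` the right-hand side is `∏ (x_l² + 1) > 0`.
  have hw0 : w ≠ 0 := by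
    rintro rfl
    have h1 := hwx (-1)
    simp only [Pi.zero_apply, zero_mul, Finset.sum_const_zero, one_mul] at h1
    exact (Finset.prod_pos fun i _ => by linarith [sq_nonneg (x i)]).ne h1
  obtain ⟨u, hu, hu1, huw⟩ := exists_pairWeight_eq (ne_zero_of_isRegularParam ha) hw hw0
  obtain ⟨g, hg⟩ := exists_toMat_mulVec_eq_nullVec hu hu1
  obtain ⟨p, Y, β, hβ, hYβ, hp⟩ := exists_normalForm (ne_zero_of_isRegularParam ha) g
  have hgu : toMat _ g⁻¹ *ᵥ nullVec _ = u := by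
    rw [← hg, Matrix.mulVec_mulVec, toMat_inv_mul, Matrix.one_mulVec]
  obtain ⟨c, hc, hpν⟩ := parabolic_inv_mulVec p.2
  have hcν : toMat _ ((p : Spin (2 * k + 1)) * g)⁻¹ *ᵥ nullVec _ = c • u := by
    rw [mul_inv_rev, map_mul, ← Matrix.mulVec_mulVec, hpν, Matrix.mulVec_smul, hgu]
  have hchY : Y.1.charpoly = Y₁.1.charpoly := by
    refine charpoly_eq_of_mul_det (c := 4 * (β ⬝ᵥ β)) (c' := c ^ 2)
      (mul_pos four_pos (dotProduct_self_pos hβ)).ne' fun r hr => ?_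
    rw [det_of_pr_adG hYβ hp hr, hcν, ← eval_charpoly_eq_det, hch, eval_charpoly_eq_det,
      det_of_singularValues Y₂.2 hs₂]
    simp only [pairWeight_smul, huw]
    have h1 := hwx (-(r ^ 2))
    have h2 : ∀ i, ∏ j ∈ Finset.univ.erase i, (a j ^ 2 - -(r ^ 2))
        = ∏ j ∈ Finset.univ.erase i, (r ^ 2 + a j ^ 2) := fun i =>
      Finset.prod_congr rfl fun j _ => by ring
    have h3 : ∏ l, (x l ^ 2 - -(r ^ 2)) = ∏ l, (r ^ 2 + x l ^ 2) :=
      Finset.prod_congr rfl fun j _ => by ring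
    simp only [h2, h3] at h1
    simp only [mul_assoc, ← Finset.mul_sum]
    rw [h1]
    ring
  have hsY := sign_of_pr_adG
    (fun i => (abs_nonneg _).trans_lt (castSucc_pos_of_isRegularParam ha i)) hp
  obtain ⟨q, hq⟩ := exists_parabolic_of_charpoly_eq hYβ hn₁.2.1 hchY (hsY.trans hs₁.symm)
    (by rw [← sign_ne_zero, hs₁, sign_ne_zero]; exact ne_zero_of_isRegularParam ha _)
  have h1 : coadP _ (q * p) (pr _ (adG _ g (tElt a)))
      = pr _ ⟨xMat Y₁.1 β₁ 0, xMat_mem Y₁ β₁ 0⟩ := by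
    rw [map_mul, Module.End.mul_apply, coadP_pr, ← adG_mul, hp, coadP_pr, hq]
  have h2 : φ ∈ orbitP (pr _ (adG _ g (tElt a))) := by
    rw [← orbitP_eq_of_mem ⟨q * p, h1⟩, orbitP_eq_of_mem hn₁.2.2]
    exact mem_orbitP_self φ
  obtain ⟨s, hs⟩ := h2
  exact ⟨s * g, by rw [adG_mul, ← coadP_pr]; exact hs⟩

end SpinOrbit

/-! ### The centralizer of `t_a`, and separation of `P`-orbits. -/

namespace SpinOrbit

/-- For `z = x + iy` and `z' = x' + iy'`, the rotation is `c + is = z' / z`, or the identity when `z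
= 0`. -/
theorem exists_rotation {x y x' y' : ℝ} (h : x ^ 2 + y ^ 2 = x' ^ 2 + y' ^ 2) :
    ∃ c s : ℝ, c ^ 2 + s ^ 2 = 1 ∧ c * x - s * y = x' ∧ s * x + c * y = y' := by
  by_cases h0 : x ^ 2 + y ^ 2 = 0
  · have hx : x = 0 := by nlinarith [sq_nonneg x, sq_nonneg y]
    have hy : y = 0 := by nlinarith [sq_nonneg x, sq_nonneg y]
    have hx' : x' = 0 := by nlinarith [sq_nonneg x', sq_nonneg y']
    have hy' : y' = 0 := by nlinarith [sq_nonneg x', sq_nonneg y']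
    exact ⟨1, 0, by norm_num, by rw [hx, hx', hy]; ring, by rw [hx, hy, hy']; ring⟩
  · refine ⟨(x * x' + y * y') / (x ^ 2 + y ^ 2), (x * y' - y * x') / (x ^ 2 + y ^ 2), ?_, ?_, ?_⟩
    · field_simp
      linear_combination (-(x ^ 2 + y ^ 2)) * h
    · field_simp
      ring
    · field_simp
      ring

/-- The block diagonal rotations. -/
def torusMat {k : ℕ} (c s : Fin (k + 1) → ℝ) :
    Matrix (Fin (2 * k + 1) ⊕ Fin 1) (Fin (2 * k + 1) ⊕ Fin 1) ℝ :=
  Matrix.reindex (spacePairs k) (spacePairs k)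
    (Matrix.blockDiagonal fun i => !![c i, -s i; s i, c i])

theorem torusMat_mulVec {k : ℕ} (c s : Fin (k + 1) → ℝ) (v : Idx (2 * k + 1) → ℝ) :
    (∀ i, (kGrp (torusMat c s) *ᵥ v) (pairIdx (0, i))
      = c i * v (pairIdx (0, i)) - s i * v (pairIdx (1, i))) ∧
    (∀ i, (kGrp (torusMat c s) *ᵥ v) (pairIdx (1, i))
      = s i * v (pairIdx (0, i)) + c i * v (pairIdx (1, i))) := by
  have key : ∀ b i, (kGrp (torusMat c s) *ᵥ v) (pairIdx (b, i))
      = ∑ j, ((!![c i, -s i; s i, c i] : Matrix (Fin 2) (Fin 2) ℝ) b j) * v (pairIdx (j, i)) := by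
    intro b i
    rw [pairIdx, kGrp_mulVec_inl, torusMat, Matrix.reindex_apply, Matrix.submatrix_mulVec_equiv]
    simp only [Function.comp_def, Equiv.symm_apply_apply, Equiv.symm_symm, Matrix.mulVec,
      dotProduct, Fintype.sum_prod_type, Matrix.blockDiagonal_apply]
    simp [pairIdx]
  exact ⟨fun i => by simp [key, sub_eq_add_neg], fun i => by simp [key]⟩

theorem torusMat_mem {k : ℕ} {c s : Fin (k + 1) → ℝ} (h : ∀ i, c i ^ 2 + s i ^ 2 = 1) :
    kGrp (torusMat c s) ∈ MonoidHom.mrange (toMat (2 * k + 1)) := by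
  refine kGrp_mem ?_ ?_
  · rw [torusMat, Matrix.transpose_reindex, Matrix.blockDiagonal_transpose, Matrix.reindex_apply,
      Matrix.reindex_apply, Matrix.submatrix_mul_equiv, ← Matrix.blockDiagonal_mul]
    have e : (fun i => !![c i, -s i; s i, c i]ᵀ * !![c i, -s i; s i, c i])
        = (1 : Fin (k + 1) → Matrix (Fin 2) (Fin 2) ℝ) := by
      funext i
      have := h i
      ext x y
      fin_cases x <;> fin_cases y <;> simp [Matrix.mul_apply] <;> linarith
    rw [e, Matrix.blockDiagonal_one, Matrix.submatrix_one_equiv]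
  · rw [torusMat, Matrix.det_reindex_self, Matrix.det_blockDiagonal]
    refine Finset.prod_eq_one fun i _ => ?_
    rw [Matrix.det_fin_two_of]
    linarith [h i]

theorem torusMat_mul_tMat {k : ℕ} (a c s : Fin (k + 1) → ℝ) :
    kGrp (torusMat c s) * tMat a = tMat a * kGrp (torusMat c s) := by
  refine Matrix.ext_of_mulVec_single fun j => ?_
  rw [← Matrix.mulVec_mulVec, ← Matrix.mulVec_mulVec]
  set v : Idx (2 * k + 1) → ℝ := Pi.single j 1
  obtain ⟨h0, h1⟩ := torusMat_mulVec c s v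
  obtain ⟨h0', h1'⟩ := torusMat_mulVec c s (tMat a *ᵥ v)
  obtain ⟨t0, t1, t2⟩ := tMat_mulVec a v
  obtain ⟨t0', t1', t2'⟩ := tMat_mulVec a (kGrp (torusMat c s) *ᵥ v)
  refine idx_ext_pairs (fun i => ?_) (fun i => ?_) ?_
  · rw [h0', t0', h1, t0, t1]; ring
  · rw [h1', t1', h0, t0, t1]; ring
  · rw [kGrp_mulVec_last, t2, t2']

/-- Null vectors with the same weights are related by the centralizer of `t_a`. -/
theorem exists_centralizer {k : ℕ} {a : Fin (k + 1) → ℝ} (ha : ∀ i, a i ≠ 0)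
    {u v : Idx (2 * k + 1) → ℝ} (hu : lip u u = 0) (hv : lip v v = 0) (hu1 : 0 < u (.inr 1))
    (hv1 : 0 < v (.inr 1)) (h : ∀ i, pairWeight a u i = pairWeight a v i) :
    ∃ g : Spin (2 * k + 1), toMat _ g *ᵥ u = v ∧ adG _ g (tElt a) = tElt a := by
  have hz : ∀ i, u (pairIdx (0, i)) ^ 2 + u (pairIdx (1, i)) ^ 2
      = v (pairIdx (0, i)) ^ 2 + v (pairIdx (1, i)) ^ 2 := fun i =>
    mul_right_cancel₀ (pow_ne_zero 2 (ha i)) (h i)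
  choose c s hcs h0 h1 using fun i => exists_rotation (hz i)
  obtain ⟨g, hg⟩ := torusMat_mem hcs
  obtain ⟨t0, t1⟩ := torusMat_mulVec c s u
  -- Nullity determines the square of the time coordinate from the moduli; both coordinates are
  -- positive.
  have hlast : u (.inr 1) = v (.inr 1) := by
    rw [lip_eq_pairs] at hu hv
    have e : ∑ i, (u (pairIdx (0, i)) * u (pairIdx (0, i)) + u (pairIdx (1, i)) * u (pairIdx (1, i)))
        = ∑ i, (v (pairIdx (0, i)) * v (pairIdx (0, i)) + v (pairIdx (1, i)) * v (pairIdx (1, i))) :=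
      Finset.sum_congr rfl fun i _ => by linarith [hz i]
    rw [← pow_left_inj₀ hu1.le hv1.le two_ne_zero]
    linarith
  refine ⟨g, ?_, ?_⟩
  · rw [hg]
    refine idx_ext_pairs (fun i => by rw [t0, h0]) (fun i => by rw [t1, h1]) ?_
    rw [kGrp_mulVec_last, hlast]
  · ext1
    change toMat _ g * tMat a * toMat _ g⁻¹ = tMat a
    rw [hg, torusMat_mul_tMat, ← hg, mul_assoc, toMat_mul_inv, mul_one]

-- The products over `j ≠ i` form a Lagrange basis: evaluating at `-b i` isolates the weight `w i`.
-- Since the hypothesis concerns `r²`, it is first extended from positive arguments to all arguments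
-- as a polynomial identity.
open Polynomial in
theorem pairWeight_eq_of_sum_eq {k : ℕ} {b : Fin (k + 1) → ℝ} (hb : Function.Injective b)
    {w w' : Fin (k + 1) → ℝ}
    (h : ∀ r : ℝ, r ≠ 0 → ∑ i, w i * ∏ j ∈ Finset.univ.erase i, (r ^ 2 + b j)
      = ∑ i, w' i * ∏ j ∈ Finset.univ.erase i, (r ^ 2 + b j)) (i : Fin (k + 1)) : w i = w' i := by
  set P : (Fin (k + 1) → ℝ) → ℝ[X] := fun w =>
    ∑ i, C (w i) * ∏ j ∈ Finset.univ.erase i, (X + C (b j)) with hP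
  have he : ∀ w s, (P w).eval s = ∑ i, w i * ∏ j ∈ Finset.univ.erase i, (s + b j) := by
    intro w s; simp [hP, eval_finsetSum, eval_prod]
  have hPP : P w = P w' := by
    refine Polynomial.eq_of_infinite_eval_eq _ _ ((Set.Ioi_infinite (0 : ℝ)).mono fun s hs => ?_)
    have hs' : 0 < s := hs
    have := h (√s) (Real.sqrt_pos.2 hs').ne'
    rw [Real.sq_sqrt hs'.le] at this
    rwa [Set.mem_ofPred_eq, he, he]
  have key : ∀ w, (P w).eval (-b i) = w i * ∏ j ∈ Finset.univ.erase i, (-b i + b j) := by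
    intro w
    rw [he, Finset.sum_eq_single i]
    · intro t _ hti
      rw [Finset.prod_eq_zero (i := i) (by simp [hti.symm]) (by ring), mul_zero]
    · simp
  have h1 := key w
  rw [hPP, key] at h1
  refine (mul_right_cancel₀ (Finset.prod_ne_zero_iff.2 fun j hj h0 => ?_) h1).symm
  exact Finset.ne_of_mem_erase hj (hb (by linarith))

/-- Equal restrictions have equal bordered determinants, so `g⁻¹ν` and `g'⁻¹ν` have equal weights,
and some `s` centralizing `t_a` carries one to the other. Then `g' s g⁻¹` fixes `ν`, hence lies in
`P`. -/
theorem exists_parabolic_of_pr_eq {k : ℕ} {a : Fin (k + 1) → ℝ} (ha : IsRegularParam a)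
    {g g' : Spin (2 * k + 1)} (h : pr _ (adG _ g (tElt a)) = pr _ (adG _ g' (tElt a))) :
    ∃ p : parabolic (2 * k + 1), adG _ p (adG _ g (tElt a)) = adG _ g' (tElt a) := by
  have hfut : ∀ g : Spin (2 * k + 1), 0 < (toMat _ g⁻¹ *ᵥ nullVec (2 * k + 1)) (.inr 1) :=
    fun g => toMat_future g⁻¹ (lip_nullVec _).le (by simp [nullVec])
  have hw := pairWeight_eq_of_sum_eq (strictAnti_sq_of_isRegularParam ha).injective
    (w := pairWeight a (toMat _ g⁻¹ *ᵥ nullVec _)) (w' := pairWeight a (toMat _ g'⁻¹ *ᵥ nullVec _))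
    (fun r hr => by
      rw [← bord_tMat a (lip_toMat_nullVec g⁻¹) hr, ← bord_tMat a (lip_toMat_nullVec g'⁻¹) hr]
      have h1 := bord_eq_of_pr_eq h r
      rwa [bord_adG, bord_adG] at h1)
  obtain ⟨s, hs, hst⟩ := exists_centralizer (ne_zero_of_isRegularParam ha)
    (lip_toMat_nullVec g⁻¹) (lip_toMat_nullVec g'⁻¹) (hfut g) (hfut g') hw
  refine ⟨⟨g' * s * g⁻¹, mem_parabolic_of_mulVec (c := 1) ?_⟩, ?_⟩
  · rw [map_mul, map_mul, ← Matrix.mulVec_mulVec, ← Matrix.mulVec_mulVec, hs, Matrix.mulVec_mulVec,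
      toMat_mul_inv, Matrix.one_mulVec, one_smul]
  · rw [← adG_mul, inv_mul_cancel_right, adG_mul, hst]

end SpinOrbit

/-! ### Assembly of the image statement and the statements on `P`-orbits. -/

theorem propositionP (k : ℕ) (a : Fin (k + 1) → ℝ) (ha : IsRegularParam a) :
    -- the image of the moment map on the orbit of `f_a`
    (moment (2 * k + 1) '' orbitG (fElt a) =
      ⋃₀ {𝒪 | IsOrbitP 𝒪 ∧ DepthOne 𝒪 ∧
        HasPfaffianSign 𝒪 (SignType.sign (a (Fin.last k))) ∧
        ∃ x : Fin k → ℝ, HasSingularValues 𝒪 x ∧ Interlaces a x}) ∧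
    -- the moment map sends `P`-orbits onto `P`-orbits, and different ones to different ones
    (∀ f ∈ orbitG (fElt a),
      moment (2 * k + 1) '' orbitPG f = orbitP (moment (2 * k + 1) f)) ∧
    (∀ f₁ ∈ orbitG (fElt a), ∀ f₂ ∈ orbitG (fElt a), orbitPG f₁ ≠ orbitPG f₂ →
      orbitP (moment (2 * k + 1) f₁) ≠ orbitP (moment (2 * k + 1) f₂)) := by
  refine ⟨?_, fun f _ => moment_image_orbitPG f, ?_⟩
  · ext φ
    constructor
    · rintro ⟨_, ⟨g, rfl⟩, rfl⟩
      obtain ⟨𝒪, h𝒪, hmem⟩ := image_subset ha g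
      refine ⟨𝒪, h𝒪, ?_⟩
      simp only
      rwa [moment_coadG_fElt]
    · rintro ⟨𝒪, ⟨⟨ψ, rfl⟩, -, hpf, x, hsv, hx⟩, hφ⟩
      rw [← orbitP_eq_of_mem hφ] at hpf hsv
      obtain ⟨g, hg⟩ := subset_image ha hpf hsv hx
      exact ⟨_, ⟨g, rfl⟩, by rw [← hg]; exact moment_coadG_fElt a g⟩
  · rintro _ ⟨g, rfl⟩ _ ⟨g', rfl⟩ hne heq
    refine hne ?_
    simp only [moment_coadG_fElt] at heq
    have hmem := mem_orbitP_self (pr _ (adG _ g' (tElt a)))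
    rw [← heq] at hmem
    obtain ⟨p, hp⟩ := hmem
    simp only at hp
    rw [coadP_pr, ← adG_mul] at hp
    obtain ⟨q, hq⟩ := exists_parabolic_of_pr_eq ha hp
    rw [← orbitPG_eq_of_mem]
    refine ⟨q * p, ?_⟩
    have e : ∀ s : Spin (2 * k + 1), coadG _ s (fElt a) = iota _ (adG _ s (tElt a)) :=
      fun s => coadG_iota s _
    simp only [e]
    rw [coadG_iota, Subgroup.coe_mul, adG_mul, ← adG_mul p.1 g, hq]
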